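/- Fix a constant $p\in(0,1)$, an integer $r\ge 1$, distinct positive integers $k_1,\dots,k_r$ and positive integers $m_1,\dots,m_r$. Let $G(n,p)$ be the binomial random graph on $n$ labelled vertices, in which every pair of vertices is an edge independently with probability $p$. For integers $k,j\ge 1$ let $\Delta^j_{n,k}$ be the $j$-th largest value, counted with multiplicity, of the number of common neighbours in $G(n,p)$ of the vertices of $U$, where $U$ ranges over all $k$-element sets of vertices. (This is defined for all $n$ with $\binom nk\ge j$; for other $n$ put, say, $\Delta^j_{n,k}=0$.) Set $$a_{n,k}=np^k+\sqrt{2kp^k(1-p^k)\,n\ln n}\left(1-\frac{\ln(k!)}{2k\ln n}-\frac{\ln[4\pi k\ln n]}{4k\ln n}\right),\qquad b_{n,k}=\sqrt{\frac{p^k(1-p^k)\,n}{2k\ln n}},$$ and, for $1\le i\le r$ and $1\le j\le m_i$, $$\xi_{i,j}=\xi_{i,j}(n)=\frac{\Delta^{j}_{n,k_i}-a_{n,k_i}}{b_{n,k_i}}.$$ Then, as $n\to\infty$, the random vector $\xi(n)=(\xi_{i,j})_{1\le i\le r,\,1\le j\le m_i}$ converges in distribution to a random vector in $\mathbb R^{m_1+\dots+m_r}$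 whose distribution is absolutely continuous with respect to Lebesgue measure, with probability density $$\prod_{i=1}^r p_i(x_{i,1},\dots,x_{i,m_i}),\qquad p_i(x_1,\dots,x_{m_i})=e^{-x_1}e^{-x_2}\cdots e^{-x_{m_i}}\,e^{-e^{-x_{m_i}}}\,I(x_1\ge x_2\ge\dots\ge x_{m_i}),$$ where $I$ is the indicator function. -/

import Mathlib

namespace CommonNbr

open MeasureTheory

/-- The number of common neighbours in `G` of the vertices of `U`. -/
noncomputable def deg {V : Type*} (G : SimpleGraph V) (U : Finset V) : ℕ :=
  Set.ncard {v : V | ∀ u ∈ U, G.Adj u v}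

/-- The `j`-th largest (`j = 1, 2, …`) of the numbers `deg G U`, where `U` runs over all `k`-element
sets of vertices of `G` and equal values are counted with multiplicity: the largest `d` such that at
least `j` of the `k`-sets have at least `d` common neighbours. (It is `0` if there are fewer than `j`
such sets.) -/
noncomputable def jthMax {V : Type*} (G : SimpleGraph V) (k j : ℕ) : ℕ :=
  sSup {d : ℕ | j ≤ Set.ncard {U : Finset V | U.card = k ∧ d ≤ deg G U}}

/-- The centering constant `a_{n,k}`. -/
noncomputable def center (p : ℝ) (n k : ℕ) : ℝ :=
  n * p ^ k + Real.sqrt (2 * k * p ^ k * (1 - p ^ k) * n * Real.log n) *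
    (1 - Real.log (k.factorial : ℝ) / (2 * k * Real.log n)
      - Real.log (4 * Real.pi * k * Real.log n) / (4 * k * Real.log n))

/-- The normalising constant `b_{n,k}`. -/
noncomputable def scale (p : ℝ) (n k : ℕ) : ℝ :=
  Real.sqrt (p ^ k * (1 - p ^ k) * n / (2 * k * Real.log n))

/-- The vector of the rescaled numbers `(Δ - a_{n,k_i}) / b_{n,k_i}`, where `Δ` is the `j`-th largest
number of common neighbours of a `k_i`-set, for `1 ≤ j ≤ m_i`. The index `j : Fin (m i)` is
zero-based, hence the `j + 1`. -/
noncomputable def rescaledMaxima {r : ℕ} (p : ℝ) (k m : Fin r → ℕ) (n : ℕ)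
    (G : SimpleGraph (Fin n)) (ij : Σ i : Fin r, Fin (m i)) : ℝ :=
  ((jthMax G (k ij.1) (ij.2 + 1) : ℝ) - center p n (k ij.1)) / scale p n (k ij.1)

/-- The function
`e^{-y_1} ⋯ e^{-y_m} e^{-e^{-y_m}} I(y_1 ≥ … ≥ y_m)` on `ℝ^m`, for `m ≥ 1`. -/
noncomputable def blockDensity {m : ℕ} (hm : 0 < m) (y : Fin m → ℝ) : ℝ :=
  Set.indicator {z : Fin m → ℝ | Antitone z}
    (fun z => (∏ j, Real.exp (-z j)) *
      Real.exp (-Real.exp (-z ⟨m - 1, Nat.sub_lt hm Nat.one_pos⟩))) y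

/-- The measure on `ℝ^{m_1 + ⋯ + m_r}` whose density with respect to Lebesgue measure is the product
of the block densities. -/
noncomputable def limitLaw {r : ℕ} (m : Fin r → ℕ) (hm : ∀ i, 0 < m i) :
    Measure ((Σ i : Fin r, Fin (m i)) → ℝ) :=
  volume.withDensity fun x =>
    ENNReal.ofReal (∏ i, blockDensity (hm i) fun j => x ⟨i, j⟩)

end CommonNbr

open MeasureTheory ProbabilityTheory Filter Topology


/-! The centring and scaling are chosen so that the expected number of `k`-sets with more than
`a_{n,k} + b_{n,k} x` common neighbours tends to `e^{-x}` (`tendsto_binTail_center`, a moderate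
deviation estimate for the binomial tail). The extremal sets behave like independent Poisson
processes of intensity `e^{-x} dx`, one for each `k_i`, and the limit law is that of the largest
points of these processes.

Only lower bounds are needed. The limit law has total mass one, so by the portmanteau theorem it
suffices that `liminf P(ξ(n) ∈ O)` is at least the limiting mass of every open `O`. An open set is
filled from inside by small grid boxes. Off a null set of ties, a small box has disjoint decreasing
intervals in every block.

For such a box, sum over families `U` of pairwise disjoint sets the probability that each `U a` has
its degree in the prescribed interval while every other `k_i`-set stays below the lowest interval of
its block. These events are disjoint for different `U` and force the maxima into the box.

To bound one such probability (`le_measureReal_familyEvent`), let `S` be the union of the family and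
`D` its complement. The counts of the `U a` inside `D` are independent binomials. Each remaining
`k_i`-set `X` is of one of three kinds. If `X ⊆ S`, then `X` being extremal together with all the `U
a` costs an additional power of `n`, by a joint Chernoff bound (`eventually_prob_overlap_le`). If
`X` meets both `S` and `D`, condition on the edges between `S` and `D`: an extension from `s` to `k`
vertices has conditional probability at most `n^{-(k-s)-c}` (`eventually_prob_extension_le`), which
beats the number of extensions. If `X ⊆ D`, only edges inside `D` matter, which are independent of
the rest, and the Harris inequality bounds the probability that no such `X` is extremal from below
by a product tending to `e^{-e^{-z}}`. The number of families is asymptotic to `∏ n^{k}/k!`, which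
turns the product of binomial probabilities into `∏ (e^{-x} - e^{-x'})`. -/

instance SimpleGraph.discreteMeasurableSpace {V : Type*} [Finite V] :
    DiscreteMeasurableSpace (SimpleGraph V) := by
  have : MeasurableSingletonClass (SimpleGraph V) := by
    refine ⟨fun G => ?_⟩
    have h : ({G} : Set (SimpleGraph V)) = ⋂ u : V, ⋂ v : V, {H | H.Adj u v ↔ G.Adj u v} := by
      ext H
      simp only [Set.mem_singleton_iff, Set.mem_iInter, Set.mem_ofPred_eq]
      exact ⟨fun h => by simp [h], fun h => by ext u v; exact h u v⟩
    rw [h]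
    refine .iInter fun u => .iInter fun v => ?_
    have hm : Measurable fun H : SimpleGraph V => (H.Adj u v ↔ G.Adj u v) := by fun_prop
    exact hm.setOf
  infer_instance

namespace CommonNbr

/-! ### Independence of events determined by disjoint sets of edges. -/

section Independence

variable {V : Type*}

/-- The quantity `F` is determined by the edges in `E`. -/
def DependsOnEdges {α : Type*} (F : SimpleGraph V → α) (E : Set (Sym2 V)) : Prop :=
  ∀ G G' : SimpleGraph V, (∀ e ∈ E, e ∈ G.edgeSet ↔ e ∈ G'.edgeSet) → F G = F G'

lemma DependsOnEdges.mono {α : Type*} {F : SimpleGraph V → α} {E E' : Set (Sym2 V)}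
    (h : DependsOnEdges F E) (hE : E ⊆ E') : DependsOnEdges F E' :=
  fun G G' hG => h G G' fun e he => hG e (hE he)

lemma DependsOnEdges.comp {α β : Type*} {F : SimpleGraph V → α} {E : Set (Sym2 V)}
    (h : DependsOnEdges F E) (g : α → β) : DependsOnEdges (fun G => g (F G)) E :=
  fun G G' hG => congrArg g (h G G' hG)

lemma DependsOnEdges.inter {F H : Set (SimpleGraph V)} {E : Set (Sym2 V)}
    (hF : DependsOnEdges (· ∈ F) E) (hH : DependsOnEdges (· ∈ H) E) :
    DependsOnEdges (· ∈ F ∩ H) E := fun G G' hG =>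
  congrArg₂ And (hF G G' hG) (hH G G' hG)

lemma DependsOnEdges.forall {ι : Sort*} {F : ι → SimpleGraph V → Prop} {E : Set (Sym2 V)}
    (hF : ∀ i, DependsOnEdges (F i) E) : DependsOnEdges (fun G => ∀ i, F i G) E :=
  fun G G' hG => forall_congr fun i => hF i G G' hG

variable [Finite V] {p : unitInterval}

/-- The random graph restricted to different edges is independent. -/
lemma iIndepFun_mem_edgeSet :
    iIndepFun (fun (e : Sym2 V) (G : SimpleGraph V) => e ∈ G.edgeSet)
      (SimpleGraph.binomialRandom V p) := by
  -- The random graph is the image of a product measure with one coordinate per pair. The presence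
  -- of `e` is a function of the coordinate `e` alone, so independence is inherited from the
  -- coordinates.
  let Q : Measure (Sym2 V → Prop) := Measure.infinitePi fun e : Sym2 V =>
      unitInterval.toNNReal p • Measure.dirac (e ∈ (Sym2.diagSetᶜ : Set (Sym2 V)))
        + unitInterval.toNNReal (unitInterval.symm p) • Measure.dirac False
  have hm : Measurable fun f : Sym2 V → Prop => SimpleGraph.fromEdgeSet {i | f i} :=
    SimpleGraph.measurable_fromEdgeSet.comp MeasurableEquiv.setOfPred.measurable
  have hP : SimpleGraph.binomialRandom V p = Q.map
      (fun f => SimpleGraph.fromEdgeSet {i | f i}) := by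
    rw [SimpleGraph.binomialRandom_eq_map, setBernoulli_eq_map, Measure.map_map]
    · rfl
    · exact SimpleGraph.measurable_fromEdgeSet
    · exact MeasurableEquiv.setOfPred.measurable
  have hQ : iIndepFun (fun (e : Sym2 V) (f : Sym2 V → Prop) => f e ∧ ¬ e.IsDiag) Q :=
    iIndepFun_infinitePi (X := fun (e : Sym2 V) (f : Prop) => f ∧ ¬ e.IsDiag)
      fun _ => Measurable.of_discrete
  rw [iIndepFun_iff_measure_inter_preimage_eq_mul] at hQ ⊢
  intro S s hs
  rw [hP, Measure.map_apply hm (MeasurableSet.of_discrete)]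
  convert hQ S hs using 2
  · ext f; simp
  · rw [Measure.map_apply hm (MeasurableSet.of_discrete)]
    congr 1; ext f; simp

lemma binomialRandom_real_mem_edgeSet {e : Sym2 V} (he : ¬ e.IsDiag) :
    (SimpleGraph.binomialRandom V p).real {G | e ∈ G.edgeSet} = p := by
  rw [SimpleGraph.binomialRandom_eq_map, setBernoulli_eq_map, Measure.map_map]
  rotate_left
  · exact SimpleGraph.measurable_fromEdgeSet
  · exact MeasurableEquiv.setOfPred.measurable
  have hm : Measurable (SimpleGraph.fromEdgeSet ∘ fun f : Sym2 V → Prop => {i | f i}) :=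
    SimpleGraph.measurable_fromEdgeSet.comp MeasurableEquiv.setOfPred.measurable
  rw [map_measureReal_apply hm .of_discrete]
  have : ((SimpleGraph.fromEdgeSet ∘ fun f : Sym2 V → Prop => {i | f i}) ⁻¹'
      {G | e ∈ G.edgeSet}) = (fun f : Sym2 V → Prop => f e) ⁻¹' {True} := by
    ext f; simp [he]
  rw [this, ← map_measureReal_apply (measurable_pi_apply e) .of_discrete,
    Measure.infinitePi_map_eval, measureReal_def]
  simp [he]

/-- An event determined by `E` is the full preimage of its own image under restriction to `E`, and
the restrictions to disjoint sets of pairs are independent. -/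
lemma measureReal_inter_of_dependsOnEdges {F H : Set (SimpleGraph V)} {E₁ E₂ : Set (Sym2 V)}
    (hE : Disjoint E₁ E₂) (hF : DependsOnEdges (· ∈ F) E₁) (hH : DependsOnEdges (· ∈ H) E₂) :
    (SimpleGraph.binomialRandom V p).real (F ∩ H) =
      (SimpleGraph.binomialRandom V p).real F * (SimpleGraph.binomialRandom V p).real H := by
  classical
  have := Fintype.ofFinite V
  have hI := (iIndepFun_mem_edgeSet (V := V) (p := p)).indepFun_finset E₁.toFinset E₂.toFinset
    (by simpa using hE) (fun _ => Measurable.of_discrete)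
  have rep : ∀ (F : Set (SimpleGraph V)) (E : Set (Sym2 V)), DependsOnEdges (· ∈ F) E →
      F = (fun G (e : E.toFinset) => (e : Sym2 V) ∈ G.edgeSet) ⁻¹'
        ((fun G (e : E.toFinset) => (e : Sym2 V) ∈ G.edgeSet) '' F) := by
    intro F E h
    refine (Set.subset_preimage_image _ _).antisymm ?_
    rintro G ⟨G', hG', hGG⟩
    have : (G' ∈ F) = (G ∈ F) := h G' G fun e he => by
      have := congrFun hGG ⟨e, by simpa using he⟩
      simpa using this
    exact this ▸ hG'
  rw [rep F E₁ hF, rep H E₂ hH]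
  have := hI.measure_inter_preimage_eq_mul
    ((fun G (e : E₁.toFinset) => (e : Sym2 V) ∈ G.edgeSet) '' F)
    ((fun G (e : E₂.toFinset) => (e : Sym2 V) ∈ G.edgeSet) '' H) .of_discrete .of_discrete
  simp only [measureReal_def]
  rw [this, ENNReal.toReal_mul]

lemma measureReal_biInter_of_dependsOnEdges {ι : Type*} {s : Finset ι} {F : ι → Set (SimpleGraph V)}
    {E : ι → Set (Sym2 V)} (hE : (s : Set ι).PairwiseDisjoint E)
    (hF : ∀ i ∈ s, DependsOnEdges (· ∈ F i) (E i)) :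
    (SimpleGraph.binomialRandom V p).real (⋂ i ∈ s, F i) =
      ∏ i ∈ s, (SimpleGraph.binomialRandom V p).real (F i) := by
  classical
  induction s using Finset.induction_on with
  | empty => simp
  | insert a s ha ih =>
    rw [Finset.prod_insert ha, Finset.set_biInter_insert, ← ih (hE.subset (by simp))
      (fun i hi => hF i (by simp [hi]))]
    refine measureReal_inter_of_dependsOnEdges (E₁ := E a) (E₂ := ⋃ i ∈ s, E i) ?_
      (hF a (by simp)) ?_
    · rw [Set.disjoint_iUnion₂_right]
      intro i hi
      exact hE (by simp) (by simp [hi]) (by rintro rfl; exact ha hi)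
    · intro G G' h
      simp only [Set.mem_iInter]
      refine forall_congr fun i => forall_congr fun hi => hF i (by simp [hi]) G G' fun e he => h e ?_
      simp only [Set.mem_iUnion]
      exact ⟨i, hi, he⟩

lemma iIndepFun_of_dependsOnEdges {ι : Type*} {β : Type*} [MeasurableSpace β]
    {X : ι → SimpleGraph V → β} {E : ι → Set (Sym2 V)} (hE : Pairwise (Function.onFun Disjoint E))
    (hX : ∀ i, DependsOnEdges (X i) (E i)) :
    iIndepFun X (SimpleGraph.binomialRandom V p) := by
  rw [iIndepFun_iff_measure_inter_preimage_eq_mul]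
  intro S s _
  have := measureReal_biInter_of_dependsOnEdges (p := p) (s := S) (F := fun i => X i ⁻¹' s i)
    (E := E) (fun i _ j _ h => hE h) (fun i _ => (hX i).comp (· ∈ s i))
  simp only [measureReal_def] at this
  rw [← ENNReal.toReal_prod] at this
  rwa [ENNReal.toReal_eq_toReal_iff' (measure_ne_top _ _)] at this
  exact ENNReal.prod_ne_top fun _ _ => measure_ne_top _ _

end Independence

/-! ### The Harris inequality for decreasing events. -/

section Harris

variable {V : Type*} [Fintype V] {p : unitInterval}

/-- The weight of a graph depends only on its number of edges, which is modular on the lattice of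
graphs. This is the lattice condition of the FKG inequality, with equality. -/
lemma binomialRandom_modular (G H : SimpleGraph V) :
    (SimpleGraph.binomialRandom V p).real {G} * (SimpleGraph.binomialRandom V p).real {H} =
      (SimpleGraph.binomialRandom V p).real {G ⊓ H} *
        (SimpleGraph.binomialRandom V p).real {G ⊔ H} := by
  have hw : ∀ G : SimpleGraph V, (SimpleGraph.binomialRandom V p).real {G} =
      (p : ℝ) ^ G.edgeSet.ncard * (1 - p : ℝ) ^ ((Nat.card V).choose 2 - G.edgeSet.ncard) := by
    intro G
    simp [measureReal_def, SimpleGraph.binomialRandom_singleton]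
  have hle : ∀ G : SimpleGraph V, G.edgeSet.ncard ≤ (Nat.card V).choose 2 := by
    intro G
    classical
    rw [Nat.card_eq_fintype_card, ← Sym2.card_diagSet_compl, Fintype.card_eq_nat_card,
      Nat.card_coe_set_eq]
    exact Set.ncard_le_ncard (by simp) (Set.toFinite _)
  have hadd : G.edgeSet.ncard + H.edgeSet.ncard =
      (G ⊓ H).edgeSet.ncard + (G ⊔ H).edgeSet.ncard := by
    rw [SimpleGraph.edgeSet_inf, SimpleGraph.edgeSet_sup, add_comm (Set.ncard (_ ∩ _)),
      Set.ncard_union_add_ncard_inter]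
  simp only [hw]
  rw [mul_mul_mul_comm, mul_mul_mul_comm ((p : ℝ) ^ (G ⊓ H).edgeSet.ncard), ← pow_add, ← pow_add,
    ← pow_add, ← pow_add, hadd]
  have := hle G; have := hle H; have := hle (G ⊓ H); have := hle (G ⊔ H)
  congr 2
  omega

lemma measureReal_eq_sum_indicator (A : Set (SimpleGraph V)) [Fintype (SimpleGraph V)] :
    (SimpleGraph.binomialRandom V p).real A =
      ∑ G, (SimpleGraph.binomialRandom V p).real {G} * A.indicator 1 G := by
  classical
  have : A = ⋃ G ∈ Finset.univ.filter (· ∈ A), {G} := by ext; simp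
  conv_lhs => rw [this]
  rw [measureReal_biUnion_finset (fun i _ j _ h => by simpa using h) (fun _ _ => .of_discrete),
    Finset.sum_filter]
  exact Finset.sum_congr rfl fun G _ => by by_cases h : G ∈ A <;> simp [h]

/-- **Harris inequality** for two decreasing events. -/
lemma measureReal_mul_le_inter_of_isLowerSet {A B : Set (SimpleGraph V)}
    (hA : IsLowerSet A) (hB : IsLowerSet B) :
    (SimpleGraph.binomialRandom V p).real A * (SimpleGraph.binomialRandom V p).real B ≤
      (SimpleGraph.binomialRandom V p).real (A ∩ B) := by
  classical
  have hmono : ∀ {A : Set (SimpleGraph V)}, IsLowerSet A →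
      Monotone fun G : (SimpleGraph V)ᵒᵈ => A.indicator (1 : SimpleGraph V → ℝ) (OrderDual.ofDual G) := by
    intro A hA G G' h
    by_cases hG : OrderDual.ofDual G ∈ A
    · have : OrderDual.ofDual G' ∈ A := hA h hG
      simp [hG, this]
    · simp only [hG, not_false_eq_true, Set.indicator_of_notMem]
      exact Set.indicator_nonneg (fun _ _ => zero_le_one) _
  -- FKG is about monotone functions, and indicators of lower sets are monotone for the reversed
  -- order. The reversal exchanges `⊓` and `⊔` in the lattice condition.
  have h := fkg (α := (SimpleGraph V)ᵒᵈ)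
    (μ := fun G => (SimpleGraph.binomialRandom V p).real {OrderDual.ofDual G})
    (f := fun G => A.indicator (1 : SimpleGraph V → ℝ) (OrderDual.ofDual G))
    (g := fun G => B.indicator (1 : SimpleGraph V → ℝ) (OrderDual.ofDual G))
    (fun _ => measureReal_nonneg) (fun _ => Set.indicator_nonneg (fun _ _ => zero_le_one) _)
    (fun _ => Set.indicator_nonneg (fun _ _ => zero_le_one) _) (hmono hA) (hmono hB)
    (fun a b => by
      rw [mul_comm (Measure.real _ {OrderDual.ofDual (a ⊓ b)})]
      exact (binomialRandom_modular _ _).le)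
  have htot : ∑ G : (SimpleGraph V)ᵒᵈ,
      (SimpleGraph.binomialRandom V p).real {OrderDual.ofDual G} = 1 := by
    have := measureReal_eq_sum_indicator (V := V) (p := p) Set.univ
    simp only [probReal_univ, Set.indicator_univ, Pi.one_apply, mul_one] at this
    exact this.symm
  rw [htot, one_mul] at h
  rw [measureReal_eq_sum_indicator A, measureReal_eq_sum_indicator B,
    measureReal_eq_sum_indicator (A ∩ B)]
  refine h.trans (le_of_eq ?_)
  refine Finset.sum_congr rfl fun G _ => ?_
  rw [Set.inter_indicator_one]; rfl

lemma prod_measureReal_le_biInter_of_isLowerSet {ι : Type*} (s : Finset ι)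
    {A : ι → Set (SimpleGraph V)} (hA : ∀ i ∈ s, IsLowerSet (A i)) :
    ∏ i ∈ s, (SimpleGraph.binomialRandom V p).real (A i) ≤
      (SimpleGraph.binomialRandom V p).real (⋂ i ∈ s, A i) := by
  classical
  induction s using Finset.induction_on with
  | empty => simp
  | insert a s ha ih =>
    rw [Finset.prod_insert ha, Finset.set_biInter_insert]
    refine (mul_le_mul_of_nonneg_left (ih fun i hi => hA i (by simp [hi])) measureReal_nonneg).trans ?_
    exact measureReal_mul_le_inter_of_isLowerSet (hA a (by simp))
      (isLowerSet_iInter₂ fun i hi => hA i (by simp [hi]))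

end Harris
end CommonNbr

namespace CommonNbr

/-! ### Numbers of common neighbours inside a fixed set: exact laws. -/

section Columns

open Classical in
/-- The vertices of `D` adjacent to all vertices of `B`. -/
noncomputable def nbrsIn {V : Type*} (G : SimpleGraph V) (D B : Finset V) : Finset V :=
  {v ∈ D | ∀ u ∈ B, G.Adj u v}

lemma mem_nbrsIn {V : Type*} {G : SimpleGraph V} {D B : Finset V} {v : V} :
    v ∈ nbrsIn G D B ↔ v ∈ D ∧ ∀ u ∈ B, G.Adj u v := by
  simp [nbrsIn]

lemma nbrsIn_subset {V : Type*} (G : SimpleGraph V) (D B : Finset V) : nbrsIn G D B ⊆ D :=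
  fun _ h => (mem_nbrsIn.1 h).1

/-- The pairs with one element in `B` and the other in `D`. -/
def edgesBetween {V : Type*} (D B : Set V) : Set (Sym2 V) := {e | ∃ v ∈ D, ∃ u ∈ B, e = s(u, v)}

lemma edgesBetween_mono {V : Type*} {D B D' B' : Set V} (hD : D ⊆ D') (hB : B ⊆ B') :
    edgesBetween D B ⊆ edgesBetween D' B' := by
  rintro _ ⟨v, hv, u, hu, rfl⟩
  exact ⟨v, hD hv, u, hB hu, rfl⟩

lemma dependsOnEdges_nbrsIn {V : Type*} (D B : Finset V) :
    DependsOnEdges (fun G : SimpleGraph V => nbrsIn G D B) (edgesBetween D B) := by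
  intro G G' h
  ext v
  simp only [mem_nbrsIn]
  refine and_congr_right fun hv => forall₂_congr fun u hu => ?_
  simpa using h s(u, v) ⟨v, hv, u, hu, rfl⟩

/-- An unordered pair could be read with its two ends exchanged; `hB` excludes the exchanged
reading. -/
lemma disjoint_edgesBetween_right {V : Type*} {D B B' : Set V} (h : Disjoint B B')
    (hB : Disjoint D B) : Disjoint (edgesBetween D B) (edgesBetween D B') := by
  rw [Set.disjoint_left]
  rintro _ ⟨v, hv, u, hu, rfl⟩ ⟨v', hv', u', hu', he⟩
  rcases Sym2.eq_iff.1 he with ⟨rfl, rfl⟩ | ⟨rfl, rfl⟩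
  · exact Set.disjoint_left.1 h hu hu'
  · exact Set.disjoint_left.1 hB hv' hu

lemma disjoint_edgesBetween_left {V : Type*} {D D' B : Set V} (h : Disjoint D D')
    (hB : Disjoint D B) : Disjoint (edgesBetween D B) (edgesBetween D' B) := by
  rw [Set.disjoint_left]
  rintro _ ⟨v, hv, u, hu, rfl⟩ ⟨v', hv', u', hu', he⟩
  rcases Sym2.eq_iff.1 he with ⟨rfl, rfl⟩ | ⟨rfl, rfl⟩
  · exact Set.disjoint_left.1 h hv hv'
  · exact Set.disjoint_left.1 hB hv hu'

variable {V : Type*} [Fintype V] {p : unitInterval}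

lemma measureReal_forall_adj {B : Finset V} {v : V} (hv : v ∉ B) :
    (SimpleGraph.binomialRandom V p).real {G | ∀ u ∈ B, G.Adj u v} = (p : ℝ) ^ B.card := by
  have h := measureReal_biInter_of_dependsOnEdges (p := p) (s := B)
    (F := fun u => {G : SimpleGraph V | s(u, v) ∈ G.edgeSet}) (E := fun u => {s(u, v)})
    (fun u hu u' hu' huu => by
      simp only [Function.onFun, Set.disjoint_singleton_right, Set.mem_singleton_iff]
      intro h
      rcases Sym2.eq_iff.1 h with ⟨rfl, -⟩ | ⟨rfl, -⟩
      · exact huu rfl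
      · exact hv hu')
    (fun u _ G G' h => propext (by simpa using h))
  rw [Finset.prod_congr rfl fun u hu => binomialRandom_real_mem_edgeSet (by
    simp only [Sym2.mk_isDiag_iff]; rintro rfl; exact hv hu), Finset.prod_const] at h
  rw [← h]
  congr 1; ext G; simp

/-- The vertices of `D` use disjoint sets of pairs, so each joins the common neighbourhood
independently with probability `p ^ B.card`. -/
lemma measureReal_nbrsIn_eq {D B T : Finset V} (hDB : Disjoint D B) (hT : T ⊆ D) :
    (SimpleGraph.binomialRandom V p).real {G | nbrsIn G D B = T} =
      ((p : ℝ) ^ B.card) ^ T.card * (1 - (p : ℝ) ^ B.card) ^ (D.card - T.card) := by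
  classical
  have h := measureReal_biInter_of_dependsOnEdges (p := p) (s := D)
    (F := fun v => {G : SimpleGraph V | (∀ u ∈ B, G.Adj u v) ↔ v ∈ T})
    (E := fun v => edgesBetween {v} B)
    (fun v hv v' hv' hvv => disjoint_edgesBetween_left (by simpa using hvv)
      (by simpa using Finset.disjoint_left.1 hDB hv))
    (fun v hv G G' h => by
      have := fun u (hu : u ∈ B) => h s(u, v) ⟨v, rfl, u, hu, rfl⟩
      simp only [SimpleGraph.mem_edgeSet] at this
      simp only [Set.mem_ofPred_eq, forall₂_congr this])
  have h1 : {G : SimpleGraph V | nbrsIn G D B = T} =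
      ⋂ v ∈ D, {G : SimpleGraph V | (∀ u ∈ B, G.Adj u v) ↔ v ∈ T} := by
    ext G
    simp only [Set.mem_ofPred_eq, Set.mem_iInter, Finset.ext_iff, mem_nbrsIn]
    refine ⟨fun h v hv => by simpa [hv] using h v, fun h v => ?_⟩
    by_cases hv : v ∈ D
    · simpa [hv] using h v hv
    · simpa [hv] using fun h => hv (hT h)
  rw [h1, h, ← Finset.prod_sdiff hT, mul_comm, Finset.card_sdiff_of_subset hT |>.symm]
  congr 1
  · rw [← Finset.prod_const]
    refine Finset.prod_congr rfl fun v hv => ?_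
    rw [← measureReal_forall_adj (Finset.disjoint_left.1 hDB (hT hv))]
    congr 1; ext G; simp [hv]
  · rw [← Finset.prod_const]
    refine Finset.prod_congr rfl fun v hv => ?_
    rw [Finset.mem_sdiff] at hv
    rw [← measureReal_forall_adj (p := p) (Finset.disjoint_left.1 hDB hv.1),
      ← probReal_compl_eq_one_sub .of_discrete]
    congr 1; ext G; simp [hv.2]

/-- The number of common neighbours of `B` outside `B` is binomial. -/
lemma map_card_nbrsIn {D B : Finset V} (hDB : Disjoint D B) :
    (SimpleGraph.binomialRandom V p).map (fun G => (nbrsIn G D B).card) =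
      binomial D.card (p ^ B.card) := by
  classical
  refine Measure.ext_of_measureReal_singleton fun m => ?_
  rw [map_measureReal_apply .of_discrete .of_discrete, binomial_real_singleton]
  have h1 : ((fun G : SimpleGraph V => (nbrsIn G D B).card) ⁻¹' {m}) =
      ⋃ T ∈ D.powersetCard m, {G : SimpleGraph V | nbrsIn G D B = T} := by
    ext G
    simp [Finset.mem_powersetCard, nbrsIn_subset]
  rw [h1, measureReal_biUnion_finset]
  · rw [Finset.sum_congr rfl fun T hT => measureReal_nbrsIn_eq hDB (Finset.mem_powersetCard.1 hT).1]
    rw [Finset.sum_congr rfl fun T hT => by rw [(Finset.mem_powersetCard.1 hT).2],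
      Finset.sum_const, Finset.card_powersetCard, nsmul_eq_mul]
    simp [mul_assoc]
  · intro T _ T' _ hTT
    rw [Function.onFun, Set.disjoint_left]
    rintro G h h'
    exact hTT (h.symm.trans h')
  · exact fun _ _ => .of_discrete

lemma measureReal_card_nbrsIn_mem {D B : Finset V} (hDB : Disjoint D B) (K : Set ℕ) :
    (SimpleGraph.binomialRandom V p).real {G | (nbrsIn G D B).card ∈ K} =
      (binomial D.card (p ^ B.card)).real K := by
  rw [← map_card_nbrsIn hDB, map_measureReal_apply .of_discrete .of_discrete]; rfl

/-- Disjoint sets `B a` see `D` through disjoint sets of pairs, so their counts are independent.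
This produces the main term for a disjoint family. -/
lemma measureReal_forall_card_nbrsIn_mem {ι : Type*} [Fintype ι] {D : Finset V} {B : ι → Finset V}
    (hB : Pairwise (Function.onFun Disjoint B)) (hDB : ∀ a, Disjoint D (B a)) (K : ι → Set ℕ) :
    (SimpleGraph.binomialRandom V p).real {G | ∀ a, (nbrsIn G D (B a)).card ∈ K a} =
      ∏ a, (binomial D.card (p ^ (B a).card)).real (K a) := by
  have h := measureReal_biInter_of_dependsOnEdges (p := p) (s := Finset.univ)
    (F := fun a => {G : SimpleGraph V | (nbrsIn G D (B a)).card ∈ K a})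
    (E := fun a => edgesBetween D (B a))
    (fun a _ b _ hab => disjoint_edgesBetween_right (by simpa using hB hab) (by simpa using hDB a))
    (fun a _ => (dependsOnEdges_nbrsIn D (B a)).comp (fun T : Finset V => T.card ∈ K a))
  rw [Finset.prod_congr rfl fun a _ => measureReal_card_nbrsIn_mem (hDB a) (K a)] at h
  rw [← h]
  congr 1; ext G; simp

end Columns

/-! ### A joint Chernoff bound with the covariance form in the exponent. -/

section Chernoff

/-- The cubic remainder is absorbed in the factor `1 + T`. As `T → 0` the quadratic coefficient
tends to `1 / 2`, so the resulting Chernoff bound has the Gaussian exponent to leading order. -/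
lemma exp_le_one_add_add_sq {x T : ℝ} (hx : |x| ≤ T) (hT : T ≤ 1) :
    Real.exp x ≤ 1 + x + (1 + T) / 2 * x ^ 2 := by
  have h := Real.exp_bound (hx.trans hT) (n := 3) (by norm_num)
  have h2 := (abs_le.1 h).2
  simp only [Finset.sum_range_succ, Finset.range_zero, Finset.sum_empty] at h2
  norm_num [Nat.factorial] at h2
  have h3 : |x| ^ 3 ≤ T * x ^ 2 := by
    rw [pow_succ, sq_abs, mul_comm]; gcongr
  have := abs_nonneg x
  nlinarith [sq_nonneg x]

/-- The quadratic form of the covariances of the indicators of the events that a fixed vertex is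
adjacent to all elements of `B b`. -/
noncomputable def covForm {V β : Type*} [DecidableEq V] [Fintype β] (p : ℝ) (B : β → Finset V)
    (t : β → ℝ) : ℝ :=
  ∑ b, ∑ b', t b * t b' * (p ^ (B b ∪ B b').card - p ^ (B b).card * p ^ (B b').card)

variable {V : Type*} [Fintype V] [DecidableEq V] {p : unitInterval} {β : Type*} [Fintype β]

/-- The centred contribution of the vertex `v`. -/
noncomputable def column (p : ℝ) (B : β → Finset V) (t : β → ℝ) (v : V) (G : SimpleGraph V) : ℝ :=
  ∑ b, t b * ({G : SimpleGraph V | ∀ u ∈ B b, G.Adj u v}.indicator 1 G - p ^ (B b).card)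

/-- Being adjacent to all of `B` and to all of `B'` means being adjacent to all of `B ∪ B'`, whence
the covariance of the two indicators. -/
lemma integral_column_mul {B B' : Finset V} {v : V} (h : v ∉ B) (h' : v ∉ B') :
    ∫ G, ({G : SimpleGraph V | ∀ u ∈ B, G.Adj u v}.indicator 1 G - (p : ℝ) ^ B.card) *
      ({G : SimpleGraph V | ∀ u ∈ B', G.Adj u v}.indicator 1 G - (p : ℝ) ^ B'.card)
      ∂(SimpleGraph.binomialRandom V p) =
    (p : ℝ) ^ (B ∪ B').card - (p : ℝ) ^ B.card * (p : ℝ) ^ B'.card := by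
  have e : ∀ G : SimpleGraph V,
      ({G : SimpleGraph V | ∀ u ∈ B, G.Adj u v}.indicator 1 G - (p : ℝ) ^ B.card) *
      ({G : SimpleGraph V | ∀ u ∈ B', G.Adj u v}.indicator 1 G - (p : ℝ) ^ B'.card) =
      {G : SimpleGraph V | ∀ u ∈ B ∪ B', G.Adj u v}.indicator 1 G
      - (p : ℝ) ^ B'.card * {G : SimpleGraph V | ∀ u ∈ B, G.Adj u v}.indicator 1 G
      - (p : ℝ) ^ B.card * {G : SimpleGraph V | ∀ u ∈ B', G.Adj u v}.indicator 1 G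
      + (p : ℝ) ^ B.card * (p : ℝ) ^ B'.card := by
    intro G
    have : {G : SimpleGraph V | ∀ u ∈ B ∪ B', G.Adj u v} =
        {G : SimpleGraph V | ∀ u ∈ B, G.Adj u v} ∩ {G : SimpleGraph V | ∀ u ∈ B', G.Adj u v} := by
      ext G; simp [or_imp, forall_and]
    rw [this, Set.inter_indicator_one]
    simp only [Pi.mul_apply]
    ring
  simp only [e]
  rw [integral_add .of_finite .of_finite, integral_sub .of_finite .of_finite,
    integral_sub .of_finite .of_finite, integral_const_mul, integral_const_mul,
    integral_indicator_one .of_discrete, integral_indicator_one .of_discrete,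
    integral_indicator_one .of_discrete, measureReal_forall_adj h, measureReal_forall_adj h',
    measureReal_forall_adj (by simp [h, h'])]
  simp
  ring

lemma integral_column {B : β → Finset V} (t : β → ℝ) {v : V} (h : ∀ b, v ∉ B b) :
    ∫ G, column p B t v G ∂(SimpleGraph.binomialRandom V p) = 0 := by
  unfold column
  rw [integral_finsetSum _ fun _ _ => .of_finite]
  refine Finset.sum_eq_zero fun b _ => ?_
  rw [integral_const_mul, integral_sub .of_finite .of_finite, integral_indicator_one .of_discrete,
    measureReal_forall_adj (h b)]
  simp

lemma integral_column_sq {B : β → Finset V} (t : β → ℝ) {v : V} (h : ∀ b, v ∉ B b) :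
    ∫ G, column p B t v G ^ 2 ∂(SimpleGraph.binomialRandom V p) = covForm (p : ℝ) B t := by
  unfold column covForm
  simp only [sq, Finset.sum_mul_sum]
  rw [integral_finsetSum _ fun _ _ => .of_finite]
  refine Finset.sum_congr rfl fun b _ => ?_
  rw [integral_finsetSum _ fun _ _ => .of_finite]
  refine Finset.sum_congr rfl fun b' _ => ?_
  rw [← integral_column_mul (h b) (h b'), ← integral_const_mul]
  congr 1; ext G; ring

lemma abs_column_le (B : β → Finset V) {t : β → ℝ} (ht : ∀ b, 0 ≤ t b) (v : V)
    (G : SimpleGraph V) : |column p B t v G| ≤ ∑ b, t b := by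
  refine (Finset.abs_sum_le_sum_abs _ _).trans (Finset.sum_le_sum fun b _ => ?_)
  rw [abs_mul, abs_of_nonneg (ht b)]
  refine mul_le_of_le_one_right (ht b) ?_
  have h0 : 0 ≤ (p : ℝ) ^ (B b).card := pow_nonneg p.2.1 _
  have h1 : (p : ℝ) ^ (B b).card ≤ 1 := pow_le_one₀ p.2.1 p.2.2
  rw [abs_le]
  by_cases hG : G ∈ {G : SimpleGraph V | ∀ u ∈ B b, G.Adj u v}
  · rw [Set.indicator_of_mem hG]; simp only [Pi.one_apply]; constructor <;> linarith
  · rw [Set.indicator_of_notMem hG]; constructor <;> linarith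

lemma mgf_column_le {B : β → Finset V} {t : β → ℝ} (ht : ∀ b, 0 ≤ t b) (ht1 : ∑ b, t b ≤ 1)
    {v : V} (h : ∀ b, v ∉ B b) :
    mgf (column (p : ℝ) B t v) (SimpleGraph.binomialRandom V p) 1 ≤
      Real.exp ((1 + ∑ b, t b) / 2 * covForm (p : ℝ) B t) := by
  unfold mgf
  calc ∫ G, Real.exp (1 * column (p : ℝ) B t v G) ∂(SimpleGraph.binomialRandom V p)
      ≤ ∫ G, (1 + column (p : ℝ) B t v G + (1 + ∑ b, t b) / 2 * column (p : ℝ) B t v G ^ 2)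
        ∂(SimpleGraph.binomialRandom V p) := by
        refine integral_mono .of_finite .of_finite fun G => ?_
        simp only [one_mul]
        exact exp_le_one_add_add_sq (abs_column_le B ht v G) ht1
    _ = 1 + (1 + ∑ b, t b) / 2 * covForm (p : ℝ) B t := by
        rw [integral_add .of_finite .of_finite, integral_add .of_finite .of_finite,
          integral_const_mul, integral_column t h, integral_column_sq t h]
        simp
    _ ≤ _ := by rw [add_comm]; exact Real.add_one_le_exp _

/-- A Chernoff bound for the numbers of common neighbours in `D` of several sets. -/
lemma measureReal_forall_le_card_nbrsIn_le {D : Finset V} {B : β → Finset V}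
    (hDB : ∀ b, Disjoint D (B b)) {t : β → ℝ} (ht : ∀ b, 0 ≤ t b) (ht1 : ∑ b, t b ≤ 1)
    (y : β → ℝ) :
    (SimpleGraph.binomialRandom V p).real {G | ∀ b, y b ≤ (nbrsIn G D (B b)).card} ≤
      Real.exp (∑ b, t b * (D.card * (p : ℝ) ^ (B b).card - y b) +
        D.card * ((1 + ∑ b, t b) / 2 * covForm (p : ℝ) B t)) := by
  have hv : ∀ v ∈ D, ∀ b, v ∉ B b := fun v hv b => Finset.disjoint_left.1 (hDB b) hv
  -- Different vertices of `D` use disjoint sets of pairs, however much the sets `B b` overlap.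
  have hind : iIndepFun (fun (v : D) => column (p : ℝ) B t (v : V))
      (SimpleGraph.binomialRandom V p) := by
    refine iIndepFun_of_dependsOnEdges (E := fun v : D => edgesBetween {(v : V)} (⋃ b, (B b : Set V)))
      (fun v v' hvv => disjoint_edgesBetween_left (by simpa using fun h => hvv (Subtype.ext h))
        (by simpa using hv v v.2)) fun v G G' h => ?_
    unfold column
    refine Finset.sum_congr rfl fun b _ => ?_
    have : (∀ u ∈ B b, G.Adj u v) ↔ (∀ u ∈ B b, G'.Adj u v) :=
      forall₂_congr fun u hu => by
        simpa using h s(u, (v : V)) ⟨v, rfl, u, Set.mem_iUnion.2 ⟨b, hu⟩, rfl⟩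
    have h2 : {G : SimpleGraph V | ∀ u ∈ B b, G.Adj u v}.indicator (1 : SimpleGraph V → ℝ) G =
        {G : SimpleGraph V | ∀ u ∈ B b, G.Adj u v}.indicator 1 G' := by
      by_cases hG : ∀ u ∈ B b, G.Adj u v
      · rw [Set.indicator_of_mem (by exact hG), Set.indicator_of_mem (by exact this.1 hG)]; rfl
      · rw [Set.indicator_of_notMem (by exact hG),
          Set.indicator_of_notMem (by exact fun h => hG (this.2 h))]
    rw [h2]
  have hsum : ∀ G : SimpleGraph V, (∑ v : D, column (p : ℝ) B t (v : V)) G =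
      ∑ b, t b * ((nbrsIn G D (B b)).card - D.card * (p : ℝ) ^ (B b).card) := by
    intro G
    rw [Finset.sum_apply]
    unfold column
    rw [Finset.sum_comm]
    refine Finset.sum_congr rfl fun b _ => ?_
    rw [← Finset.mul_sum, Finset.sum_sub_distrib]
    congr 2
    · rw [Finset.univ_eq_attach, Finset.sum_attach D
        (fun v => {G : SimpleGraph V | ∀ u ∈ B b, G.Adj u v}.indicator (1 : SimpleGraph V → ℝ) G)]
      rw [nbrsIn, Finset.card_filter, Nat.cast_sum]
      refine Finset.sum_congr rfl fun v _ => ?_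
      by_cases h : ∀ u ∈ B b, G.Adj u v
      · rw [Set.indicator_of_mem (by exact h), if_pos h]; simp
      · rw [Set.indicator_of_notMem (by exact h), if_neg h]; simp
    · simp
  -- The exponential Markov inequality is used at parameter `1`, because the weights `t b` already
  -- contain the parameter.
  have hc := measure_ge_le_exp_mul_mgf (μ := SimpleGraph.binomialRandom V p) (t := 1)
    (X := ∑ v : D, column (p : ℝ) B t (v : V))
    (∑ b, t b * (y b - D.card * (p : ℝ) ^ (B b).card)) zero_le_one .of_finite
  rw [hind.mgf_sum (fun _ => .of_discrete)] at hc
  calc (SimpleGraph.binomialRandom V p).real {G | ∀ b, y b ≤ (nbrsIn G D (B b)).card}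
      ≤ _ := measureReal_mono fun G hG => by
        simp only [Set.mem_ofPred_eq, hsum] at hG ⊢
        refine Finset.sum_le_sum fun b _ => mul_le_mul_of_nonneg_left ?_ (ht b)
        linarith [hG b]
    _ ≤ _ := hc
    _ ≤ Real.exp (-1 * ∑ b, t b * (y b - D.card * (p : ℝ) ^ (B b).card)) *
        ∏ v : D, Real.exp ((1 + ∑ b, t b) / 2 * covForm (p : ℝ) B t) := by
        gcongr with v
        · exact fun v _ => mgf_nonneg
        · exact mgf_column_le ht ht1 (hv v v.2)
    _ = _ := by
        rw [Finset.prod_const, Finset.card_univ, Fintype.card_coe, ← Real.exp_nat_mul,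
          ← Real.exp_add]
        congr 1
        rw [neg_one_mul, ← Finset.sum_neg_distrib]
        congr 1
        exact Finset.sum_congr rfl fun b _ => by ring

end Chernoff
end CommonNbr

namespace CommonNbr

/-! ### Binomial tails compared with geometric series. -/

section BinomialTail

/-- The probability that a binomial variable with parameters `N` and `q` equals `m`. -/
noncomputable def binPmf (N : ℕ) (q : ℝ) (m : ℕ) : ℝ := N.choose m * q ^ m * (1 - q) ^ (N - m)

/-- The probability that a binomial variable with parameters `N` and `q` is at least `y`. -/
noncomputable def binTail (N : ℕ) (q : ℝ) (y : ℕ) : ℝ := ∑ m ∈ Finset.Icc y N, binPmf N q m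

lemma binomial_real_Ici (N : ℕ) (q : unitInterval) (y : ℕ) :
    (binomial N q).real (Set.Ici y) = binTail N q y := by
  have h0 : (binomial N q).real (Set.Ioi N) = 0 := by
    rw [measureReal_def, binomial_eq_sum_dirac, Measure.finsetSum_apply]
    simp only [Measure.smul_apply, smul_eq_mul]
    rw [Finset.sum_eq_zero]; · simp
    intro m hm
    simp [Finset.mem_Iic.1 hm]
  have h1 : (binomial N q).real (Set.Icc y N) = binTail N q y := by
    rw [← Finset.coe_Icc, ← sum_measureReal_singleton]
    exact Finset.sum_congr rfl fun m _ => binomial_real_singleton N m q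
  rw [← h1]
  refine le_antisymm ?_ (measureReal_mono fun m hm => hm.1)
  calc (binomial N q).real (Set.Ici y)
      ≤ (binomial N q).real (Set.Icc y N ∪ Set.Ioi N) := measureReal_mono fun m hm => by
        simp only [Set.mem_union, Set.mem_Icc, Set.mem_Ioi, Set.mem_Ici] at hm ⊢; omega
    _ ≤ _ := measureReal_union_le _ _
    _ = _ := by rw [h0, add_zero]

lemma binPmf_nonneg {N m : ℕ} {q : ℝ} (h0 : 0 ≤ q) (h1 : q ≤ 1) : 0 ≤ binPmf N q m := by
  have : 0 ≤ 1 - q := by linarith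
  unfold binPmf; positivity

lemma binPmf_succ {N m : ℕ} {q : ℝ} (hm : m < N) (hq : q < 1) :
    binPmf N q (m + 1) = binPmf N q m * (((N : ℝ) - m) * q / ((m + 1) * (1 - q))) := by
  have h := Nat.choose_succ_right_eq N m
  have h' : (N.choose (m + 1) : ℝ) * (m + 1) = N.choose m * ((N : ℝ) - m) := by
    rw [← Nat.cast_sub hm.le]; exact_mod_cast h
  have h1 : (0 : ℝ) < 1 - q := by linarith
  have h2 : N - m = (N - (m + 1)) + 1 := by omega
  unfold binPmf
  rw [h2, pow_succ (1 - q), pow_succ q, mul_div_assoc', eq_div_iff (by positivity)]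
  linear_combination (q ^ m * q * (1 - q) ^ (N - (m + 1)) * (1 - q)) * h'

/-- The ratio of consecutive probabilities decreases, so beyond `y` it is at most its value at `y`,
and a geometric series dominates the tail. -/
lemma binTail_le {N y : ℕ} {q : ℝ} (h0 : 0 < q) (h1 : q < 1) (hy : y ≤ N)
    (hR : ((N : ℝ) - y) * q / ((y + 1) * (1 - q)) < 1) :
    binTail N q y ≤ binPmf N q y / (1 - ((N : ℝ) - y) * q / ((y + 1) * (1 - q))) := by
  set R := ((N : ℝ) - y) * q / ((y + 1) * (1 - q)) with hRdef
  have hq1 : 0 < 1 - q := by linarith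
  have hNy : (y : ℝ) ≤ N := by exact_mod_cast hy
  have hR0 : 0 ≤ R := div_nonneg (mul_nonneg (by linarith) h0.le) (by positivity)
  have key : ∀ l, y + l ≤ N → binPmf N q (y + l) ≤ binPmf N q y * R ^ l := by
    intro l
    induction l with
    | zero => simp
    | succ l ih =>
      intro hl
      rw [← add_assoc, binPmf_succ (by omega) h1, pow_succ, ← mul_assoc]
      have hl' : ((y + l : ℕ) : ℝ) + 1 ≤ N := by exact_mod_cast hl
      refine mul_le_mul (ih (by omega)) ?_ (div_nonneg (mul_nonneg (by linarith) h0.le)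
        (by positivity)) (mul_nonneg (binPmf_nonneg h0.le h1.le) (pow_nonneg hR0 _))
      rw [hRdef]
      push_cast
      have : (0 : ℝ) ≤ l := l.cast_nonneg
      refine div_le_div₀ (mul_nonneg (by linarith) h0.le) ?_ (by positivity) ?_
      · gcongr; linarith
      · gcongr; linarith
  unfold binTail
  calc ∑ m ∈ Finset.Icc y N, binPmf N q m
      = ∑ l ∈ Finset.range (N + 1 - y), binPmf N q (y + l) := by
        rw [← Finset.sum_Ico_eq_sum_range]; rfl
    _ ≤ ∑ l ∈ Finset.range (N + 1 - y), binPmf N q y * R ^ l :=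
        Finset.sum_le_sum fun l hl => key l (by have := Finset.mem_range.1 hl; omega)
    _ = binPmf N q y * ∑ l ∈ Finset.range (N + 1 - y), R ^ l := by rw [Finset.mul_sum]
    _ ≤ binPmf N q y * (1 - R)⁻¹ := by
        refine mul_le_mul_of_nonneg_left ?_ (binPmf_nonneg h0.le h1.le)
        rw [← tsum_geometric_of_lt_one hR0 hR]
        exact (summable_geometric_of_lt_one hR0 hR).sum_le_tsum _ fun _ _ => pow_nonneg hR0 _
    _ = _ := by rw [div_eq_mul_inv]

/-- Only the `K` terms from `y` on are kept; there the ratio is at least its value `R` at `y + K`.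
The truncation costs the factor `1 - R ^ K`, estimated by `R ≤ exp (-(1 - R))`. -/
lemma le_binTail {N y K : ℕ} {q : ℝ} (h0 : 0 < q) (h1 : q < 1) (hy : y + K ≤ N)
    (hR : ((N : ℝ) - y - K) * q / ((y + K + 1) * (1 - q)) < 1) :
    binPmf N q y / (1 - ((N : ℝ) - y - K) * q / ((y + K + 1) * (1 - q))) *
      (1 - Real.exp (-(K * (1 - ((N : ℝ) - y - K) * q / ((y + K + 1) * (1 - q)))))) ≤
    binTail N q y := by
  set R := ((N : ℝ) - y - K) * q / ((y + K + 1) * (1 - q)) with hRdef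
  have hq1 : 0 < 1 - q := by linarith
  have hNy : (y : ℝ) + K ≤ N := by exact_mod_cast hy
  have hR0 : 0 ≤ R := div_nonneg (mul_nonneg (by linarith) h0.le) (by positivity)
  have key : ∀ l, l ≤ K → binPmf N q y * R ^ l ≤ binPmf N q (y + l) := by
    intro l
    induction l with
    | zero => simp
    | succ l ih =>
      intro hl
      rw [← add_assoc, binPmf_succ (by omega) h1, pow_succ, ← mul_assoc]
      have hl' : (l : ℝ) + 1 ≤ K := by exact_mod_cast hl
      refine mul_le_mul (ih (by omega)) ?_ hR0 (binPmf_nonneg h0.le h1.le)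
      rw [hRdef]
      push_cast
      refine div_le_div₀ (mul_nonneg (by linarith) h0.le) ?_ (by positivity) ?_
      · exact mul_le_mul_of_nonneg_right (by linarith) h0.le
      · exact mul_le_mul_of_nonneg_right (by linarith) hq1.le
  unfold binTail
  calc binPmf N q y / (1 - R) * (1 - Real.exp (-(K * (1 - R))))
      ≤ binPmf N q y * ((1 - R ^ K) / (1 - R)) := by
        rw [div_mul_eq_mul_div, mul_div_assoc]
        refine mul_le_mul_of_nonneg_left ?_ (binPmf_nonneg h0.le h1.le)
        have : R ^ K ≤ Real.exp (-(K * (1 - R))) := by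
          rw [← mul_neg, Real.exp_nat_mul]
          exact pow_le_pow_left₀ hR0 (by have := Real.add_one_le_exp (-(1 - R)); linarith) K
        have h1R : 0 < 1 - R := by linarith
        gcongr
    _ = ∑ l ∈ Finset.range K, binPmf N q y * R ^ l := by
        rw [← Finset.mul_sum, geom_sum_eq hR.ne, ← neg_div_neg_eq]; ring_nf
    _ ≤ ∑ l ∈ Finset.range K, binPmf N q (y + l) :=
        Finset.sum_le_sum fun l hl => key l (Finset.mem_range.1 hl).le
    _ = ∑ m ∈ Finset.Ico y (y + K), binPmf N q m := by
        rw [Finset.sum_Ico_eq_sum_range]; simp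
    _ ≤ _ := Finset.sum_le_sum_of_subset_of_nonneg (fun m hm => by
        simp only [Finset.mem_Ico, Finset.mem_Icc] at hm ⊢; omega)
        fun _ _ _ => binPmf_nonneg h0.le h1.le

/-- The second order expansion of the entropy function. The constant comes from `3/2 · 2 + 1/2 ≤ 4`.
-/
lemma abs_mul_log_sub_le {x : ℝ} (hx : |x| ≤ 1 / 2) :
    |(1 + x) * Real.log (1 + x) - x - x ^ 2 / 2| ≤ 4 * |x| ^ 3 := by
  have h := Real.abs_log_sub_add_sum_range_le (x := -x) (by rw [abs_neg]; linarith) 2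
  simp only [Finset.sum_range_succ, Finset.range_zero, Finset.sum_empty, abs_neg, sub_neg_eq_add]
    at h
  norm_num at h
  have hb : |x| ^ 3 / (1 - |x|) ≤ 2 * |x| ^ 3 := by
    rw [div_le_iff₀ (by linarith)]
    nlinarith [pow_nonneg (abs_nonneg x) 3]
  have e : (1 + x) * Real.log (1 + x) - x - x ^ 2 / 2 =
      (1 + x) * (-x + x ^ 2 / 2 + Real.log (1 + x)) - x ^ 3 / 2 := by ring
  rw [e]
  refine (abs_sub _ _).trans ?_
  rw [abs_mul, abs_div, abs_pow, abs_two]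
  have h1 : |1 + x| ≤ 3 / 2 := (abs_add_le _ _).trans (by rw [abs_one]; linarith)
  have h2 := mul_le_mul h1 (h.trans hb) (abs_nonneg _) (by norm_num)
  have := pow_nonneg (abs_nonneg x) 3
  linarith

end BinomialTail
end CommonNbr

namespace CommonNbr

/-! ### Stirling's formula for single binomial probabilities. -/

section LocalLimit

/-- The ratio of `n!` to Stirling's approximation. -/
noncomputable def stirlingRatio (n : ℕ) : ℝ :=
  n.factorial / (√(2 * Real.pi * n) * (n / Real.exp 1) ^ n)

lemma tendsto_stirlingRatio : Tendsto stirlingRatio atTop (𝓝 1) := by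
  have h := Stirling.factorial_isEquivalent_stirling
  rw [Asymptotics.isEquivalent_iff_tendsto_one] at h
  · refine h.congr' ?_
    filter_upwards with n
    simp only [Pi.div_apply, stirlingRatio]
    congr 2
    rw [mul_right_comm]
  · filter_upwards [eventually_gt_atTop 0] with n hn
    positivity

lemma factorial_eq_stirlingRatio_mul {n : ℕ} (hn : 0 < n) :
    (n.factorial : ℝ) = stirlingRatio n * (√(2 * Real.pi * n) * (n / Real.exp 1) ^ n) := by
  unfold stirlingRatio
  have : 0 < √(2 * Real.pi * n) * (n / Real.exp 1) ^ n := by positivity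
  rw [div_mul_cancel₀ _ this.ne']

lemma stirlingRatio_pos {n : ℕ} (hn : 0 < n) : 0 < stirlingRatio n := by
  unfold stirlingRatio; positivity

/-- The error in the exponent of the local limit theorem. -/
noncomputable def llError (N : ℕ) (q : ℝ) (y : ℕ) : ℝ :=
  y * Real.log (y / (N * q)) + (N - y) * Real.log ((N - y) / (N * (1 - q))) -
    (y - N * q) ^ 2 / (2 * N * q * (1 - q))

/-- With `u = y - N q`, the entropy function is expanded at `u / (N q)` and `-u / (N (1 - q))`. The
linear terms cancel and the quadratic ones add up to `u ^ 2 / (2 N q (1 - q))`, so only cubic errors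
remain. -/
lemma abs_llError_le {N y : ℕ} {q : ℝ} (h0 : 0 < q) (h1 : q < 1) (hN : 0 < N)
    (hu : |y - N * q| ≤ N * q / 2) (hu' : |y - N * q| ≤ N * (1 - q) / 2) :
    |llError N q y| ≤ 4 * (|y - N * q| ^ 3 / (N * q) ^ 2 + |y - N * q| ^ 3 / (N * (1 - q)) ^ 2) := by
  have hq1 : 0 < 1 - q := by linarith
  have hN' : (0 : ℝ) < N := by exact_mod_cast hN
  set u : ℝ := y - N * q with hu_def
  have ha : 0 < N * q := by positivity
  have hb : 0 < N * (1 - q) := by positivity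
  have hx := abs_mul_log_sub_le (x := u / (N * q)) (by
    rw [abs_div, abs_of_pos ha, div_le_iff₀ ha]; linarith)
  have hx' := abs_mul_log_sub_le (x := -(u / (N * (1 - q)))) (by
    rw [abs_neg, abs_div, abs_of_pos hb, div_le_iff₀ hb]; linarith)
  have e1 : 1 + u / (N * q) = y / (N * q) := by rw [hu_def]; field_simp; ring
  have e2 : 1 + -(u / (N * (1 - q))) = (N - y) / (N * (1 - q)) := by
    rw [hu_def]; field_simp; ring
  rw [e1] at hx
  rw [e2] at hx'
  have e : llError N q y = N * q * (y / (N * q) * Real.log (y / (N * q)) - u / (N * q)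
      - (u / (N * q)) ^ 2 / 2) + N * (1 - q) * ((N - y) / (N * (1 - q)) *
      Real.log ((N - y) / (N * (1 - q))) - -(u / (N * (1 - q))) - (-(u / (N * (1 - q)))) ^ 2 / 2) := by
    unfold llError
    rw [← hu_def]
    field_simp
    ring
  rw [e]
  refine (abs_add_le _ _).trans ?_
  rw [abs_mul (N * q), abs_mul (N * (1 - q)), abs_of_pos ha, abs_of_pos hb]
  refine (add_le_add (mul_le_mul_of_nonneg_left hx ha.le)
    (mul_le_mul_of_nonneg_left hx' hb.le)).trans (le_of_eq ?_)
  rw [abs_neg, abs_div, abs_div, abs_of_pos ha, abs_of_pos hb]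
  field_simp

/-- An exact identity: the three factorials are written through `stirlingRatio`, so that every
asymptotic statement is postponed to the factors on the right. -/
lemma binPmf_eq {N y : ℕ} {q : ℝ} (h0 : 0 < q) (h1 : q < 1) (hy : 0 < y) (hyN : y < N) :
    binPmf N q y * √(2 * Real.pi * (N * q * (1 - q))) *
      Real.exp ((y - N * q) ^ 2 / (2 * N * q * (1 - q))) =
    stirlingRatio N / (stirlingRatio y * stirlingRatio (N - y)) *
      √((N * q / y) * (N * (1 - q) / (N - y))) * Real.exp (-llError N q y) := by
  have hq1 : 0 < 1 - q := by linarith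
  have hN : 0 < N := by omega
  have hN' : (0 : ℝ) < N := by exact_mod_cast hN
  have hy' : (0 : ℝ) < y := by exact_mod_cast hy
  have hM : 0 < N - y := by omega
  have hc : ((N - y : ℕ) : ℝ) = N - y := Nat.cast_sub hyN.le
  have hM' : (0 : ℝ) < (N : ℝ) - y := by rw [← hc]; exact_mod_cast hM
  have hch : (N.choose y : ℝ) = N.factorial / (y.factorial * (N - y).factorial) := by
    rw [Nat.choose_eq_factorial_div_factorial hyN.le, Nat.cast_div
      (Nat.factorial_mul_factorial_dvd_factorial hyN.le) (by positivity)]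
    push_cast; rfl
  have e1 : Real.exp (-llError N q y) = (N * q / y) ^ y * (N * (1 - q) / (N - y)) ^ (N - y) *
      Real.exp ((y - N * q) ^ 2 / (2 * N * q * (1 - q))) := by
    have a1 : (N * q / y) ^ y = Real.exp (-(y * Real.log (y / (N * q)))) := by
      rw [← mul_neg, ← Real.log_inv, inv_div, Real.exp_nat_mul, Real.exp_log (by positivity)]
    have a2 : (N * (1 - q) / (N - y)) ^ (N - y) =
        Real.exp (-((N - y) * Real.log ((N - y) / (N * (1 - q))))) := by
      rw [← mul_neg, ← Real.log_inv, inv_div, ← hc, Real.exp_nat_mul, hc,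
        Real.exp_log (by positivity)]
    rw [a1, a2, ← Real.exp_add, ← Real.exp_add]
    unfold llError
    congr 1; ring
  rw [e1]
  have e2 : √((N * q / y) * (N * (1 - q) / (N - y))) * (√(2 * Real.pi * y) *
      √(2 * Real.pi * (N - y))) = √(2 * Real.pi * N) * √(2 * Real.pi * (N * q * (1 - q))) := by
    rw [← Real.sqrt_mul (by positivity), ← Real.sqrt_mul (by positivity),
      ← Real.sqrt_mul (by positivity)]
    congr 1
    field_simp
  have e3 : (N * q / y) ^ y * (N * (1 - q) / (N - y)) ^ (N - y) *
      ((y / Real.exp 1) ^ y * ((N - y) / Real.exp 1) ^ (N - y)) =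
      (N / Real.exp 1) ^ N * q ^ y * (1 - q) ^ (N - y) := by
    have : (N / Real.exp 1 : ℝ) ^ N = (N / Real.exp 1) ^ y * (N / Real.exp 1) ^ (N - y) := by
      rw [← pow_add]; congr 1; omega
    rw [this, mul_mul_mul_comm, ← mul_pow, ← mul_pow]
    have b1 : N * q / y * (y / Real.exp 1) = N / Real.exp 1 * q := by field_simp
    have b2 : N * (1 - q) / ((N : ℝ) - y) * ((N - y) / Real.exp 1) = N / Real.exp 1 * (1 - q) := by
      field_simp
    rw [b1, b2, mul_pow, mul_pow]; ring
  unfold binPmf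
  rw [hch, factorial_eq_stirlingRatio_mul hN, factorial_eq_stirlingRatio_mul hy,
    factorial_eq_stirlingRatio_mul hM, hc]
  have p1 := stirlingRatio_pos hy
  have p2 := stirlingRatio_pos hM
  have p3 : 0 < √(2 * Real.pi * (y : ℝ)) := by positivity
  have p4 : 0 < √(2 * Real.pi * ((N : ℝ) - y)) := by positivity
  have p5 : 0 < (y / Real.exp 1 : ℝ) ^ y := by positivity
  have p6 : 0 < (((N : ℝ) - y) / Real.exp 1) ^ (N - y) := by positivity
  rw [div_mul_eq_mul_div, div_mul_eq_mul_div, div_mul_eq_mul_div, div_mul_eq_mul_div,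
    div_mul_eq_mul_div, div_mul_eq_mul_div, div_eq_div_iff (by positivity) (by positivity)]
  -- With roots, powers and exponentials turned into atoms, the claim is a polynomial consequence of
  -- `e2` (square roots) and `e3` (powers).
  generalize Real.exp ((y - N * q) ^ 2 / (2 * N * q * (1 - q))) = W
  generalize √((N * q / y) * (N * (1 - q) / ((N : ℝ) - y))) = A at *
  generalize √(2 * Real.pi * (y : ℝ)) = B at *
  generalize √(2 * Real.pi * ((N : ℝ) - y)) = C at *
  generalize √(2 * Real.pi * (N : ℝ)) = D at *
  generalize √(2 * Real.pi * (N * q * (1 - q))) = F at *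
  generalize (y / Real.exp 1 : ℝ) ^ y = Y at *
  generalize (((N : ℝ) - y) / Real.exp 1) ^ (N - y) = Z at *
  generalize (N * q / y : ℝ) ^ y = Q at *
  generalize (N * (1 - q) / ((N : ℝ) - y)) ^ (N - y) = R at *
  generalize (N / Real.exp 1 : ℝ) ^ N = X at *
  linear_combination (-(W * stirlingRatio N * stirlingRatio y * stirlingRatio (N - y))) *
    (D * F * e3 + Q * R * (Y * Z) * e2)

end LocalLimit
end CommonNbr

namespace CommonNbr

/-! ### Moderate deviations of the binomial tail. -/

section TailAsymptotics

/-- The deviation of `y` from the mean of the binomial law, divided by `√N`. -/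
noncomputable def dev (N : ℕ) (q : ℝ) (y : ℕ) : ℝ := (y - N * q) / √N

/-- One minus the ratio of consecutive binomial probabilities. -/
noncomputable def ratioGap (N : ℕ) (q : ℝ) (m : ℝ) : ℝ := 1 - (N - m) * q / ((m + 1) * (1 - q))

variable {q : ℝ} {N y : ℕ → ℕ}

lemma tendsto_dev_div_sqrt (hv : Tendsto (fun n => dev (N n) q (y n)) atTop atTop)
    (hv3 : Tendsto (fun n => dev (N n) q (y n) ^ 3 / √(N n)) atTop (𝓝 0)) :
    Tendsto (fun n => dev (N n) q (y n) / √(N n)) atTop (𝓝 0) := by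
  refine tendsto_of_tendsto_of_tendsto_of_le_of_le' tendsto_const_nhds hv3 ?_ ?_
  · filter_upwards [hv.eventually_ge_atTop 1] with n hn
    positivity
  · filter_upwards [hv.eventually_ge_atTop 1] with n hn
    gcongr
    exact le_self_pow₀ hn (by norm_num)

lemma tendsto_div_of_dev (hN : Tendsto N atTop atTop)
    (hw : Tendsto (fun n => dev (N n) q (y n) / √(N n)) atTop (𝓝 0)) :
    Tendsto (fun n => (y n : ℝ) / N n) atTop (𝓝 q) := by
  have := hw.const_add q
  rw [add_zero] at this
  refine this.congr' ?_
  filter_upwards [hN.eventually_gt_atTop 0] with n hn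
  have hn' : (0 : ℝ) < N n := by exact_mod_cast hn
  unfold dev
  rw [div_div, Real.mul_self_sqrt hn'.le]
  field_simp
  ring

/-- The error in the exponent is of order `dev ^ 3 / √N`. Thus `hv3` is what keeps the Gaussian
density accurate although the normalised deviation tends to infinity. -/
lemma tendsto_binPmf (h0 : 0 < q) (h1 : q < 1) (hN : Tendsto N atTop atTop)
    (hv : Tendsto (fun n => dev (N n) q (y n)) atTop atTop)
    (hv3 : Tendsto (fun n => dev (N n) q (y n) ^ 3 / √(N n)) atTop (𝓝 0)) :
    Tendsto (fun n => binPmf (N n) q (y n) * √(2 * Real.pi * (N n * q * (1 - q))) *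
      Real.exp (dev (N n) q (y n) ^ 2 / (2 * q * (1 - q)))) atTop (𝓝 1) := by
  have hq1 : 0 < 1 - q := by linarith
  have hw := tendsto_dev_div_sqrt hv hv3
  have hyN := tendsto_div_of_dev hN hw
  have hNr : Tendsto (fun n => (N n : ℝ)) atTop atTop := tendsto_natCast_atTop_atTop.comp hN
  have hyr : Tendsto (fun n => (y n : ℝ)) atTop atTop := by
    refine (hyN.pos_mul_atTop h0 hNr).congr' ?_
    filter_upwards [hN.eventually_gt_atTop 0] with n hn
    have : (N n : ℝ) ≠ 0 := by positivity
    field_simp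
  have hcN : Tendsto (fun n => ((N n : ℝ) - y n) / N n) atTop (𝓝 (1 - q)) := by
    refine (hyN.const_sub 1).congr' ?_
    filter_upwards [hN.eventually_gt_atTop 0] with n hn
    have : (N n : ℝ) ≠ 0 := by positivity
    field_simp
  have hcr : Tendsto (fun n => (N n : ℝ) - y n) atTop atTop := by
    refine (hcN.pos_mul_atTop hq1 hNr).congr' ?_
    filter_upwards [hN.eventually_gt_atTop 0] with n hn
    have : (N n : ℝ) ≠ 0 := by positivity
    field_simp
  have hlt : ∀ᶠ n in atTop, y n < N n := by
    filter_upwards [hcr.eventually_gt_atTop 0] with n hn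
    have : (y n : ℝ) < N n := by linarith
    exact_mod_cast this
  have hyt : Tendsto y atTop atTop := tendsto_natCast_atTop_iff.1 hyr
  have hct : Tendsto (fun n => N n - y n) atTop atTop := by
    rw [← tendsto_natCast_atTop_iff (R := ℝ)]
    refine hcr.congr' ?_
    filter_upwards [hlt] with n hn
    rw [Nat.cast_sub hn.le]
  have hs : Tendsto (fun n => stirlingRatio (N n) /
      (stirlingRatio (y n) * stirlingRatio (N n - y n))) atTop (𝓝 1) := by
    have := (tendsto_stirlingRatio.comp hN).div
      ((tendsto_stirlingRatio.comp hyt).mul (tendsto_stirlingRatio.comp hct)) (by norm_num)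
    simp only [mul_one, div_one] at this
    exact this
  have hr : Tendsto (fun n => √((N n * q / y n) * (N n * (1 - q) / (N n - y n)))) atTop (𝓝 1) := by
    have a1 : Tendsto (fun n => (N n * q / y n : ℝ)) atTop (𝓝 1) := by
      have := (hyN.inv₀ h0.ne').mul_const q
      rw [inv_mul_cancel₀ h0.ne'] at this
      refine this.congr fun n => ?_
      rw [inv_div]; ring
    have a2 : Tendsto (fun n => (N n * (1 - q) / (N n - y n) : ℝ)) atTop (𝓝 1) := by
      have := (hcN.inv₀ hq1.ne').mul_const (1 - q)
      rw [inv_mul_cancel₀ hq1.ne'] at this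
      refine this.congr fun n => ?_
      rw [inv_div]; ring
    have := (a1.mul a2).sqrt
    simpa using this
  have hE : Tendsto (fun n => llError (N n) q (y n)) atTop (𝓝 0) := by
    have hb : Tendsto (fun n => 4 * (dev (N n) q (y n) ^ 3 / √(N n) / q ^ 2 +
        dev (N n) q (y n) ^ 3 / √(N n) / (1 - q) ^ 2)) atTop (𝓝 0) := by
      have := ((hv3.div_const (q ^ 2)).add (hv3.div_const ((1 - q) ^ 2))).const_mul 4
      simpa using this
    refine squeeze_zero_norm' ?_ hb
    filter_upwards [hN.eventually_gt_atTop 0, hv.eventually_ge_atTop 1,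
      hw.eventually_lt_const (u := q / 2) (by positivity),
      hw.eventually_lt_const (u := (1 - q) / 2) (by positivity)] with n hn hv1 hw1 hw2
    have hn' : (0 : ℝ) < N n := by exact_mod_cast hn
    have hsq : 0 < √(N n : ℝ) := Real.sqrt_pos.2 hn'
    have hsq2 : √(N n : ℝ) * √(N n) = N n := Real.mul_self_sqrt hn'.le
    have hu : |(y n : ℝ) - N n * q| = dev (N n) q (y n) * √(N n) := by
      have : (y n : ℝ) - N n * q = dev (N n) q (y n) * √(N n) := by
        unfold dev; rw [div_mul_cancel₀ _ hsq.ne']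
      rw [this, abs_of_nonneg (by positivity)]
    rw [div_lt_iff₀ hsq] at hw1 hw2
    rw [Real.norm_eq_abs]
    refine (abs_llError_le h0 h1 hn ?_ ?_).trans (le_of_eq ?_)
    · rw [hu]; nlinarith
    · rw [hu]; nlinarith
    · rw [hu]
      generalize dev (N n) q (y n) = v
      generalize √(N n : ℝ) = s at *
      rw [← hsq2]
      field_simp
  have := (hs.mul hr).mul (Real.continuous_exp.tendsto _ |>.comp hE.neg)
  simp only [neg_zero, Real.exp_zero, mul_one] at this
  refine this.congr' ?_
  filter_upwards [hlt, hyt.eventually_gt_atTop 0] with n hn hn0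
  simp only [Function.comp]
  rw [← binPmf_eq h0 h1 hn0 hn]
  congr 2
  have hn' : (0 : ℝ) < N n := by have : 0 < N n := by omega
                                 exact_mod_cast this
  unfold dev
  rw [div_pow, Real.sq_sqrt hn'.le, div_div]
  congr 1; ring

/-- The numerator of the gap is `dev * √N + K + (1 - q)`, in which the first term dominates. A shift
of `y` by `o(dev * √N)` is therefore harmless, so the geometric ratios of the upper and lower tail
bounds agree to leading order. -/
lemma tendsto_ratioGap (h0 : 0 < q) (h1 : q < 1) (hN : Tendsto N atTop atTop)
    (hv : Tendsto (fun n => dev (N n) q (y n)) atTop atTop)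
    (hv3 : Tendsto (fun n => dev (N n) q (y n) ^ 3 / √(N n)) atTop (𝓝 0))
    {K : ℕ → ℝ} (hK0 : ∀ n, 0 ≤ K n) (hK : Tendsto (fun n => K n / √(N n) / dev (N n) q (y n)) atTop (𝓝 0)) :
    Tendsto (fun n => q * (1 - q) * √(N n) / dev (N n) q (y n) * ratioGap (N n) q (y n + K n))
      atTop (𝓝 1) := by
  have hq1 : 0 < 1 - q := by linarith
  have hw := tendsto_dev_div_sqrt hv hv3
  have hyN := tendsto_div_of_dev hN hw
  have hNr : Tendsto (fun n => (N n : ℝ)) atTop atTop := tendsto_natCast_atTop_atTop.comp hN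
  have hsr : Tendsto (fun n => √(N n : ℝ)) atTop atTop := Real.tendsto_sqrt_atTop.comp hNr
  have h1u : Tendsto (fun n => (1 - q) / (√(N n) * dev (N n) q (y n))) atTop (𝓝 0) :=
    (hsr.atTop_mul_atTop₀ hv).const_div_atTop _
  have hKN : Tendsto (fun n => K n / N n) atTop (𝓝 0) := by
    have := hK.mul hw
    rw [mul_zero] at this
    refine this.congr' ?_
    filter_upwards [hN.eventually_gt_atTop 0, hv.eventually_ge_atTop 1] with n hn hv1
    have hn' : (0 : ℝ) < N n := by exact_mod_cast hn
    have hd : dev (N n) q (y n) ≠ 0 := by positivity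
    have : √(N n : ℝ) * √(N n) = N n := Real.mul_self_sqrt hn'.le
    rw [div_div, div_mul_div_comm, mul_right_comm, mul_div_mul_right _ _ hd, this]
  have hden : Tendsto (fun n => (y n : ℝ) / N n + K n / N n + 1 / N n) atTop (𝓝 (q + 0 + 0)) :=
    (hyN.add hKN).add (hNr.const_div_atTop 1)
  have hnum : Tendsto (fun n => 1 + K n / √(N n) / dev (N n) q (y n) +
      (1 - q) / (√(N n) * dev (N n) q (y n))) atTop (𝓝 (1 + 0 + 0)) := (hK.const_add 1).add h1u
  have := (hnum.const_mul q).div hden (by simpa using h0.ne')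
  simp only [add_zero, mul_one, div_self h0.ne'] at this
  refine this.congr' ?_
  filter_upwards [hN.eventually_gt_atTop 0, hv.eventually_ge_atTop 1] with n hn hv1
  have hn' : (0 : ℝ) < N n := by exact_mod_cast hn
  have hs : 0 < √(N n : ℝ) := Real.sqrt_pos.2 hn'
  have hs2 : √(N n : ℝ) * √(N n) = N n := Real.mul_self_sqrt hn'.le
  have hv0 : 0 < dev (N n) q (y n) := by linarith
  have hu : (y n : ℝ) = N n * q + dev (N n) q (y n) * √(N n) := by
    unfold dev; rw [div_mul_cancel₀ _ hs.ne']; ring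
  have hyK : (0 : ℝ) < y n + K n + 1 := by have := hK0 n; positivity
  have e : ratioGap (N n) q (y n + K n) =
      (dev (N n) q (y n) * √(N n) + K n + (1 - q)) / ((y n + K n + 1) * (1 - q)) := by
    unfold ratioGap
    rw [eq_div_iff (by positivity), sub_mul, div_mul_cancel₀ _ (by positivity)]
    linear_combination hu
  simp only [Pi.div_apply]
  rw [e]
  have e3 : (y n : ℝ) / N n + K n / N n + 1 / N n = (y n + K n + 1) / (√(N n) * √(N n)) := by
    rw [hs2]; ring
  rw [e3]
  generalize dev (N n) q (y n) = v at *
  generalize √(N n : ℝ) = s at *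
  generalize (y n + K n + 1 : ℝ) = Y at *
  field_simp

lemma tendsto_sqrt_div_sqrt (hN : Tendsto N atTop atTop) :
    Tendsto (fun n => ((N n).sqrt : ℝ) / √(N n)) atTop (𝓝 1) := by
  have hsr : Tendsto (fun n => √(N n : ℝ)) atTop atTop :=
    Real.tendsto_sqrt_atTop.comp (tendsto_natCast_atTop_atTop.comp hN)
  have hl : Tendsto (fun n => 1 - 1 / √(N n : ℝ)) atTop (𝓝 1) := by
    simpa using (hsr.const_div_atTop 1).const_sub 1
  refine tendsto_of_tendsto_of_tendsto_of_le_of_le' hl tendsto_const_nhds ?_ ?_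
  · filter_upwards [hsr.eventually_gt_atTop 0] with n hn
    rw [le_div_iff₀ hn, sub_mul, div_mul_cancel₀ _ hn.ne']
    have := Real.real_sqrt_lt_nat_sqrt_succ (a := N n)
    linarith
  · filter_upwards [hsr.eventually_gt_atTop 0] with n hn
    rw [div_le_one hn]
    exact Real.nat_sqrt_le_real_sqrt

/-- Moderate deviations of the binomial law. -/
theorem tendsto_binTail_mul (h0 : 0 < q) (h1 : q < 1) (hN : Tendsto N atTop atTop)
    (hv : Tendsto (fun n => dev (N n) q (y n)) atTop atTop)
    (hv3 : Tendsto (fun n => dev (N n) q (y n) ^ 3 / √(N n)) atTop (𝓝 0)) :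
    Tendsto (fun n => binTail (N n) q (y n) * (√(2 * Real.pi) *
      (dev (N n) q (y n) / √(q * (1 - q))) *
      Real.exp (dev (N n) q (y n) ^ 2 / (2 * q * (1 - q))))) atTop (𝓝 1) := by
  have hq1 : 0 < 1 - q := by linarith
  have hA := tendsto_binPmf h0 h1 hN hv hv3
  have hw := tendsto_dev_div_sqrt hv hv3
  have hyN := tendsto_div_of_dev hN hw
  have hNr : Tendsto (fun n => (N n : ℝ)) atTop atTop := tendsto_natCast_atTop_atTop.comp hN
  have hg0 := tendsto_ratioGap h0 h1 hN hv hv3 (K := fun _ => 0) (fun _ => le_rfl) (by simp)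
  have hS := tendsto_sqrt_div_sqrt hN
  -- A truncation length of about `√N` is short against `dev * √N`, so the ratio hardly changes. Yet
  -- the length times the gap is of order `dev → ∞`, so the discarded part of the geometric series
  -- is negligible.
  have hgK := tendsto_ratioGap h0 h1 hN hv hv3 (K := fun n => ((N n).sqrt : ℝ))
    (fun _ => by positivity) (hS.div_atTop hv)
  have hKg : Tendsto (fun n => ((N n).sqrt : ℝ) * ratioGap (N n) q (y n + (N n).sqrt))
      atTop atTop := by
    have := ((hS.mul hgK).mul_const ((q * (1 - q))⁻¹)).pos_mul_atTop (by simp; positivity) hv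
    refine this.congr' ?_
    filter_upwards [hN.eventually_gt_atTop 0, hv.eventually_ge_atTop 1] with n hn hv1
    have hs : 0 < √(N n : ℝ) := Real.sqrt_pos.2 (by exact_mod_cast hn)
    have hv0 : 0 < dev (N n) q (y n) := by linarith
    generalize ratioGap (N n) q (y n + (N n).sqrt) = g
    generalize dev (N n) q (y n) = v at *
    generalize √(N n : ℝ) = s at *
    field_simp
  have hU := hA.div hg0 one_ne_zero
  have hL := (hA.div hgK one_ne_zero).mul
    (((Real.tendsto_exp_neg_atTop_nhds_zero.comp hKg)).const_sub 1)
  simp only [div_one, sub_zero, mul_one] at hU hL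
  have hyK : ∀ᶠ n in atTop, y n + (N n).sqrt ≤ N n := by
    have hz : Tendsto (fun n => ((N n).sqrt : ℝ) / N n) atTop (𝓝 0) := by
      have := hS.div_atTop (Real.tendsto_sqrt_atTop.comp hNr)
      refine this.congr' ?_
      filter_upwards with n
      simp only [Function.comp]
      rw [div_div, Real.mul_self_sqrt (by positivity)]
    have := hyN.add hz
    rw [add_zero] at this
    filter_upwards [hN.eventually_gt_atTop 0, this.eventually_lt_const h1] with n hn h
    have hn' : (0 : ℝ) < N n := by exact_mod_cast hn
    rw [← add_div, div_lt_one hn'] at h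
    exact_mod_cast h.le
  have hpos0 : ∀ᶠ n in atTop, 0 < ratioGap (N n) q (y n + 0) := by
    filter_upwards [hN.eventually_gt_atTop 0, hv.eventually_ge_atTop 1,
      hg0.eventually_const_lt zero_lt_one] with n hn hv1 h
    have hn' : (0 : ℝ) < N n := by exact_mod_cast hn
    exact pos_of_mul_pos_right h (by positivity)
  have hposK : ∀ᶠ n in atTop, 0 < ratioGap (N n) q (y n + (N n).sqrt) := by
    filter_upwards [hN.eventually_gt_atTop 0, hv.eventually_ge_atTop 1,
      hgK.eventually_const_lt zero_lt_one] with n hn hv1 h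
    have hn' : (0 : ℝ) < N n := by exact_mod_cast hn
    exact pos_of_mul_pos_right h (by positivity)
  have heq : ∀ (s v W B g : ℝ), 0 < s → 0 < v → 0 < g →
      B * √(2 * Real.pi * (s * s * q * (1 - q))) * W / (q * (1 - q) * s / v * g) =
        B / g * (√(2 * Real.pi) * (v / √(q * (1 - q))) * W) := by
    intro s v W B g hs hv hg
    have : √(2 * Real.pi * (s * s * q * (1 - q))) = √(2 * Real.pi) * (s * √(q * (1 - q))) := by
      rw [mul_assoc (s * s), Real.sqrt_mul (x := 2 * Real.pi) (by positivity),
        Real.sqrt_mul (x := s * s) (by positivity), Real.sqrt_mul_self hs.le]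
    rw [this]
    have h2 : 0 < √(q * (1 - q)) := by positivity
    have h3 : √(q * (1 - q)) * √(q * (1 - q)) = q * (1 - q) :=
      Real.mul_self_sqrt (by positivity)
    generalize √(q * (1 - q)) = r at *
    rw [← h3]
    field_simp
  refine tendsto_of_tendsto_of_tendsto_of_le_of_le' hL hU ?_ ?_
  · filter_upwards [hN.eventually_gt_atTop 0, hv.eventually_ge_atTop 1, hposK, hyK]
      with n hn hv1 hg hyK
    have hn' : (0 : ℝ) < N n := by exact_mod_cast hn
    have hs : 0 < √(N n : ℝ) := Real.sqrt_pos.2 hn'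
    have hs2 : √(N n : ℝ) * √(N n) = N n := Real.mul_self_sqrt hn'.le
    have h := le_binTail h0 h1 hyK (by
      have := hg; unfold ratioGap at this; rw [← sub_sub] at this; linarith)
    rw [sub_sub] at h
    have hv0 : 0 < dev (N n) q (y n) := by linarith
    have e := heq (√(N n)) (dev (N n) q (y n))
      (Real.exp (dev (N n) q (y n) ^ 2 / (2 * q * (1 - q)))) (binPmf (N n) q (y n)) _ hs hv0 hg
    rw [hs2] at e
    simp only [Pi.div_apply, Function.comp]
    rw [e, mul_right_comm]
    refine mul_le_mul_of_nonneg_right h (by positivity)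
  · filter_upwards [hN.eventually_gt_atTop 0, hv.eventually_ge_atTop 1, hpos0, hyK]
      with n hn hv1 hg hyK
    have hn' : (0 : ℝ) < N n := by exact_mod_cast hn
    have hs : 0 < √(N n : ℝ) := Real.sqrt_pos.2 hn'
    have hs2 : √(N n : ℝ) * √(N n) = N n := Real.mul_self_sqrt hn'.le
    have h := binTail_le h0 h1 (y := y n) (N := N n) (by omega) (by
      have := hg; unfold ratioGap at this; simp only [add_zero] at this; linarith)
    have hv0 : 0 < dev (N n) q (y n) := by linarith
    have e := heq (√(N n)) (dev (N n) q (y n))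
      (Real.exp (dev (N n) q (y n) ^ 2 / (2 * q * (1 - q)))) (binPmf (N n) q (y n)) _ hs hv0 hg
    rw [hs2] at e
    simp only [Pi.div_apply]
    rw [e]
    refine mul_le_mul_of_nonneg_right ?_ (by positivity)
    simpa [ratioGap] using h

end TailAsymptotics
end CommonNbr

namespace CommonNbr

/-! ### The centring and scaling give a Poisson limit for the expected counts. -/

section Normalization

lemma tendsto_log_div_sqrt : Tendsto (fun x => Real.log x / √x) atTop (𝓝 0) := by
  have h := (Real.tendsto_pow_log_div_mul_add_atTop 1 0 1 one_ne_zero).comp Real.tendsto_sqrt_atTop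
  have := h.const_mul 2
  rw [mul_zero] at this
  refine this.congr' ?_
  filter_upwards [eventually_gt_atTop 0] with x hx
  simp only [Function.comp, pow_one, one_mul, add_zero]
  rw [Real.log_sqrt hx.le]; ring

lemma tendsto_log_natCast_atTop : Tendsto (fun n : ℕ => Real.log n) atTop atTop :=
  Real.tendsto_log_atTop.comp tendsto_natCast_atTop_atTop

variable {p : ℝ} {k : ℕ}

lemma sqrt_variance_pos (hp0 : 0 < p) (hp1 : p < 1) (hk : 0 < k) : 0 < √(p ^ k * (1 - p ^ k)) := by
  have : p ^ k < 1 := pow_lt_one₀ hp0.le hp1 hk.ne'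
  have : 0 < 1 - p ^ k := by linarith
  positivity

lemma scale_eq (hp0 : 0 < p) (hp1 : p < 1) (n : ℕ) :
    scale p n k = √(p ^ k * (1 - p ^ k)) * √n / √(2 * k * Real.log n) := by
  have : p ^ k ≤ 1 := pow_le_one₀ hp0.le hp1.le
  have h1 : 0 ≤ 1 - p ^ k := by linarith
  unfold scale
  rw [Real.sqrt_div (by positivity), Real.sqrt_mul (by positivity)]

lemma scale_pos (hp0 : 0 < p) (hp1 : p < 1) (hk : 0 < k) {n : ℕ} (hn : 2 ≤ n) :
    0 < scale p n k := by
  have h1 := sqrt_variance_pos hp0 hp1 hk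
  have : 0 < Real.log n := Real.log_pos (by exact_mod_cast hn)
  have : (0 : ℝ) < n := by positivity
  rw [scale_eq hp0 hp1]
  positivity

/-- With `T = 2 k log n` the standardised threshold is `√T + D / √T`, whose square is `T + 2 D +
o(1)`. The terms of `D` are such that `exp (-T / 2 - D)` equals `n^{-k} k! √(2 π T)` up to the
factor contributed by `x`, and `√(2 π T)` cancels against the prefactor of the Gaussian tail. -/
lemma center_eq (hp0 : 0 < p) (hp1 : p < 1) (hk : 0 < k) {n : ℕ} (hn : 2 ≤ n) :
    center p n k = n * p ^ k + √(p ^ k * (1 - p ^ k)) * √n * (√(2 * k * Real.log n) +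
      (-Real.log k.factorial - Real.log (2 * Real.pi * (2 * k * Real.log n)) / 2) /
        √(2 * k * Real.log n)) := by
  have : p ^ k ≤ 1 := pow_le_one₀ hp0.le hp1.le
  have h1 : 0 ≤ 1 - p ^ k := by linarith
  have hL : 0 < Real.log n := Real.log_pos (by exact_mod_cast hn)
  have hT : 0 < 2 * k * Real.log n := by positivity
  have e1 : (2 * k * p ^ k * (1 - p ^ k) * n * Real.log n : ℝ) =
      p ^ k * (1 - p ^ k) * n * (2 * k * Real.log n) := by ring
  have e2 : 4 * Real.pi * k * Real.log n = 2 * Real.pi * (2 * k * Real.log n) := by ring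
  have e3 : (4 * k * Real.log n : ℝ) = 2 * (2 * k * Real.log n) := by ring
  unfold center
  rw [e1, Real.sqrt_mul (by positivity), Real.sqrt_mul (by positivity), e2, e3]
  have hs : 0 < √(2 * k * Real.log n) := by positivity
  have hs2 : √(2 * k * Real.log n) * √(2 * k * Real.log n) = 2 * k * Real.log n :=
    Real.mul_self_sqrt hT.le
  generalize Real.log (2 * Real.pi * (2 * k * Real.log n)) = W
  generalize √(2 * k * Real.log n) = s at *
  rw [← hs2]
  field_simp
  ring

/-- Poisson asymptotics for the expected number of sets with many common neighbours. -/
theorem tendsto_binTail_center (hp0 : 0 < p) (hp1 : p < 1) (hk : 0 < k) {x : ℝ} {N y : ℕ → ℕ}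
    {C : ℕ} (hN : ∀ᶠ n in atTop, N n ≤ n ∧ n ≤ N n + C)
    (hy : Tendsto (fun n => (y n - center p n k) / scale p n k) atTop (𝓝 x)) :
    Tendsto (fun n : ℕ => (n : ℝ) ^ k / k.factorial * binTail (N n) (p ^ k) (y n)) atTop
      (𝓝 (Real.exp (-x))) := by
  set q := p ^ k with hq
  have h0 : 0 < q := by positivity
  have h1 : q < 1 := pow_lt_one₀ hp0.le hp1 hk.ne'
  have hq1 : 0 < 1 - q := by linarith
  set σ := √(q * (1 - q)) with hσ
  have hσ0 : 0 < σ := sqrt_variance_pos hp0 hp1 hk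
  have hσ2 : σ * σ = q * (1 - q) := Real.mul_self_sqrt (by positivity)
  set T : ℕ → ℝ := fun n => 2 * k * Real.log n with hTdef
  have hT : Tendsto T atTop atTop :=
    tendsto_log_natCast_atTop.const_mul_atTop (by positivity)
  have hsT : Tendsto (fun n => √(T n)) atTop atTop := Real.tendsto_sqrt_atTop.comp hT
  set X : ℕ → ℝ := fun n => (y n - center p n k) / scale p n k with hX
  set D : ℕ → ℝ := fun n => -Real.log k.factorial - Real.log (2 * Real.pi * T n) / 2 + X n with hD
  have hr : Tendsto (fun n => D n / √(T n)) atTop (𝓝 0) := by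
    have a1 : Tendsto (fun n => Real.log (2 * Real.pi * T n) / √(T n)) atTop (𝓝 0) := by
      have := (tendsto_log_div_sqrt.comp (hT.const_mul_atTop
        (by positivity : 0 < 2 * Real.pi))).mul_const √(2 * Real.pi)
      rw [zero_mul] at this
      refine this.congr' ?_
      filter_upwards [hT.eventually_gt_atTop 0] with n hn
      simp only [Function.comp]
      rw [Real.sqrt_mul (by positivity)]
      have : 0 < √(2 * Real.pi) := by positivity
      have : 0 < √(T n) := by positivity
      generalize √(2 * Real.pi) = c at *
      field_simp
    have a2 := hsT.const_div_atTop (-Real.log k.factorial)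
    have a3 := hy.div_atTop hsT
    have := (a2.sub (a1.div_const 2)).add a3
    simp only [zero_div, sub_zero, add_zero] at this
    refine this.congr fun n => ?_
    simp only [hD]; ring
  -- `ζ` is the deviation of `y` standardised for `n` trials, while `z` below is standardised for
  -- the actual number `N n` of trials.
  set ζ : ℕ → ℝ := fun n => √(T n) + D n / √(T n) with hζ
  have hζT : Tendsto (fun n => ζ n / √(T n)) atTop (𝓝 1) := by
    have := (hr.div_atTop hsT).const_add 1
    rw [add_zero] at this
    refine this.congr' ?_
    filter_upwards [hsT.eventually_gt_atTop 0] with n hn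
    simp only [hζ]; field_simp
  have hNle : ∀ᶠ n in atTop, ((N n : ℝ) ≤ n ∧ (n : ℝ) ≤ N n + C) := by
    filter_upwards [hN] with n hn
    exact ⟨by exact_mod_cast hn.1, by exact_mod_cast hn.2⟩
  have hNt : Tendsto N atTop atTop := by
    refine tendsto_atTop_mono' _ (f₁ := fun n => n - C) ?_ (tendsto_sub_atTop_nat C)
    filter_upwards [hN] with n hn
    omega
  have hNr : Tendsto (fun n => (N n : ℝ)) atTop atTop := tendsto_natCast_atTop_atTop.comp hNt
  have hsN : Tendsto (fun n => √(N n : ℝ)) atTop atTop := Real.tendsto_sqrt_atTop.comp hNr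
  -- A bounded number of missing trials does not affect the limit: `n - N n` lies between `0` and
  -- `C`.
  have hdiff : ∀ {f : ℕ → ℝ}, Tendsto f atTop (𝓝 0) →
      Tendsto (fun n : ℕ => ((n : ℝ) - N n) * f n) atTop (𝓝 0) := by
    intro f hf
    have hb := (hf.abs.const_mul (C : ℝ))
    rw [abs_zero, mul_zero] at hb
    refine squeeze_zero_norm' ?_ hb
    filter_upwards [hNle] with n hn
    rw [norm_mul, Real.norm_eq_abs, Real.norm_eq_abs]
    gcongr
    rw [abs_of_nonneg (by linarith)]; linarith
  have hα : Tendsto (fun n : ℕ => √((n : ℝ) / N n)) atTop (𝓝 1) := by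
    have := (hdiff (hNr.const_div_atTop 1)).const_add 1
    rw [add_zero] at this
    have := this.sqrt
    rw [Real.sqrt_one] at this
    refine this.congr' ?_
    filter_upwards [hNr.eventually_gt_atTop 0] with n hn
    congr 1; field_simp; ring
  have hT3 : Tendsto (fun n => √(T n) ^ 3 / √(N n)) atTop (𝓝 0) := by
    have a := ((Real.tendsto_pow_log_div_mul_add_atTop 1 0 3 one_ne_zero).comp
      (tendsto_natCast_atTop_atTop (R := ℝ))).const_mul ((2 * k : ℝ) ^ 3)
    rw [mul_zero] at a
    have := a.sqrt.mul hα
    rw [Real.sqrt_zero, zero_mul] at this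
    refine this.congr' ?_
    filter_upwards [hNr.eventually_gt_atTop 0, hT.eventually_gt_atTop 0,
      eventually_gt_atTop 0] with n hn hTn hn0
    have hn' : (0 : ℝ) < n := by exact_mod_cast hn0
    simp only [Function.comp, one_mul, add_zero]
    have hL : 0 < Real.log n := by
      have : 0 < 2 * (k : ℝ) * Real.log n := hTn
      exact pos_of_mul_pos_right this (by positivity)
    have e3 : √(T n) ^ 3 = √(T n ^ 3) := by
      rw [eq_comm, Real.sqrt_eq_iff_mul_self_eq (by positivity) (by positivity)]
      have : √(T n) * √(T n) = T n := Real.mul_self_sqrt hTn.le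
      calc T n ^ 3 = (√(T n) * √(T n)) ^ 3 := by rw [this]
        _ = _ := by ring
    rw [← Real.sqrt_mul (by positivity), e3, ← Real.sqrt_div (by positivity)]
    congr 1
    simp only [hTdef]
    field_simp
  have hT1 : Tendsto (fun n => √(T n) / √(N n)) atTop (𝓝 0) := by
    refine tendsto_of_tendsto_of_tendsto_of_le_of_le' tendsto_const_nhds hT3 ?_ ?_
    · exact Eventually.of_forall fun n => by positivity
    · filter_upwards [hsT.eventually_ge_atTop 1] with n hn
      gcongr
      exact le_self_pow₀ hn (by norm_num)
  have hζN : Tendsto (fun n => ζ n / √(N n)) atTop (𝓝 0) := by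
    have := hζT.mul hT1
    rw [mul_zero] at this
    refine this.congr' ?_
    filter_upwards [hsT.eventually_gt_atTop 0] with n hn
    rw [div_mul_div_comm, mul_comm (√(T n)), mul_div_mul_right _ _ hn.ne']
  set z : ℕ → ℝ := fun n => dev (N n) q (y n) / σ with hz
  have hz_eq : ∀ᶠ n in atTop, z n = √((n : ℝ) / N n) * ζ n + (n - N n) * (q / σ / √(N n)) := by
    filter_upwards [hNr.eventually_gt_atTop 0, hT.eventually_gt_atTop 0,
      eventually_ge_atTop 2] with n hn hTn hn2
    have hsc := scale_pos (p := p) hp0 hp1 hk hn2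
    have hyn : (y n : ℝ) = center p n k + scale p n k * X n := by
      simp only [hX]; field_simp; ring
    rw [center_eq hp0 hp1 hk hn2, scale_eq hp0 hp1] at hyn
    have hsTn : 0 < √(T n) := by positivity
    have hyn' : (y n : ℝ) = n * q + σ * √n * ζ n := by
      rw [hyn]
      simp only [hζ, hD]
      change n * q + σ * √n * (√(T n) + (-Real.log k.factorial - Real.log (2 * Real.pi * T n) / 2) /
        √(T n)) + σ * √n / √(T n) * X n = _
      field_simp
      ring
    simp only [hz]
    unfold dev
    rw [hyn', Real.sqrt_div (by positivity)]
    have : 0 < √(N n : ℝ) := by positivity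
    field_simp
    ring
  have hzT : Tendsto (fun n => z n / √(T n)) atTop (𝓝 1) := by
    have a := hα.mul hζT
    have b := hdiff ((hsN.const_div_atTop (q / σ)).div_atTop hsT)
    have := a.add b
    simp only [mul_one, add_zero] at this
    refine this.congr' ?_
    filter_upwards [hz_eq] with n hn
    rw [hn]; ring
  -- The ratio `z / ζ → 1` would not suffice, since the squares stand in an exponent and tend to
  -- infinity.
  have he : Tendsto (fun n => z n ^ 2 - ζ n ^ 2) atTop (𝓝 0) := by
    have a := hdiff (hζN.pow 2 |>.trans (by simp))
    have b := (hα.mul (hdiff (hζN.const_mul (2 * (q / σ)) |>.trans (by simp))))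
    have c := (hdiff (hsN.const_div_atTop (q / σ))).pow 2
    have := (a.add b).add c
    simp only [mul_zero, add_zero, ne_eq, OfNat.ofNat_ne_zero, not_false_eq_true, zero_pow] at this
    refine this.congr' ?_
    filter_upwards [hz_eq, hNr.eventually_gt_atTop 0] with n hn hn0
    have hs : 0 < √(N n : ℝ) := by positivity
    have e1 : √((n : ℝ) / N n) ^ 2 = 1 + (n - N n) / √(N n) ^ 2 := by
      rw [Real.sq_sqrt (by positivity), Real.sq_sqrt hn0.le]; field_simp; ring
    rw [hn]
    have : (√((n : ℝ) / N n) * ζ n + (n - N n) * (q / σ / √(N n))) ^ 2 - ζ n ^ 2 =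
      (√((n : ℝ) / N n) ^ 2 - 1) * ζ n ^ 2 + √((n : ℝ) / N n) * ((n - N n) *
        (2 * (q / σ) * (ζ n / √(N n)))) + ((n - N n) * (q / σ / √(N n))) ^ 2 := by ring
    rw [this, e1]
    ring
  have hv : Tendsto (fun n => dev (N n) q (y n)) atTop atTop := by
    have := (hzT.const_mul σ).pos_mul_atTop (by simpa using hσ0) hsT
    refine this.congr' ?_
    filter_upwards [hsT.eventually_gt_atTop 0] with n hn
    simp only [hz]; field_simp
  have hv3 : Tendsto (fun n => dev (N n) q (y n) ^ 3 / √(N n)) atTop (𝓝 0) := by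
    have := (((hzT.const_mul σ).pow 3).mul hT3)
    rw [mul_zero] at this
    refine this.congr' ?_
    filter_upwards [hsT.eventually_gt_atTop 0] with n hn
    simp only [hz]; field_simp
  have hmain := tendsto_binTail_mul h0 h1 hNt hv hv3
  -- The additional factor is chosen so that its product with the Gaussian normaliser is exactly `n
  -- ^ k / k!`, while the factor itself tends to `e^{-x}`.
  have hlim : Tendsto (fun n => binTail (N n) q (y n) * (√(2 * Real.pi) *
      (dev (N n) q (y n) / √(q * (1 - q))) *
      Real.exp (dev (N n) q (y n) ^ 2 / (2 * q * (1 - q)))) * ((z n / √(T n))⁻¹ *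
      Real.exp (-X n - (D n / √(T n)) ^ 2 / 2 - (z n ^ 2 - ζ n ^ 2) / 2))) atTop
      (𝓝 (1 * (1⁻¹ * Real.exp (-x - 0 ^ 2 / 2 - 0 / 2)))) :=
    hmain.mul ((hzT.inv₀ one_ne_zero).mul (Real.continuous_exp.tendsto _ |>.comp
      ((hy.neg.sub ((hr.pow 2).div_const 2)).sub (he.div_const 2))))
  have hone : 1 * (1⁻¹ * Real.exp (-x - 0 ^ 2 / 2 - 0 / 2)) = Real.exp (-x) := by norm_num
  rw [hone] at hlim
  refine hlim.congr' ?_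
  filter_upwards [hsT.eventually_gt_atTop 0, hv.eventually_gt_atTop 0, hT.eventually_gt_atTop 0,
    eventually_ge_atTop 2] with n hn hvn hTn hn2
  have hn0 : (0 : ℝ) < n := by positivity
  have hzn : 0 < z n := by simp only [hz]; positivity
  have hnk : (n : ℝ) ^ k / k.factorial = Real.exp (T n / 2 - Real.log k.factorial) := by
    rw [Real.exp_sub, Real.exp_log (by positivity)]
    congr 1
    simp only [hTdef]
    rw [show 2 * k * Real.log n / 2 = k * Real.log n by ring, Real.exp_nat_mul, Real.exp_log hn0]
  have hdz : dev (N n) q (y n) ^ 2 / (2 * q * (1 - q)) = z n ^ 2 / 2 := by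
    simp only [hz]
    rw [div_pow, sq σ, hσ2, div_div]; ring
  have hsT2 : √(T n) = Real.exp (Real.log (2 * Real.pi * T n) / 2) / √(2 * Real.pi) := by
    rw [← Real.log_sqrt (by positivity), Real.exp_log (by positivity),
      eq_div_iff (by positivity), ← Real.sqrt_mul hTn.le, mul_comm]
  have hζ2 : ζ n ^ 2 = T n + 2 * D n + (D n / √(T n)) ^ 2 := by
    simp only [hζ]
    have : √(T n) ^ 2 = T n := Real.sq_sqrt hTn.le
    rw [add_sq, this]
    field_simp
  rw [hdz, hnk]
  change binTail (N n) q (y n) * (√(2 * Real.pi) * z n * Real.exp (z n ^ 2 / 2)) *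
    ((z n / √(T n))⁻¹ * Real.exp (-X n - (D n / √(T n)) ^ 2 / 2 - (z n ^ 2 - ζ n ^ 2) / 2)) = _
  have e4 : Real.exp (z n ^ 2 / 2) * (Real.exp (Real.log (2 * Real.pi * T n) / 2) *
      Real.exp (-X n - (D n / √(T n)) ^ 2 / 2 - (z n ^ 2 - ζ n ^ 2) / 2)) =
      Real.exp (T n / 2 - Real.log k.factorial) := by
    rw [← Real.exp_add, ← Real.exp_add]
    congr 1
    rw [hζ2]
    simp only [hD]
    ring
  rw [← e4]
  have : (z n / √(T n))⁻¹ = √(T n) / z n := inv_div _ _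
  rw [this]
  nth_rewrite 1 [hsT2]
  have : 0 < √(2 * Real.pi) := by positivity
  generalize Real.exp (-X n - (D n / √(T n)) ^ 2 / 2 - (z n ^ 2 - ζ n ^ 2) / 2) = E1
  generalize √(2 * Real.pi) = c at *
  field_simp

end Normalization
end CommonNbr

namespace CommonNbr

/-! ### Cruder thresholds that bracket the extremal ones. -/

section Levels

/-- A number of common neighbours of an `s`-set that exceeds its mean by `c` times the typical excess
of the maximum over all `s`-sets. -/
noncomputable def level (p : ℝ) (s : ℕ) (c : ℝ) (n : ℕ) : ℝ :=
  n * p ^ s + c * √(2 * s * (p ^ s * (1 - p ^ s))) * √(n * Real.log n)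

lemma level_mono {p : ℝ} {s n : ℕ} {c c' : ℝ} (h : c ≤ c') : level p s c n ≤ level p s c' n := by
  unfold level; gcongr

variable {p : ℝ} {k : ℕ}

lemma tendsto_log_div_self : Tendsto (fun n : ℕ => Real.log n / n) atTop (𝓝 0) := by
  have := (Real.tendsto_pow_log_div_mul_add_atTop 1 0 1 one_ne_zero).comp
    (tendsto_natCast_atTop_atTop (R := ℝ))
  simpa [Function.comp_def] using this

lemma tendsto_scale (hp0 : 0 < p) (hp1 : p < 1) (hk : 0 < k) :
    Tendsto (fun n => scale p n k) atTop atTop := by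
  have h1 : p ^ k < 1 := pow_lt_one₀ hp0.le hp1 hk.ne'
  have h2 : 0 < 1 - p ^ k := by linarith
  refine Real.tendsto_sqrt_atTop.comp ?_
  have h0 : Tendsto (fun n : ℕ => Real.log n / n) atTop (𝓝[>] 0) := by
    refine tendsto_nhdsWithin_iff.2 ⟨tendsto_log_div_self, ?_⟩
    filter_upwards [eventually_ge_atTop 2] with n hn
    exact div_pos (Real.log_pos (by exact_mod_cast hn)) (by positivity)
  have := (tendsto_inv_nhdsGT_zero.comp h0).const_mul_atTop
    (by positivity : 0 < p ^ k * (1 - p ^ k) / (2 * k))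
  refine this.congr fun n => ?_
  simp only [Function.comp, inv_div]
  rw [div_mul_div_comm]

/-- The corrections in the centring and the shift by `x` are of relative order `o(1)`. Levels with
`c < 1` and `c > 1` thus enclose all thresholds, and the large deviation bounds can ignore the fine
normalisation. -/
lemma tendsto_sub_div_level (hp0 : 0 < p) (hp1 : p < 1) (hk : 0 < k) {x : ℝ} {y : ℕ → ℝ}
    (hy : Tendsto (fun n => (y n - center p n k) / scale p n k) atTop (𝓝 x)) :
    Tendsto (fun n : ℕ => (y n - n * p ^ k) /
      (√(2 * k * (p ^ k * (1 - p ^ k))) * √(n * Real.log n))) atTop (𝓝 1) := by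
  have hσ0 := sqrt_variance_pos hp0 hp1 hk
  have h1 : p ^ k < 1 := pow_lt_one₀ hp0.le hp1 hk.ne'
  have h2 : 0 < 1 - p ^ k := by linarith
  have hT : Tendsto (fun n : ℕ => 2 * k * Real.log n) atTop atTop :=
    tendsto_log_natCast_atTop.const_mul_atTop (by positivity)
  have a1 : Tendsto (fun n : ℕ => (-Real.log k.factorial) / (2 * k * Real.log n)) atTop (𝓝 0) :=
    hT.const_div_atTop _
  have a2 : Tendsto (fun n : ℕ => Real.log (2 * Real.pi * (2 * k * Real.log n)) /
      (2 * k * Real.log n)) atTop (𝓝 0) := by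
    have := (Real.tendsto_pow_log_div_mul_add_atTop (1 / (2 * Real.pi)) 0 1 (by positivity)).comp
      (hT.const_mul_atTop (by positivity : 0 < 2 * Real.pi))
    refine this.congr fun n => ?_
    simp only [Function.comp, pow_one, add_zero]
    congr 1
    field_simp
  have a3 := hy.div_atTop hT
  have := ((a1.sub (a2.div_const 2)).add a3).const_add 1
  simp only [zero_div, sub_zero, add_zero] at this
  refine this.congr' ?_
  filter_upwards [eventually_ge_atTop 2, hT.eventually_gt_atTop 0] with n hn hTn
  have hsc := scale_pos (p := p) hp0 hp1 hk hn
  have hn0 : (0 : ℝ) < n := by positivity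
  have hL : 0 < Real.log n := Real.log_pos (by exact_mod_cast hn)
  have e : √(2 * k * (p ^ k * (1 - p ^ k))) * √(n * Real.log n) =
      √(p ^ k * (1 - p ^ k)) * √n * √(2 * k * Real.log n) := by
    rw [← Real.sqrt_mul (by positivity), ← Real.sqrt_mul (by positivity),
      ← Real.sqrt_mul (by positivity)]
    congr 1; ring
  have hy2 : y n - n * p ^ k = √(p ^ k * (1 - p ^ k)) * √n * (√(2 * k * Real.log n) +
      (-Real.log k.factorial - Real.log (2 * Real.pi * (2 * k * Real.log n)) / 2) /
        √(2 * k * Real.log n)) + √(p ^ k * (1 - p ^ k)) * √n / √(2 * k * Real.log n) *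
        ((y n - center p n k) / scale p n k) := by
    rw [← scale_eq hp0 hp1, mul_div_cancel₀ _ hsc.ne']
    have := center_eq (p := p) hp0 hp1 hk hn
    linarith
  rw [e, hy2]
  have hs : 0 < √(2 * k * Real.log n) := by positivity
  have hsn : 0 < √(n : ℝ) := by positivity
  have hs2 : √(2 * k * Real.log n) * √(2 * k * Real.log n) = 2 * k * Real.log n :=
    Real.mul_self_sqrt hTn.le
  generalize (y n - center p n k) / scale p n k = X
  generalize Real.log (2 * Real.pi * (2 * k * Real.log n)) = W
  generalize √(2 * k * Real.log n) = s at *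
  rw [← hs2]
  generalize √(p ^ k * (1 - p ^ k)) = σ at *
  field_simp
  ring

lemma tendsto_affine_sub_center (hp0 : 0 < p) (hp1 : p < 1) (hk : 0 < k) (x C : ℝ) :
    Tendsto (fun n => (center p n k + scale p n k * x - C - center p n k) / scale p n k) atTop
      (𝓝 x) := by
  have := ((tendsto_scale hp0 hp1 hk).const_div_atTop C).const_sub x
  rw [sub_zero] at this
  refine this.congr' ?_
  filter_upwards [eventually_ge_atTop 2] with n hn
  have hsc := scale_pos (p := p) hp0 hp1 hk hn
  field_simp
  ring

lemma eventually_level_le (hp0 : 0 < p) (hp1 : p < 1) (hk : 0 < k) (x C : ℝ) {c : ℝ} (hc : c < 1) :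
    ∀ᶠ n in atTop, level p k c n ≤ center p n k + scale p n k * x - C := by
  have h := tendsto_sub_div_level hp0 hp1 hk (tendsto_affine_sub_center hp0 hp1 hk x C)
  have h1 : p ^ k < 1 := pow_lt_one₀ hp0.le hp1 hk.ne'
  have h2 : 0 < 1 - p ^ k := by linarith
  filter_upwards [h.eventually_const_le hc, eventually_ge_atTop 2] with n hn hn2
  have hn0 : (0 : ℝ) < n := by positivity
  have hL : 0 < Real.log n := Real.log_pos (by exact_mod_cast hn2)
  rw [le_div_iff₀ (by positivity)] at hn
  unfold level
  linarith

lemma eventually_le_level (hp0 : 0 < p) (hp1 : p < 1) (hk : 0 < k) (x C : ℝ) {c : ℝ} (hc : 1 < c) :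
    ∀ᶠ n in atTop, center p n k + scale p n k * x - C ≤ level p k c n := by
  have h := tendsto_sub_div_level hp0 hp1 hk (tendsto_affine_sub_center hp0 hp1 hk x C)
  have h1 : p ^ k < 1 := pow_lt_one₀ hp0.le hp1 hk.ne'
  have h2 : 0 < 1 - p ^ k := by linarith
  filter_upwards [h.eventually_le_const hc, eventually_ge_atTop 2] with n hn hn2
  have hn0 : (0 : ℝ) < n := by positivity
  have hL : 0 < Real.log n := Real.log_pos (by exact_mod_cast hn2)
  rw [div_le_iff₀ (by positivity)] at hn
  unfold level
  linarith

end Levels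

/-! ### Strict inequalities between the exponents. -/

section Exponents

/-- In other words `(x ^ s - 1) / s` increases strictly with `s`: it is `x - 1` times the average of
the powers `1, …, x ^ (s - 1)`. All strictness in the two exponent inequalities below comes from
here. -/
lemma mul_pow_sub_one_lt {x : ℝ} (hx : 1 < x) {s k : ℕ} (hs : 0 < s) (hk : s < k) :
    k * (x ^ s - 1) < s * (x ^ k - 1) := by
  have key : ∀ j, s ≤ j → x ^ s - 1 < s * x ^ j * (x - 1) := by
    intro j hj
    have h1 : x ^ s - 1 = (∑ i ∈ Finset.range s, x ^ i) * (x - 1) := (geom_sum_mul x s).symm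
    rw [h1]
    refine mul_lt_mul_of_pos_right ?_ (by linarith)
    calc ∑ i ∈ Finset.range s, x ^ i < ∑ i ∈ Finset.range s, x ^ j :=
          Finset.sum_lt_sum_of_nonempty (Finset.nonempty_range_iff.2 hs.ne') fun i hi =>
            pow_lt_pow_right₀ hx ((Finset.mem_range.1 hi).trans_le hj)
      _ = _ := by simp
  induction k, hk using Nat.le_induction with
  | base =>
    have := key s le_rfl
    push_cast
    rw [pow_succ]; nlinarith
  | succ k hk ih =>
    have := key k (by omega)
    push_cast
    rw [pow_succ]; nlinarith

variable {p : ℝ}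

/-- `p⁻ˢ - 1`. -/
noncomputable def odds (p : ℝ) (s : ℕ) : ℝ := p⁻¹ ^ s - 1

lemma odds_pos (hp0 : 0 < p) (hp1 : p < 1) {s : ℕ} (hs : 0 < s) : 0 < odds p s := by
  have := one_lt_pow₀ ((one_lt_inv₀ hp0).2 hp1) hs.ne'
  unfold odds; linarith

lemma odds_nonneg (hp0 : 0 < p) (hp1 : p < 1) (s : ℕ) : 0 ≤ odds p s := by
  have := one_le_pow₀ (one_lt_inv₀ hp0 |>.2 hp1).le (n := s)
  unfold odds; linarith

lemma mul_odds_lt (hp0 : 0 < p) (hp1 : p < 1) {s k : ℕ} (hs : 0 < s) (hk : s < k) :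
    k * odds p s < s * odds p k := mul_pow_sub_one_lt ((one_lt_inv₀ hp0).2 hp1) hs hk

lemma variance_eq_odds (hp0 : 0 < p) (s : ℕ) : p ^ s * (1 - p ^ s) = (p ^ s) ^ 2 * odds p s := by
  unfold odds
  rw [inv_pow]
  field_simp

/-- The gain in the exponent for extending an `s`-set to a `k`-set. -/
lemma extension_exponent (hp0 : 0 < p) (hp1 : p < 1) {s k : ℕ} (hs : 0 < s) (hk : s < k) :
    0 < √(2 * k * (p ^ k * (1 - p ^ k))) - p ^ (k - s) * √(2 * s * (p ^ s * (1 - p ^ s))) ∧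
    2 * ((k : ℝ) - s) * (p ^ s * (p ^ (k - s) * (1 - p ^ (k - s)))) <
    (√(2 * k * (p ^ k * (1 - p ^ k))) - p ^ (k - s) * √(2 * s * (p ^ s * (1 - p ^ s)))) ^ 2 := by
  have hos := odds_pos hp0 hp1 hs
  have hok := odds_pos hp0 hp1 (hs.trans hk)
  have hlt := mul_odds_lt hp0 hp1 hs hk
  have hs' : (0 : ℝ) < s := by exact_mod_cast hs
  have hk' : (s : ℝ) < k := by exact_mod_cast hk
  have hk0 : (0 : ℝ) < k := by linarith
  have epk : p ^ k = p ^ (k - s) * p ^ s := by rw [← pow_add]; congr 1; omega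
  have e1 : √(2 * k * (p ^ k * (1 - p ^ k))) = p ^ k * √(2 * (k * odds p k)) := by
    rw [variance_eq_odds hp0, show 2 * k * ((p ^ k) ^ 2 * odds p k) =
      (p ^ k) ^ 2 * (2 * (k * odds p k)) by ring, Real.sqrt_mul (by positivity),
      Real.sqrt_sq (by positivity)]
  have e2 : p ^ (k - s) * √(2 * s * (p ^ s * (1 - p ^ s))) = p ^ k * √(2 * (s * odds p s)) := by
    rw [variance_eq_odds hp0, show 2 * s * ((p ^ s) ^ 2 * odds p s) =
      (p ^ s) ^ 2 * (2 * (s * odds p s)) by ring, Real.sqrt_mul (by positivity),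
      Real.sqrt_sq (by positivity), epk]
    ring
  have e3 : p ^ s * (p ^ (k - s) * (1 - p ^ (k - s))) = (p ^ k) ^ 2 * (odds p k - odds p s) := by
    unfold odds
    rw [inv_pow, inv_pow, epk]
    field_simp
    ring
  have hmono : odds p s < odds p k := by nlinarith
  rw [e1, e2, e3, ← mul_sub]
  have hpk : 0 < p ^ k := by positivity
  constructor
  · refine mul_pos hpk (sub_pos.2 (Real.sqrt_lt_sqrt (by positivity) ?_))
    have := mul_lt_mul'' hk' hmono hs'.le hos.le
    linarith
  · rw [mul_pow]
    have : 2 * ((k : ℝ) - s) * (odds p k - odds p s) <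
        (√(2 * (k * odds p k)) - √(2 * (s * odds p s))) ^ 2 := by
      rw [sub_sq, Real.sq_sqrt (by positivity), Real.sq_sqrt (by positivity),
        mul_assoc 2 √(2 * (k * odds p k)), ← Real.sqrt_mul (by positivity)]
      -- After expansion the claim is the inequality of arithmetic and geometric means for `k * odds
      -- p s` and `s * odds p k`, strict because these differ by `hlt`.
      have h4 : √(2 * (k * odds p k) * (2 * (s * odds p s))) < k * odds p s + s * odds p k := by
        rw [Real.sqrt_lt' (by positivity)]
        nlinarith [mul_self_pos.2 (sub_pos.2 hlt).ne']
      linarith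
    have h5 := mul_lt_mul_of_pos_left this (pow_pos hpk 2)
    linarith

/-- Sets meeting the given sets, but different from them, do not have extremal neighbourhoods. -/
lemma overlap_exponent (hp0 : 0 < p) (hp1 : p < 1) {ι : Type*} [Fintype ι] {κ σ : ι → ℕ}
    (hκ : ∀ a, 0 < κ a) (hσ : ∀ a, σ a ≤ κ a) (hpos : 0 < ∑ a, σ a)
    (hne : ∀ a, σ a = κ a → σ a ≠ ∑ b, σ b) :
    ∑ a, √(2 * κ a / (p ^ κ a * (1 - p ^ κ a))) * (p ^ (κ a + ∑ b, σ b - σ a) - p ^ (κ a + ∑ b, σ b))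
      < √(2 * ((∑ b, σ b : ℕ) : ℝ) * (p ^ (∑ b, σ b) * (1 - p ^ (∑ b, σ b)))) := by
  set s := ∑ b, σ b with hs
  have hs' : (0 : ℝ) < s := by exact_mod_cast hpos
  have hos := odds_pos hp0 hp1 hpos
  have hle : ∀ a, σ a ≤ s := fun a => Finset.single_le_sum (fun _ _ => Nat.zero_le _)
    (Finset.mem_univ a)
  have term : ∀ a, √(2 * κ a / (p ^ κ a * (1 - p ^ κ a))) * (p ^ (κ a + s - σ a) - p ^ (κ a + s)) =
      p ^ s * √2 * (√(κ a / odds p (κ a)) * odds p (σ a)) := by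
    intro a
    have hok := odds_pos hp0 hp1 (hκ a)
    have hk0 : (0 : ℝ) < κ a := by exact_mod_cast hκ a
    rw [variance_eq_odds hp0, show 2 * κ a / ((p ^ κ a) ^ 2 * odds p (κ a)) =
      2 * (κ a / odds p (κ a)) / (p ^ κ a) ^ 2 by field_simp, Real.sqrt_div (by positivity),
      Real.sqrt_sq (by positivity), Real.sqrt_mul (by positivity)]
    have h1 : p ^ (κ a + s) = p ^ (κ a + s - σ a) * p ^ σ a := by
      rw [← pow_add]; congr 1; have := hσ a; omega
    have h2 : p ^ (κ a + s - σ a) - p ^ (κ a + s) = p ^ (κ a + s) * odds p (σ a) := by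
      rw [h1]; unfold odds; rw [inv_pow]; field_simp
    rw [h2, pow_add]
    field_simp
  have rhs : √(2 * (s : ℝ) * (p ^ s * (1 - p ^ s))) = p ^ s * √2 * √(s * odds p s) := by
    rw [variance_eq_odds hp0, show 2 * s * ((p ^ s) ^ 2 * odds p s) =
      (p ^ s) ^ 2 * (2 * (s * odds p s)) by ring, Real.sqrt_mul (by positivity),
      Real.sqrt_sq (by positivity), Real.sqrt_mul (by positivity), mul_assoc]
  rw [Finset.sum_congr rfl fun a _ => term a, rhs, ← Finset.mul_sum]
  refine mul_lt_mul_of_pos_left ?_ (by positivity)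
  have hodds_le : ∀ {a b : ℕ}, 0 < a → a ≤ b → b * odds p a ≤ a * odds p b := by
    intro a b ha hab
    rcases hab.eq_or_lt with rfl | h
    · exact le_rfl
    · exact (mul_odds_lt hp0 hp1 ha h).le
  -- The right-hand side is split in proportion to `σ a` and compared term by term. Since `odds p j
  -- / j` increases, `odds p (σ a) / σ a` is at most its values at `κ a` and at `s`; multiplying the
  -- two bounds gives each comparison.
  have tot : √(s * odds p s) = ∑ a, σ a * √(odds p s / s) := by
    rw [← Finset.sum_mul, ← Nat.cast_sum, ← hs]
    rw [show (s : ℝ) * odds p s = s ^ 2 * (odds p s / s) by field_simp, Real.sqrt_mul (by positivity),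
      Real.sqrt_sq hs'.le]
  have sq_term : ∀ a, √(κ a / odds p (κ a)) * odds p (σ a) =
      √(κ a / odds p (κ a) * odds p (σ a) ^ 2) := by
    intro a
    rw [Real.sqrt_mul (div_nonneg (Nat.cast_nonneg _) (odds_nonneg hp0 hp1 _)),
      Real.sqrt_sq (odds_nonneg hp0 hp1 _)]
  have sq_term' : ∀ a, σ a * √(odds p s / s) = √((σ a : ℝ) ^ 2 * (odds p s / s)) := by
    intro a
    rw [Real.sqrt_mul (by positivity), Real.sqrt_sq (by positivity)]
  rw [tot]
  obtain ⟨a₀, -, ha₀⟩ := Finset.sum_pos_iff.1 hpos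
  refine Finset.sum_lt_sum (fun a _ => ?_) ⟨a₀, Finset.mem_univ _, ?_⟩
  · rcases Nat.eq_zero_or_pos (σ a) with h | h
    · simp [h, odds]
    · rw [sq_term, sq_term']
      refine Real.sqrt_le_sqrt ?_
      have hok := odds_pos hp0 hp1 (hκ a)
      have h1 := hodds_le h (hσ a)
      have h2 := hodds_le h (hle a)
      have h0 := odds_pos hp0 hp1 h
      rw [div_mul_eq_mul_div, mul_div_assoc', div_le_div_iff₀ hok hs']
      have h3 := mul_le_mul h1 h2 (by positivity) (by positivity)
      nlinarith
  · rw [sq_term, sq_term']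
    have hok := odds_pos hp0 hp1 (hκ a₀)
    have hk0 : (0 : ℝ) < κ a₀ := by exact_mod_cast hκ a₀
    have hσ0 : (0 : ℝ) < σ a₀ := by exact_mod_cast ha₀
    have h1 := hodds_le ha₀ (hσ a₀)
    have h2 := hodds_le ha₀ (hle a₀)
    have h0 := odds_pos hp0 hp1 ha₀
    refine Real.sqrt_lt_sqrt (by positivity) ?_
    rw [div_mul_eq_mul_div, mul_div_assoc', div_lt_div_iff₀ hok hs']
    -- When `σ a₀ = κ a₀` the comparison with `κ a₀` is an equality, but `hne` makes the one with
    -- `s` strict. Otherwise the comparison with `κ a₀` is itself strict.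
    rcases (hσ a₀).eq_or_lt with h | h
    · have h3 := mul_odds_lt hp0 hp1 ha₀ (lt_of_le_of_ne (hle a₀) (hne a₀ h))
      have := mul_lt_mul_of_pos_left h3 (mul_pos hk0 h0)
      have := mul_le_mul_of_nonneg_right h1 (by positivity : 0 ≤ σ a₀ * odds p s)
      nlinarith
    · have h3 := mul_odds_lt hp0 hp1 ha₀ h
      have := mul_lt_mul_of_pos_right h3 (mul_pos hs' h0)
      have := mul_le_mul_of_nonneg_left h2 (by positivity : 0 ≤ σ a₀ * odds p (κ a₀))
      nlinarith

end Exponents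
end CommonNbr

namespace CommonNbr

/-! ### Polynomial probability bounds for overlapping sets. -/

section LargeDeviations

variable {p : unitInterval}

lemma tendsto_sqrt_log_div : Tendsto (fun n : ℕ => √(Real.log n / n)) atTop (𝓝 0) := by
  simpa using tendsto_log_div_self.sqrt

lemma sqrt_log_div_mul_sqrt {n : ℕ} (hn : 1 ≤ n) :
    √(Real.log n / n) * √(n * Real.log n) = Real.log n := by
  have hn0 : (0 : ℝ) < n := by positivity
  have hL : 0 ≤ Real.log n := Real.log_nonneg (by exact_mod_cast hn)
  rw [← Real.sqrt_mul (by positivity), show Real.log n / n * (n * Real.log n) =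
    Real.log n ^ 2 by field_simp, Real.sqrt_sq hL]

lemma covForm_const_mul {V β : Type*} [DecidableEq V] [Fintype β] (p : ℝ) (B : β → Finset V)
    (t : β → ℝ) (c : ℝ) : covForm p B (fun b => c * t b) = c ^ 2 * covForm p B t := by
  unfold covForm
  rw [Finset.mul_sum]
  refine Finset.sum_congr rfl fun b _ => ?_
  rw [Finset.mul_sum]
  exact Finset.sum_congr rfl fun b' _ => by ring

/-- A joint large deviation bound for the numbers of common neighbours of finitely many sets. -/
lemma eventually_prob_forall_level_le {β : Type*} [Fintype β] (sz : β → ℕ) {θ : β → ℝ}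
    (hθ : ∀ b, 0 ≤ θ b) {c R Q : ℝ} (hQ : 0 ≤ Q)
    (h : R < c * ∑ b, θ b * √(2 * sz b * ((p : ℝ) ^ sz b * (1 - (p : ℝ) ^ sz b))) - Q / 2) :
    ∀ᶠ n : ℕ in atTop, ∀ (B : β → Finset (Fin n)) (D : Finset (Fin n)), (∀ b, (B b).card = sz b) →
      (∀ b, Disjoint D (B b)) → covForm (p : ℝ) B θ = Q →
      (SimpleGraph.binomialRandom (Fin n) p).real
        {G | ∀ b, level p (sz b) c n ≤ (nbrsIn G D (B b)).card} ≤ Real.exp (-(R * Real.log n)) := by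
  set S := ∑ b, θ b * √(2 * sz b * ((p : ℝ) ^ sz b * (1 - (p : ℝ) ^ sz b))) with hS
  set Θ := ∑ b, θ b with hΘ
  have hΘ0 : 0 ≤ Θ := Finset.sum_nonneg fun b _ => hθ b
  have ht : Tendsto (fun n : ℕ => √(Real.log n / n) * Θ) atTop (𝓝 0) := by
    simpa using tendsto_sqrt_log_div.mul_const Θ
  have hlim : Tendsto (fun n : ℕ => c * S - (1 + √(Real.log n / n) * Θ) / 2 * Q) atTop
      (𝓝 (c * S - (1 + 0) / 2 * Q)) :=
    (((ht.const_add 1).div_const 2).mul_const Q).const_sub _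
  filter_upwards [ht.eventually_le_const zero_lt_one, eventually_ge_atTop 1,
    hlim.eventually_const_le (show R < _ by linarith)] with n hn1 hn2 hR B D hB hDB hcov
  have hn0 : (0 : ℝ) < n := by positivity
  have hL : 0 ≤ Real.log n := Real.log_nonneg (by exact_mod_cast hn2)
  have hp0 : (0 : ℝ) ≤ p := p.2.1
  -- At this scale the linear and the quadratic term of the Chernoff exponent are both of order `log
  -- n`, with coefficients tending to those in `h`.
  refine (measureReal_forall_le_card_nbrsIn_le hDB (t := fun b => √(Real.log n / n) * θ b)
    (fun b => mul_nonneg (Real.sqrt_nonneg _) (hθ b)) (by rwa [← Finset.mul_sum]) _).trans ?_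
  rw [Real.exp_le_exp, ← Finset.mul_sum, covForm_const_mul, hcov,
    Real.sq_sqrt (by positivity)]
  have hD : (D.card : ℝ) ≤ n := by
    have := D.card_le_univ; simp only [Fintype.card_fin] at this; exact_mod_cast this
  have e1 : ∑ b, √(Real.log n / n) * θ b * (D.card * (p : ℝ) ^ (B b).card - level p (sz b) c n) ≤
      -(c * S * Real.log n) := by
    rw [hS, Finset.mul_sum, Finset.sum_mul, ← Finset.sum_neg_distrib]
    refine Finset.sum_le_sum fun b _ => ?_
    have h1 : D.card * (p : ℝ) ^ (B b).card - level p (sz b) c n ≤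
        -(c * √(2 * sz b * ((p : ℝ) ^ sz b * (1 - (p : ℝ) ^ sz b))) * √(n * Real.log n)) := by
      rw [hB]; unfold level
      have := mul_le_mul_of_nonneg_right hD (pow_nonneg hp0 (sz b))
      linarith
    refine (mul_le_mul_of_nonneg_left h1 (mul_nonneg (Real.sqrt_nonneg _) (hθ b))).trans
      (le_of_eq ?_)
    linear_combination (-(θ b * c * √(2 * sz b * ((p : ℝ) ^ sz b * (1 - (p : ℝ) ^ sz b))))) *
      sqrt_log_div_mul_sqrt hn2
  have e2 : D.card * ((1 + √(Real.log n / n) * Θ) / 2 * (Real.log n / n * Q)) ≤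
      (1 + √(Real.log n / n) * Θ) / 2 * Q * Real.log n := by
    have h2 : 0 ≤ (1 + √(Real.log n / n) * Θ) / 2 * (Real.log n / n * Q) := by positivity
    refine (mul_le_mul_of_nonneg_right hD h2).trans (le_of_eq ?_)
    field_simp
  have e3 := mul_le_mul_of_nonneg_right hR hL
  rw [← hΘ]
  linarith

/-- Given an `s`-set whose neighbourhood is not too large, a fixed extension to a `k`-set is very
unlikely to have an extremal neighbourhood. -/
lemma eventually_prob_extension_le (hp0 : 0 < (p : ℝ)) (hp1 : (p : ℝ) < 1) {s k : ℕ} (hs : 0 < s)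
    (hk : s < k) :
    ∀ᶠ c : ℝ in 𝓝[>] 0, ∀ᶠ n : ℕ in atTop, ∀ T D : Finset (Fin n), T.card = k - s →
      Disjoint D T → (D.card : ℝ) ≤ level p s (1 + c) n →
      (SimpleGraph.binomialRandom (Fin n) p).real
        {G | level p k (1 - c) n ≤ (nbrsIn G D T).card} ≤
        Real.exp (-((((k - s : ℕ) : ℝ) + c) * Real.log n)) := by
  obtain ⟨hg, hgap⟩ := extension_exponent hp0 hp1 hs hk
  set A := √(2 * k * ((p : ℝ) ^ k * (1 - (p : ℝ) ^ k))) with hA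
  set B := √(2 * s * ((p : ℝ) ^ s * (1 - (p : ℝ) ^ s))) with hB
  set q := (p : ℝ) ^ (k - s) with hq
  set v := (p : ℝ) ^ s * (q * (1 - q)) with hv
  have hq1 : q < 1 := pow_lt_one₀ hp0.le hp1 (by omega)
  have hq0 : 0 < q := by positivity
  have hq2 : 0 < 1 - q := by linarith
  have hv0 : 0 < v := by positivity
  -- This maximises `θ * (A - q * B) - θ ^ 2 * v / 2`. The maximum `(A - q * B) ^ 2 / (2 * v)`
  -- exceeds `k - s` by `extension_exponent`, which leaves room for a small `c`.
  set θ := (A - q * B) / v with hθ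
  have hθ0 : 0 < θ := div_pos hg hv0
  have hcast : ((k - s : ℕ) : ℝ) = k - s := by rw [Nat.cast_sub hk.le]
  have h0 : Tendsto (fun c : ℝ => θ * ((1 - c) * A - q * (1 + c) * B) - θ ^ 2 * v / 2 - c) (𝓝[>] 0)
      (𝓝 (θ * ((1 - 0) * A - q * (1 + 0) * B) - θ ^ 2 * v / 2 - 0)) := by
    refine Tendsto.mono_left (Continuous.tendsto (by fun_prop) _) nhdsWithin_le_nhds
  have hval : ((k - s : ℕ) : ℝ) < θ * ((1 - 0) * A - q * (1 + 0) * B) - θ ^ 2 * v / 2 - 0 := by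
    have : θ * ((1 - 0) * A - q * (1 + 0) * B) - θ ^ 2 * v / 2 - 0 = (A - q * B) ^ 2 / (2 * v) := by
      rw [hθ]; field_simp; ring
    rw [this, hcast, lt_div_iff₀ (by positivity)]
    linarith
  filter_upwards [h0.eventually_const_lt hval] with c hc
  have ht : Tendsto (fun n : ℕ => √(Real.log n / n) * θ) atTop (𝓝 0) := by
    simpa using tendsto_sqrt_log_div.mul_const θ
  have hM : Tendsto (fun n : ℕ => level p s (1 + c) n / n) atTop (𝓝 ((p : ℝ) ^ s)) := by
    have := (tendsto_sqrt_log_div.const_mul ((1 + c) * B)).const_add ((p : ℝ) ^ s)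
    rw [mul_zero, add_zero] at this
    refine this.congr' ?_
    filter_upwards [eventually_gt_atTop 0] with n hn
    have hn0 : (0 : ℝ) < n := by positivity
    have e : √(n * Real.log n) / n = √(Real.log n / n) := by
      rw [show Real.log n / n = n * Real.log n / n ^ 2 by field_simp,
        Real.sqrt_div' _ (by positivity), Real.sqrt_sq hn0.le]
    rw [← e]
    unfold level
    rw [← hB]
    field_simp
  have hlim : Tendsto (fun n : ℕ => θ * ((1 - c) * A - q * (1 + c) * B) -
      level p s (1 + c) n / n * ((1 + √(Real.log n / n) * θ) / 2 * (θ ^ 2 * (q * (1 - q))))) atTop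
      (𝓝 (θ * ((1 - c) * A - q * (1 + c) * B) - (p : ℝ) ^ s * ((1 + 0) / 2 * (θ ^ 2 * (q * (1 - q)))))) :=
    (hM.mul (((ht.const_add 1).div_const 2).mul_const _)).const_sub _
  filter_upwards [ht.eventually_le_const zero_lt_one, eventually_ge_atTop 1,
    hlim.eventually_const_le (show ((k - s : ℕ) : ℝ) + c < _ by rw [hv] at hc; linarith)]
    with n hn1 hn2 hR T D hT hDT hD
  have hn0 : (0 : ℝ) < n := by positivity
  have hL : 0 ≤ Real.log n := Real.log_nonneg (by exact_mod_cast hn2)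
  set t := √(Real.log n / n) * θ with htdef
  have ht0 : 0 ≤ t := by positivity
  have hch := measureReal_forall_le_card_nbrsIn_le (p := p) (β := Unit) (B := fun _ => T)
    (fun _ => hDT) (t := fun _ => t) (fun _ => ht0) (by simpa using hn1)
    (fun _ => level p k (1 - c) n)
  simp only [Finset.univ_unique, Finset.sum_const, Finset.card_singleton, one_smul,
    forall_const, hT, covForm, Finset.union_self, ← hq] at hch
  refine hch.trans ?_
  rw [Real.exp_le_exp]
  have hcoef : 0 ≤ t * q + (1 + t) / 2 * (t * t * (q - q * q)) := by
    have : 0 ≤ q - q * q := by nlinarith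
    positivity
  have h1 := mul_le_mul_of_nonneg_right hD hcoef
  have epk : (p : ℝ) ^ k = q * (p : ℝ) ^ s := by rw [hq, ← pow_add]; congr 1; omega
  have e1 : t * (level p s (1 + c) n * q - level p k (1 - c) n) =
      -(θ * ((1 - c) * A - q * (1 + c) * B)) * Real.log n := by
    unfold level
    rw [← hA, ← hB, epk, htdef]
    linear_combination (-(θ * ((1 - c) * A - q * (1 + c) * B))) * sqrt_log_div_mul_sqrt hn2
  have e2 : level p s (1 + c) n * ((1 + t) / 2 * (t * t * (q - q * q))) =
      level p s (1 + c) n / n * ((1 + t) / 2 * (θ ^ 2 * (q * (1 - q)))) * Real.log n := by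
    have : t * t = Real.log n / n * θ ^ 2 := by
      rw [htdef, mul_mul_mul_comm, Real.mul_self_sqrt (by positivity)]; ring
    rw [this]
    field_simp
  have e3 := mul_le_mul_of_nonneg_right hR hL
  linarith

/-- Disjoint sets are uncorrelated, so besides the variances only the covariances with `W`, the
entry at `none`, survive. -/
lemma covForm_option {V ι : Type*} [DecidableEq V] [Fintype ι] (p : ℝ) {U : ι → Finset V}
    (hU : Pairwise (Function.onFun Disjoint U)) (W : Finset V) (θ : ι → ℝ) (τ : ℝ) :
    covForm p (fun o : Option ι => o.elim W U) (fun o => o.elim τ θ) =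
      ∑ a, θ a ^ 2 * (p ^ (U a).card * (1 - p ^ (U a).card)) +
        τ ^ 2 * (p ^ W.card * (1 - p ^ W.card)) +
        2 * τ * ∑ a, θ a * (p ^ ((U a).card + W.card - (W ∩ U a).card) - p ^ ((U a).card + W.card)) := by
  classical
  have hu : ∀ a, (U a ∪ W).card = (U a).card + W.card - (W ∩ U a).card := by
    intro a
    have := Finset.card_union_add_card_inter (U a) W
    rw [Finset.inter_comm] at this
    omega
  unfold covForm
  simp only [Fintype.sum_option, Option.elim_none, Option.elim_some, Finset.union_self]
  have hd : ∀ a, ∑ b, θ a * θ b * (p ^ (U a ∪ U b).card - p ^ (U a).card * p ^ (U b).card) =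
      θ a ^ 2 * (p ^ (U a).card * (1 - p ^ (U a).card)) := by
    intro a
    rw [Finset.sum_eq_single a]
    · rw [Finset.union_self]; ring
    · intro b _ hb
      rw [Finset.card_union_of_disjoint (hU hb.symm), pow_add]; ring
    · simp
  rw [Finset.sum_add_distrib, Finset.sum_congr rfl fun a _ => hd a]
  have h1 : ∑ a, τ * θ a * (p ^ (W ∪ U a).card - p ^ W.card * p ^ (U a).card) =
      τ * ∑ a, θ a * (p ^ ((U a).card + W.card - (W ∩ U a).card) - p ^ ((U a).card + W.card)) := by
    rw [Finset.mul_sum]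
    refine Finset.sum_congr rfl fun a _ => ?_
    rw [Finset.union_comm, hu, pow_add]; ring
  have h2 : ∑ a, θ a * τ * (p ^ (U a ∪ W).card - p ^ (U a).card * p ^ W.card) =
      τ * ∑ a, θ a * (p ^ ((U a).card + W.card - (W ∩ U a).card) - p ^ ((U a).card + W.card)) := by
    rw [Finset.mul_sum]
    refine Finset.sum_congr rfl fun a _ => ?_
    rw [hu, pow_add]; ring
  rw [h1, h2]
  ring

/-- It is very unlikely that disjoint sets `U a` and a further set `W` with prescribed
intersections with the `U a` all have extremal neighbourhoods. -/
lemma eventually_prob_overlap_le_aux (hp0 : 0 < (p : ℝ)) (hp1 : (p : ℝ) < 1) {ι : Type*} [Fintype ι]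
    {κ σ : ι → ℕ} (hκ : ∀ a, 0 < κ a) (hσ : ∀ a, σ a ≤ κ a) (hpos : 0 < ∑ a, σ a)
    (hne : ∀ a, σ a = κ a → σ a ≠ ∑ b, σ b) :
    ∀ᶠ c : ℝ in 𝓝[>] 0, ∀ᶠ n : ℕ in atTop, ∀ (U : ι → Finset (Fin n)) (W D : Finset (Fin n)),
      Pairwise (Function.onFun Disjoint U) → (∀ a, (U a).card = κ a) → (∀ a, (W ∩ U a).card = σ a) →
      W.card = ∑ a, σ a → (∀ a, Disjoint D (U a)) → Disjoint D W →
      (SimpleGraph.binomialRandom (Fin n) p).real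
        ({G | ∀ a, level p (κ a) (1 - c) n ≤ (nbrsIn G D (U a)).card} ∩
          {G | level p W.card (1 - c) n ≤ (nbrsIn G D W).card}) ≤
        Real.exp (-((((∑ a, κ a : ℕ) : ℝ) + c) * Real.log n)) := by
  have hov := overlap_exponent hp0 hp1 hκ hσ hpos hne
  set s := ∑ b, σ b with hs
  set vs := (p : ℝ) ^ s * (1 - (p : ℝ) ^ s) with hvs
  have hv : ∀ {j : ℕ}, 0 < j → 0 < (p : ℝ) ^ j * (1 - (p : ℝ) ^ j) := by
    intro j hj
    have : (p : ℝ) ^ j < 1 := pow_lt_one₀ hp0.le hp1 hj.ne'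
    have : 0 < 1 - (p : ℝ) ^ j := by linarith
    positivity
  have hvs0 : 0 < vs := hv hpos
  -- These weights are optimal for the `U a` alone and yield exactly the exponent `∑ a, κ a`. The
  -- weight `τ` for `W` maximises `τ * δ - τ ^ 2 * vs / 2`, where `δ > 0` is the slack in
  -- `overlap_exponent`, so `W` contributes the extra `δ ^ 2 / (2 * vs)`.
  set θ : ι → ℝ := fun a => √(2 * κ a / ((p : ℝ) ^ κ a * (1 - (p : ℝ) ^ κ a))) with hθ
  set C := ∑ a, θ a * ((p : ℝ) ^ (κ a + s - σ a) - (p : ℝ) ^ (κ a + s)) with hC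
  set δ := √(2 * (s : ℝ) * vs) - C with hδ
  have hδ0 : 0 < δ := sub_pos.2 hov
  set τ := δ / vs with hτ
  have hτ0 : 0 < τ := div_pos hδ0 hvs0
  have hC0 : 0 ≤ C := Finset.sum_nonneg fun a _ => mul_nonneg (Real.sqrt_nonneg _) (sub_nonneg.2
    (pow_le_pow_of_le_one hp0.le hp1.le (Nat.sub_le _ _)))
  set K : ℝ := ((∑ a, κ a : ℕ) : ℝ) with hK
  have hθ1 : ∑ a, θ a * √(2 * κ a * ((p : ℝ) ^ κ a * (1 - (p : ℝ) ^ κ a))) = 2 * K := by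
    rw [hK, Nat.cast_sum, Finset.mul_sum]
    refine Finset.sum_congr rfl fun a _ => ?_
    have := hv (hκ a)
    rw [hθ, ← Real.sqrt_mul (by positivity)]
    generalize (p : ℝ) ^ κ a * (1 - (p : ℝ) ^ κ a) = w at *
    rw [show 2 * κ a / w * (2 * κ a * w) = (2 * κ a : ℝ) ^ 2 by field_simp]
    exact Real.sqrt_sq (by positivity)
  have hθ2 : ∑ a, θ a ^ 2 * ((p : ℝ) ^ κ a * (1 - (p : ℝ) ^ κ a)) = 2 * K := by
    rw [hK, Nat.cast_sum, Finset.mul_sum]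
    refine Finset.sum_congr rfl fun a _ => ?_
    have := hv (hκ a)
    rw [hθ]
    simp only
    rw [Real.sq_sqrt (by positivity), div_mul_cancel₀ _ this.ne']
  set Q := 2 * K + τ ^ 2 * vs + 2 * τ * C with hQ
  have hQ0 : 0 ≤ Q := by positivity
  have h0 : Tendsto (fun c : ℝ => (1 - c) * (τ * √(2 * s * vs) + 2 * K) - Q / 2 - c) (𝓝[>] 0)
      (𝓝 ((1 - 0) * (τ * √(2 * s * vs) + 2 * K) - Q / 2 - 0)) :=
    Tendsto.mono_left (Continuous.tendsto (by fun_prop) _) nhdsWithin_le_nhds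
  have hval : K < (1 - 0) * (τ * √(2 * s * vs) + 2 * K) - Q / 2 - 0 := by
    have : (1 - 0) * (τ * √(2 * s * vs) + 2 * K) - Q / 2 - 0 = K + τ * δ - τ ^ 2 * vs / 2 := by
      rw [hQ, hδ]; ring
    rw [this]
    have : τ * δ - τ ^ 2 * vs / 2 = δ ^ 2 / (2 * vs) := by rw [hτ]; field_simp; ring
    have : 0 < δ ^ 2 / (2 * vs) := by positivity
    linarith
  filter_upwards [h0.eventually_const_lt hval] with c hc
  have hev := eventually_prob_forall_level_le (p := p) (β := Option ι) (fun o => o.elim s κ)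
    (θ := fun o => o.elim τ θ) (by rintro (_ | a); exacts [hτ0.le, Real.sqrt_nonneg _])
    (c := 1 - c) (R := K + c) (Q := Q) hQ0 (by
      simp only [Fintype.sum_option, Option.elim_none, Option.elim_some]
      rw [hθ1]; linarith)
  filter_upwards [hev] with n hn U W D hU hUκ hWσ hW hDU hDW
  have := hn (fun o => o.elim W U) D (by rintro (_ | a); exacts [hW, hUκ a])
    (by rintro (_ | a); exacts [hDW, hDU a]) (by
      rw [covForm_option _ hU]
      simp only [hUκ, hW, hWσ]
      rw [hθ2])
  refine le_trans (measureReal_mono fun G hG => ?_) this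
  rintro (_ | a)
  · have := hG.2
    rw [hW] at this
    exact this
  · exact hG.1 a

/-- The bound depends on `W` only through the sizes `σ a` of its intersections with the `U a`. There
are finitely many such profiles, so `c` and the threshold for `n` can be chosen uniformly. -/
lemma eventually_prob_overlap_le (hp0 : 0 < (p : ℝ)) (hp1 : (p : ℝ) < 1) {ι : Type*} [Fintype ι]
    {κ : ι → ℕ} (hκ : ∀ a, 0 < κ a) :
    ∀ᶠ c : ℝ in 𝓝[>] 0, ∀ᶠ n : ℕ in atTop, ∀ (U : ι → Finset (Fin n)) (W D : Finset (Fin n)),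
      Pairwise (Function.onFun Disjoint U) → (∀ a, (U a).card = κ a) → W.Nonempty →
      W ⊆ Finset.univ.biUnion U → (∀ a, W ≠ U a) → (∀ a, Disjoint D (U a)) →
      (SimpleGraph.binomialRandom (Fin n) p).real
        ({G | ∀ a, level p (κ a) (1 - c) n ≤ (nbrsIn G D (U a)).card} ∩
          {G | level p W.card (1 - c) n ≤ (nbrsIn G D W).card}) ≤
        Real.exp (-((((∑ a, κ a : ℕ) : ℝ) + c) * Real.log n)) := by
  classical
  have hfin : {σ : ι → ℕ | ∀ a, σ a ≤ κ a}.Finite := Set.finite_Iic κ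
  have h1 : ∀ᶠ c : ℝ in 𝓝[>] 0, ∀ σ ∈ {σ : ι → ℕ | ∀ a, σ a ≤ κ a}, ∀ᶠ n : ℕ in atTop,
      0 < ∑ a, σ a → (∀ a, σ a = κ a → σ a ≠ ∑ b, σ b) →
      ∀ (U : ι → Finset (Fin n)) (W D : Finset (Fin n)),
      Pairwise (Function.onFun Disjoint U) → (∀ a, (U a).card = κ a) → (∀ a, (W ∩ U a).card = σ a) →
      W.card = ∑ a, σ a → (∀ a, Disjoint D (U a)) → Disjoint D W →
      (SimpleGraph.binomialRandom (Fin n) p).real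
        ({G | ∀ a, level p (κ a) (1 - c) n ≤ (nbrsIn G D (U a)).card} ∩
          {G | level p W.card (1 - c) n ≤ (nbrsIn G D W).card}) ≤
        Real.exp (-((((∑ a, κ a : ℕ) : ℝ) + c) * Real.log n)) := by
    rw [eventually_all_finite hfin]
    intro σ hσ
    by_cases h : 0 < ∑ a, σ a ∧ ∀ a, σ a = κ a → σ a ≠ ∑ b, σ b
    · filter_upwards [eventually_prob_overlap_le_aux hp0 hp1 hκ hσ h.1 h.2] with c hc
      filter_upwards [hc] with n hn _ _ using hn
    · refine Eventually.of_forall fun c => Eventually.of_forall fun n h1 h2 => (h ⟨h1, h2⟩).elim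
  filter_upwards [h1] with c hc
  filter_upwards [(eventually_all_finite hfin).2 hc] with n hn U W D hU hUκ hW hWU hne hDU
  have hcard : W.card = ∑ a, (W ∩ U a).card := by
    rw [← Finset.card_biUnion]
    · congr 1
      ext v
      simp only [Finset.mem_biUnion, Finset.mem_univ, true_and, Finset.mem_inter]
      refine ⟨fun h => ?_, fun ⟨_, h, _⟩ => h⟩
      obtain ⟨a, -, ha⟩ := Finset.mem_biUnion.1 (hWU h)
      exact ⟨a, h, ha⟩
    · intro a _ b _ hab
      exact (hU hab).mono Finset.inter_subset_right Finset.inter_subset_right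
  have hle : ∀ a, (W ∩ U a).card ≤ κ a := fun a =>
    (Finset.card_le_card Finset.inter_subset_right).trans (hUκ a).le
  refine hn (fun a => (W ∩ U a).card) hle ?_ ?_ U W D hU hUκ (fun _ => rfl) hcard hDU ?_
  · rw [← hcard]; exact hW.card_pos
  · intro a h1 h2
    rw [← hcard] at h2
    have e1 : W ∩ U a = W := Finset.eq_of_subset_of_card_le Finset.inter_subset_left h2.ge
    have e2 : W ∩ U a = U a := Finset.eq_of_subset_of_card_le Finset.inter_subset_right
      (by rw [hUκ, h1])
    exact hne a (e1.symm.trans e2)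
  · rw [Finset.disjoint_left]
    intro v hv hvW
    obtain ⟨a, -, ha⟩ := Finset.mem_biUnion.1 (hWU hvW)
    exact Finset.disjoint_left.1 (hDU a) hv ha

end LargeDeviations
end CommonNbr

namespace CommonNbr

/-! ### Degrees versus counts inside a subset. -/

section Degrees

variable {V : Type*} {G : SimpleGraph V}

lemma nbrsIn_mono_left {D D' B : Finset V} (h : D ⊆ D') : nbrsIn G D B ⊆ nbrsIn G D' B := by
  intro v hv
  rw [mem_nbrsIn] at hv ⊢
  exact ⟨h hv.1, hv.2⟩

lemma deg_eq_card_nbrsIn [Fintype V] (U : Finset V) : deg G U = (nbrsIn G Finset.univ U).card := by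
  unfold deg
  rw [← Set.ncard_coe_finset]
  congr 1; ext v; simp [mem_nbrsIn]

lemma card_nbrsIn_le_deg [Fintype V] (D U : Finset V) : (nbrsIn G D U).card ≤ deg G U := by
  rw [deg_eq_card_nbrsIn]
  exact Finset.card_le_card (nbrsIn_mono_left (Finset.subset_univ _))

lemma deg_le_card_nbrsIn_add [Fintype V] [DecidableEq V] (D U : Finset V) :
    deg G U ≤ (nbrsIn G D U).card + Dᶜ.card := by
  rw [deg_eq_card_nbrsIn]
  refine (Finset.card_le_card (t := nbrsIn G D U ∪ Dᶜ) fun v hv => ?_).trans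
    (Finset.card_union_le _ _)
  rw [mem_nbrsIn] at hv
  by_cases h : v ∈ D
  · exact Finset.mem_union_left _ (mem_nbrsIn.2 ⟨h, hv.2⟩)
  · exact Finset.mem_union_right _ (Finset.mem_compl.2 h)

lemma nbrsIn_nbrsIn [DecidableEq V] (D W T : Finset V) :
    nbrsIn G (nbrsIn G D W) T = nbrsIn G D (W ∪ T) := by
  ext v
  simp only [mem_nbrsIn, Finset.mem_union, or_imp, forall_and, and_assoc]

/-- There are no loops, so no vertex of `T` is a common neighbour of `T`. -/
lemma nbrsIn_sdiff_self [DecidableEq V] (D T : Finset V) :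
    nbrsIn G (D \ T) T = nbrsIn G D T := by
  ext v
  simp only [mem_nbrsIn, Finset.mem_sdiff]
  refine ⟨fun h => ⟨h.1.1, h.2⟩, fun h => ⟨⟨h.1, fun hv => ?_⟩, h.2⟩⟩
  exact G.loopless.irrefl v (h.2 v hv)

lemma isLowerSet_card_nbrsIn_le (D X : Finset V) (h : ℝ) :
    IsLowerSet {G : SimpleGraph V | ((nbrsIn G D X).card : ℝ) ≤ h} := by
  intro G G' hG hle
  have hle' : ((nbrsIn G D X).card : ℝ) ≤ h := hle
  change ((nbrsIn G' D X).card : ℝ) ≤ h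
  refine le_trans ?_ hle'
  have : nbrsIn G' D X ⊆ nbrsIn G D X := fun v hv => by
    rw [mem_nbrsIn] at hv ⊢
    exact ⟨hv.1, fun u hu => hG (hv.2 u hu)⟩
  exact_mod_cast Finset.card_le_card this

lemma disjoint_edgesBetween_self {D S : Set V} (h : Disjoint D S) :
    Disjoint (edgesBetween D S) (edgesBetween D D) := by
  rw [Set.disjoint_left]
  rintro _ ⟨v, hv, u, hu, rfl⟩ ⟨v', hv', u', hu', he⟩
  rcases Sym2.eq_iff.1 he with ⟨rfl, rfl⟩ | ⟨rfl, rfl⟩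
  · exact Set.disjoint_left.1 h hu' hu
  · exact Set.disjoint_left.1 h hv' hu

end Degrees

/-! ### The lower bound for one disjoint family. -/

section Families

variable {V : Type*} [Fintype V] [DecidableEq V] {p : unitInterval}

/-- Conditionally on the edges at `S`, the number of common neighbours of `W ∪ T` with `W ⊆ S` and
`T` outside of `S` is the number of common neighbours of `T` inside a fixed set. -/
lemma measureReal_inter_extension_le {D S W T : Finset V} {F : Set (SimpleGraph V)}
    (hDS : Disjoint D S) (hF : DependsOnEdges (· ∈ F) (edgesBetween D S)) (hW : W ⊆ S) (hT : T ⊆ D)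
    {y M β : ℝ} (hFM : ∀ G ∈ F, ((nbrsIn G D W).card : ℝ) ≤ M)
    (hβ : ∀ D₀ : Finset V, Disjoint D₀ T → (D₀.card : ℝ) ≤ M →
      (SimpleGraph.binomialRandom V p).real {G | y ≤ (nbrsIn G D₀ T).card} ≤ β) :
    (SimpleGraph.binomialRandom V p).real (F ∩ {G | y ≤ (nbrsIn G D (W ∪ T)).card}) ≤
      (SimpleGraph.binomialRandom V p).real F * β := by
  classical
  set P := (SimpleGraph.binomialRandom V p)
  -- The event is partitioned by the value `D₀` of `nbrsIn G D W`, which the edges between `D` and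
  -- `S` determine. Given `D₀`, the condition on `T` involves only edges inside `D`.
  set 𝒟 := D.powerset.filter fun D₀ => (D₀.card : ℝ) ≤ M with h𝒟
  have hdep : ∀ D₀, DependsOnEdges (· ∈ F ∩ {G : SimpleGraph V | nbrsIn G D W = D₀})
      (edgesBetween (D : Set V) S) := fun D₀ =>
    hF.inter (((dependsOnEdges_nbrsIn D W).mono (edgesBetween_mono le_rfl (by simpa using hW))).comp
      (· = D₀))
  have hsub : F ∩ {G | y ≤ (nbrsIn G D (W ∪ T)).card} ⊆ ⋃ D₀ ∈ 𝒟,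
      (F ∩ {G : SimpleGraph V | nbrsIn G D W = D₀}) ∩ {G | y ≤ (nbrsIn G (D₀ \ T) T).card} := by
    rintro G ⟨hG, hy⟩
    simp only [Set.mem_iUnion]
    refine ⟨nbrsIn G D W, ?_, ⟨hG, rfl⟩, ?_⟩
    · rw [h𝒟, Finset.mem_filter, Finset.mem_powerset]
      exact ⟨nbrsIn_subset _ _ _, hFM G hG⟩
    · simp only [Set.mem_ofPred_eq] at hy ⊢
      rwa [nbrsIn_sdiff_self, nbrsIn_nbrsIn]
  calc P.real (F ∩ {G | y ≤ (nbrsIn G D (W ∪ T)).card})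
      ≤ P.real (⋃ D₀ ∈ 𝒟, (F ∩ {G : SimpleGraph V | nbrsIn G D W = D₀}) ∩
          {G | y ≤ (nbrsIn G (D₀ \ T) T).card}) := measureReal_mono hsub (measure_ne_top _ _)
    _ ≤ ∑ D₀ ∈ 𝒟, P.real ((F ∩ {G : SimpleGraph V | nbrsIn G D W = D₀}) ∩
          {G | y ≤ (nbrsIn G (D₀ \ T) T).card}) := measureReal_biUnion_finset_le _ _
    _ ≤ ∑ D₀ ∈ 𝒟, P.real (F ∩ {G : SimpleGraph V | nbrsIn G D W = D₀}) * β := by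
        refine Finset.sum_le_sum fun D₀ hD₀ => ?_
        rw [h𝒟, Finset.mem_filter, Finset.mem_powerset] at hD₀
        have hdepT : DependsOnEdges (· ∈ {G : SimpleGraph V | y ≤ (nbrsIn G (D₀ \ T) T).card})
            (edgesBetween (D : Set V) D) :=
          ((dependsOnEdges_nbrsIn (D₀ \ T) T).mono (edgesBetween_mono
            (Finset.coe_subset.2 (Finset.sdiff_subset.trans hD₀.1)) (Finset.coe_subset.2 hT))).comp
            (fun s : Finset V => y ≤ s.card)
        rw [measureReal_inter_of_dependsOnEdges (disjoint_edgesBetween_self (by simpa using hDS))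
          (hdep D₀) hdepT]
        refine mul_le_mul_of_nonneg_left (hβ _ Finset.sdiff_disjoint (le_trans ?_ hD₀.2))
          measureReal_nonneg
        exact_mod_cast Finset.card_le_card Finset.sdiff_subset
    _ = P.real (⋃ D₀ ∈ 𝒟, F ∩ {G : SimpleGraph V | nbrsIn G D W = D₀}) * β := by
        rw [← Finset.sum_mul, measureReal_biUnion_finset _ fun _ _ => .of_discrete]
        intro D₁ _ D₂ _ h
        rw [Function.onFun, Set.disjoint_left]
        rintro G ⟨-, h1⟩ ⟨-, h2⟩
        exact h (h1.symm.trans h2)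
    _ ≤ P.real F * β := by
        -- The sign of `β` is not assumed: if `F` is nonempty then `M ≥ 0`, and `hβ` applied to the
        -- empty set shows `β ≥ 0`.
        have hβ0 : 0 ≤ β ∨ F = ∅ := by
          rcases F.eq_empty_or_nonempty with h | ⟨G, hG⟩
          · exact Or.inr h
          · refine Or.inl (measureReal_nonneg.trans (hβ ∅ (by simp) ?_))
            simpa using (Nat.cast_nonneg _).trans (hFM G hG)
        rcases hβ0 with hβ0 | h
        · refine mul_le_mul_of_nonneg_right (measureReal_mono ?_) hβ0
          exact Set.iUnion₂_subset fun D₀ _ => Set.inter_subset_left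
        · simp [h]

variable {ι I : Type*} [Fintype ι] [Fintype I]

/-- The event that the numbers of common neighbours of the sets `U a` lie in the given intervals,
while those of all other `k i`-sets are at most `c i`. -/
def familyEvent (U : ι → Finset V) (k : I → ℕ) (lo hi : ι → ℝ) (c : I → ℝ) :
    Set (SimpleGraph V) :=
  {G | (∀ a, lo a < deg G (U a) ∧ (deg G (U a) : ℝ) ≤ hi a) ∧
    ∀ i X, X.card = k i → (∀ a, X ≠ U a) → (deg G X : ℝ) ≤ c i}

/-- A competing set lies inside `S` (controlled by `F₂` at cost `ε`), outside `S` (controlled by `H`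
with probability at least `h`), or meets both sides (the events `bad`, whose number is compensated
by the powers in `hext`). As `F₁ ∩ F₂` and `H` use disjoint sets of edges, and the bound for each
`bad` event carries the factor `P (F₁ ∩ F₂)`, this factor can be taken out. The shifts by `S.card`
account for common neighbours lying in `S`. -/
lemma le_measureReal_familyEvent {U : ι → Finset V} {κ : ι → ℕ} {k : I → ℕ}
    (hU : ∀ a, (U a).card = κ a) {S : Finset V}
    (hS : S = Finset.univ.biUnion U) {lo hi : ι → ℝ} {c : I → ℝ} {M M' : ℕ → ℝ} {b ε : ℝ}
    (hb : 0 ≤ b) (hε : 0 ≤ ε)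
    (hM' : ∀ a, hi a ≤ M' (κ a)) (hMM' : ∀ s, M s ≤ M' s) (hMc : ∀ i, M (k i) + S.card ≤ c i)
    (hext : ∀ i s, 0 < s → s < k i → ∀ T D : Finset V, T.card = k i - s → Disjoint D T →
      (D.card : ℝ) ≤ M' s → (SimpleGraph.binomialRandom V p).real
        {G | M (k i) ≤ (nbrsIn G D T).card} ≤ b / (Fintype.card V : ℝ) ^ (k i - s))
    (hover : ∀ W, W.Nonempty → W ⊆ S → (∀ a, W ≠ U a) → (SimpleGraph.binomialRandom V p).real
      ({G | ∀ a, lo a < (nbrsIn G Sᶜ (U a)).card} ∩ {G | M W.card ≤ (nbrsIn G Sᶜ W).card}) ≤ ε)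
    {h : ℝ} (hh0 : Fintype.card I * 2 ^ S.card * b ≤ h)
    (hh : h ≤ (SimpleGraph.binomialRandom V p).real
      {G | ∀ i, ∀ X ∈ Sᶜ.powersetCard (k i), ((nbrsIn G Sᶜ X).card : ℝ) ≤ c i - S.card}) :
    ((SimpleGraph.binomialRandom V p).real {G | ∀ a, (nbrsIn G Sᶜ (U a)).card ∈
      {j : ℕ | lo a < j ∧ (j : ℝ) + S.card ≤ hi a}} - 2 ^ S.card * ε) *
      (h - Fintype.card I * 2 ^ S.card * b) ≤
      (SimpleGraph.binomialRandom V p).real (familyEvent U k lo hi c) := by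
  classical
  set P := (SimpleGraph.binomialRandom V p)
  set D := Sᶜ with hD
  have hDS : Disjoint D S := disjoint_compl_left
  have hUS : ∀ a, U a ⊆ S := fun a => hS ▸ Finset.subset_biUnion_of_mem U (Finset.mem_univ a)
  set F₁ : Set (SimpleGraph V) := {G | ∀ a, (nbrsIn G D (U a)).card ∈
      {j : ℕ | lo a < j ∧ (j : ℝ) + S.card ≤ hi a}} with hF₁
  set 𝒲 := S.powerset.filter fun W => W.Nonempty ∧ ∀ a, W ≠ U a with h𝒲
  set F₂ : Set (SimpleGraph V) := {G | ∀ W, W ∈ 𝒲 → ((nbrsIn G D W).card : ℝ) < M W.card} with hF₂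
  set H : Set (SimpleGraph V) :=
    {G | ∀ i, ∀ X ∈ D.powersetCard (k i), ((nbrsIn G D X).card : ℝ) ≤ c i - S.card} with hH
  have hdepW : ∀ W, W ⊆ S → DependsOnEdges (fun G : SimpleGraph V => nbrsIn G D W)
      (edgesBetween (D : Set V) S) := fun W hW =>
    (dependsOnEdges_nbrsIn D W).mono (edgesBetween_mono le_rfl (by simpa using hW))
  have hdep₁ : DependsOnEdges (· ∈ F₁) (edgesBetween (D : Set V) S) :=
    DependsOnEdges.forall fun a => (hdepW (U a) (hUS a)).comp
      fun s : Finset V => s.card ∈ {j : ℕ | lo a < j ∧ (j : ℝ) + S.card ≤ hi a}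
  have hdep₂ : DependsOnEdges (· ∈ F₂) (edgesBetween (D : Set V) S) :=
    DependsOnEdges.forall fun W => DependsOnEdges.forall fun hW =>
      (hdepW W (Finset.mem_powerset.1 (Finset.mem_filter.1 hW).1)).comp
        fun s : Finset V => (s.card : ℝ) < M W.card
  have hdepF := hdep₁.inter hdep₂
  have hdepH : DependsOnEdges (· ∈ H) (edgesBetween (D : Set V) D) :=
    DependsOnEdges.forall fun i => DependsOnEdges.forall fun X => DependsOnEdges.forall fun hX =>
      ((dependsOnEdges_nbrsIn D X).mono (edgesBetween_mono le_rfl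
        (by simpa using (Finset.mem_powersetCard.1 hX).1))).comp
        fun s : Finset V => (s.card : ℝ) ≤ c i - S.card
  have h𝒲card : (𝒲.card : ℝ) ≤ 2 ^ S.card := by
    have := (Finset.card_filter_le S.powerset fun W => W.Nonempty ∧ ∀ a, W ≠ U a).trans
      (Finset.card_powerset S).le
    exact_mod_cast this
  have hFbound : P.real F₁ - 2 ^ S.card * ε ≤ P.real (F₁ ∩ F₂) := by
    have hsub : F₁ ⊆ (F₁ ∩ F₂) ∪ ⋃ W ∈ 𝒲, ({G | ∀ a, lo a < (nbrsIn G D (U a)).card} ∩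
        {G | M W.card ≤ (nbrsIn G D W).card}) := by
      intro G hG
      by_cases h2 : G ∈ F₂
      · exact Or.inl ⟨hG, h2⟩
      · right
        simp only [hF₂, Set.mem_ofPred_eq, not_forall, not_lt] at h2
        obtain ⟨W, hW, h2⟩ := h2
        simp only [Set.mem_iUnion]
        exact ⟨W, hW, fun a => (hG a).1, h2⟩
    have h1 := (measureReal_mono (μ := P) hsub).trans (measureReal_union_le _ _)
    have h2 : P.real (⋃ W ∈ 𝒲, ({G | ∀ a, lo a < (nbrsIn G D (U a)).card} ∩
        {G | M W.card ≤ (nbrsIn G D W).card})) ≤ 𝒲.card * ε := by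
      refine (measureReal_biUnion_finset_le _ _).trans ?_
      rw [← nsmul_eq_mul]
      refine Finset.sum_le_card_nsmul _ _ _ fun W hW => ?_
      rw [h𝒲, Finset.mem_filter, Finset.mem_powerset] at hW
      exact hover W hW.2.1 hW.1 hW.2.2
    have h3 : 𝒲.card * ε ≤ 2 ^ S.card * ε := by
      gcongr
    linarith
  set 𝒯 : I → Finset (Finset V × Finset V) := fun i =>
    (S.powerset ×ˢ D.powerset).filter fun x => x.1.Nonempty ∧ x.2.Nonempty ∧
      x.1.card + x.2.card = k i with h𝒯
  set bad : I → Finset V × Finset V → Set (SimpleGraph V) := fun i x =>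
    (F₁ ∩ F₂) ∩ {G | M (k i) ≤ (nbrsIn G D (x.1 ∪ x.2)).card} with hbad
  have hsub : (F₁ ∩ F₂) ∩ H ⊆ familyEvent U k lo hi c ∪ ⋃ i ∈ Finset.univ, ⋃ x ∈ 𝒯 i, bad i x := by
    rintro G ⟨⟨hG1, hG2⟩, hGH⟩
    by_cases hB : G ∈ ⋃ i ∈ Finset.univ, ⋃ x ∈ 𝒯 i, bad i x
    · exact Or.inr hB
    left
    have hDc : Dᶜ.card = S.card := by rw [hD, compl_compl]
    have hdeg : ∀ X, (deg G X : ℝ) ≤ (nbrsIn G D X).card + S.card := by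
      intro X
      have := deg_le_card_nbrsIn_add (G := G) D X
      rw [hDc] at this
      exact_mod_cast this
    refine ⟨fun a => ⟨?_, (hdeg _).trans (hG1 a).2⟩, fun i X hX hXU => ?_⟩
    · refine (hG1 a).1.trans_le ?_
      exact_mod_cast card_nbrsIn_le_deg D (U a)
    · rcases (X ∩ S).eq_empty_or_nonempty with hW | hW
      · have hXD : X ⊆ D := by
          rw [hD, Finset.subset_compl_iff_disjoint_right]; exact Finset.disjoint_iff_inter_eq_empty.2 hW
        have := hGH i X (Finset.mem_powersetCard.2 ⟨hXD, hX⟩)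
        linarith [hdeg X]
      · rcases (X \ S).eq_empty_or_nonempty with hT | hT
        · have hXS : X ⊆ S := Finset.sdiff_eq_empty_iff_subset.1 hT
          have := hG2 X (by
            rw [h𝒲, Finset.mem_filter, Finset.mem_powerset]
            exact ⟨hXS, hW.mono Finset.inter_subset_left, hXU⟩)
          rw [hX] at this
          linarith [hdeg X, hMc i]
        · have hu : X ∩ S ∪ X \ S = X := by rw [Finset.union_comm, Finset.sdiff_union_inter]
          have : ¬ (M (k i) ≤ (nbrsIn G D X).card) := fun h => hB (by
            simp only [Set.mem_iUnion]
            refine ⟨i, Finset.mem_univ i, (X ∩ S, X \ S), ?_, ⟨hG1, hG2⟩, ?_⟩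
            · rw [h𝒯, Finset.mem_filter, Finset.mem_product, Finset.mem_powerset,
                Finset.mem_powerset]
              refine ⟨⟨Finset.inter_subset_right, ?_⟩, hW, hT, ?_⟩
              · intro v hv
                rw [hD, Finset.mem_compl]; exact (Finset.mem_sdiff.1 hv).2
              · rw [← hX]; exact Finset.card_inter_add_card_sdiff X S
            · simp only [Set.mem_ofPred_eq, hu]; exact h)
          linarith [hdeg X, hMc i, not_le.1 this]
  -- A nonempty `W ⊆ S` is either some `U a`, bounded through `hi`, or not extremal because of `F₂`.
  -- This is the bound required to apply the extension estimate.
  have hFM : ∀ G ∈ F₁ ∩ F₂, ∀ W ⊆ S, W.Nonempty → ((nbrsIn G D W).card : ℝ) ≤ M' W.card := by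
    rintro G ⟨h1, h2⟩ W hWS hW
    by_cases hne : ∀ a, W ≠ U a
    · exact (h2 W (by rw [h𝒲, Finset.mem_filter, Finset.mem_powerset]; exact ⟨hWS, hW, hne⟩)).le.trans
        (hMM' _)
    · push Not at hne
      obtain ⟨a, rfl⟩ := hne
      rw [hU]
      refine le_trans ?_ (hM' a)
      have := (h1 a).2
      have : (0 : ℝ) ≤ S.card := Nat.cast_nonneg _
      linarith
  have hbadle : ∀ i, ∑ x ∈ 𝒯 i, P.real (bad i x) ≤ P.real (F₁ ∩ F₂) * (2 ^ S.card * b) := by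
    intro i
    set N : ℝ := (Fintype.card V : ℝ)
    have hterm : ∀ x ∈ 𝒯 i, P.real (bad i x) ≤ P.real (F₁ ∩ F₂) * (b / N ^ (k i - x.1.card)) := by
      rintro ⟨W, T⟩ hx
      rw [h𝒯, Finset.mem_filter, Finset.mem_product, Finset.mem_powerset,
        Finset.mem_powerset] at hx
      obtain ⟨⟨hWS, hTD⟩, hW, hT, hc⟩ := hx
      dsimp only at hWS hTD hW hT hc ⊢
      have hT0 := hT.card_pos
      exact measureReal_inter_extension_le hDS hdepF hWS hTD (fun G hG => hFM G hG W hWS hW)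
        fun D₀ hD₀ hD₀c => hext i W.card hW.card_pos (by omega) T D₀ (by omega) hD₀ hD₀c
    have hPF : 0 ≤ P.real (F₁ ∩ F₂) := measureReal_nonneg
    have hN : 0 ≤ N := Nat.cast_nonneg _
    calc ∑ x ∈ 𝒯 i, P.real (bad i x)
        ≤ ∑ x ∈ 𝒯 i, P.real (F₁ ∩ F₂) * (b / N ^ (k i - x.1.card)) := Finset.sum_le_sum hterm
      _ = ∑ W ∈ S.powerset, ∑ x ∈ 𝒯 i with x.1 = W,
            P.real (F₁ ∩ F₂) * (b / N ^ (k i - x.1.card)) := by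
          refine (Finset.sum_fiberwise_of_maps_to (fun x hx => ?_) _).symm
          exact (Finset.mem_product.1 (Finset.mem_filter.1 hx).1).1
      _ ≤ ∑ W ∈ S.powerset, P.real (F₁ ∩ F₂) * b := by
          refine Finset.sum_le_sum fun W hW => ?_
          -- For fixed `W` the number of extensions cancels the denominator in `hext`, and only the
          -- factor `b` is left.
          have hcard : ((𝒯 i).filter fun x => x.1 = W).card ≤ Fintype.card V ^ (k i - W.card) := by
            calc _ ≤ (D.powersetCard (k i - W.card)).card := by
                  refine Finset.card_le_card_of_injOn Prod.snd (fun x hx => ?_) ?_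
                  · rw [Finset.mem_coe, Finset.mem_filter, h𝒯, Finset.mem_filter,
                      Finset.mem_product, Finset.mem_powerset, Finset.mem_powerset] at hx
                    rw [Finset.mem_coe, Finset.mem_powersetCard]
                    obtain ⟨⟨⟨-, h2⟩, -, -, h3⟩, rfl⟩ := hx
                    exact ⟨h2, by omega⟩
                  · intro x hx y hy hxy
                    rw [Finset.mem_coe, Finset.mem_filter] at hx hy
                    exact Prod.ext (hx.2.trans hy.2.symm) hxy
              _ ≤ D.card ^ (k i - W.card) := by
                  rw [Finset.card_powersetCard]; exact Nat.choose_le_pow _ _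
              _ ≤ _ := Nat.pow_le_pow_left (Finset.card_le_univ _) _
          rw [Finset.sum_congr rfl (g := fun _ => P.real (F₁ ∩ F₂) * (b / N ^ (k i - W.card)))
            (fun x hx => by rw [(Finset.mem_filter.1 hx).2]), Finset.sum_const, nsmul_eq_mul]
          have hcard' : (((𝒯 i).filter fun x => x.1 = W).card : ℝ) ≤ N ^ (k i - W.card) := by
            have := (Nat.cast_le (α := ℝ)).2 hcard
            rwa [Nat.cast_pow] at this
          calc _ ≤ N ^ (k i - W.card) * (P.real (F₁ ∩ F₂) * (b / N ^ (k i - W.card))) := by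
                gcongr
            _ = P.real (F₁ ∩ F₂) * (b * (N ^ (k i - W.card) / N ^ (k i - W.card))) := by ring
            _ ≤ P.real (F₁ ∩ F₂) * (b * 1) := by
                gcongr
                exact div_self_le_one _
            _ = _ := by rw [mul_one]
      _ = _ := by
          rw [Finset.sum_const, Finset.card_powerset, nsmul_eq_mul]; push_cast; ring
  have h1 := (measureReal_mono (μ := P) hsub).trans (measureReal_union_le _ _)
  rw [measureReal_inter_of_dependsOnEdges (disjoint_edgesBetween_self (by simpa using hDS)) hdepF
    hdepH] at h1
  have h2 : P.real (⋃ i ∈ Finset.univ, ⋃ x ∈ 𝒯 i, bad i x) ≤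
      P.real (F₁ ∩ F₂) * (Fintype.card I * 2 ^ S.card * b) := by
    calc _ ≤ ∑ i, P.real (⋃ x ∈ 𝒯 i, bad i x) := measureReal_biUnion_finset_le _ _
      _ ≤ ∑ i : I, P.real (F₁ ∩ F₂) * (2 ^ S.card * b) :=
        Finset.sum_le_sum fun i _ => (measureReal_biUnion_finset_le _ _).trans (hbadle i)
      _ = _ := by rw [Finset.sum_const, Finset.card_univ, nsmul_eq_mul]; ring
  have h3 := mul_le_mul_of_nonneg_right hFbound (sub_nonneg.2 hh0)
  have h4 := mul_le_mul_of_nonneg_left hh (measureReal_nonneg (μ := P) (s := F₁ ∩ F₂))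
  linarith

end Families
end CommonNbr

namespace CommonNbr

/-! ### Limits of the binomial factors of one family. -/

section OneSet

variable {p : ℝ} {k : ℕ}

/-- `⌊·⌋₊ + 1` is the least natural number beyond a nonnegative threshold. Both the rounding and the
constant `C` vanish against the scale. -/
lemma tendsto_floor_sub_center (hp0 : 0 < p) (hp1 : p < 1) (hk : 0 < k) (x C : ℝ) :
    Tendsto (fun n => (((⌊center p n k + scale p n k * x - C⌋₊ + 1 : ℕ) : ℝ) - center p n k) /
      scale p n k) atTop (𝓝 x) := by
  have h0 : ∀ᶠ n : ℕ in atTop, 0 ≤ center p n k + scale p n k * x - C := by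
    filter_upwards [eventually_level_le hp0 hp1 hk x C zero_lt_one] with n hn
    refine le_trans ?_ hn
    unfold level
    simp only [zero_mul, add_zero]
    positivity
  refine tendsto_of_tendsto_of_tendsto_of_le_of_le' (tendsto_affine_sub_center hp0 hp1 hk x C)
    (tendsto_affine_sub_center hp0 hp1 hk x (C - 1)) ?_ ?_
  · filter_upwards [eventually_ge_atTop 2] with n hn
    have := scale_pos hp0 hp1 hk hn
    gcongr
    push_cast
    exact (Nat.lt_floor_add_one _).le
  · filter_upwards [eventually_ge_atTop 2, h0] with n hn h0
    have := scale_pos hp0 hp1 hk hn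
    gcongr
    push_cast
    linarith [Nat.floor_le h0]

lemma sub_le_binomial_real (N : ℕ) (q : unitInterval) {lo : ℝ} (hlo : 0 ≤ lo) (hi C : ℝ) :
    binTail N q (⌊lo⌋₊ + 1) - binTail N q (⌊hi - C⌋₊ + 1) ≤
      (binomial N q).real {j : ℕ | lo < j ∧ (j : ℝ) + C ≤ hi} := by
  rw [← binomial_real_Ici, ← binomial_real_Ici]
  refine le_trans (le_measureReal_sdiff) (measureReal_mono ?_ (measure_ne_top _ _))
  rintro j ⟨h1, h2⟩
  simp only [Set.mem_Ici, not_le] at h1 h2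
  refine ⟨(Nat.floor_lt hlo).1 h1, ?_⟩
  -- Here `j ≥ ⌊lo⌋₊ + 1` is nonzero, so comparison with the floor is valid whatever the sign of `hi
  -- - C`.
  have := (Nat.le_floor_iff' (by omega)).1 (Nat.lt_succ_iff.1 h2)
  linarith

lemma exists_tendsto_le_binomial_real (hp0 : 0 < p) (hp1 : p < 1) (hk : 0 < k) (q : unitInterval)
    (hq : (q : ℝ) = p ^ k) (x x' : ℝ) (K : ℕ) :
    ∃ g : ℕ → ℝ, Tendsto g atTop (𝓝 (Real.exp (-x) - Real.exp (-x'))) ∧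
      ∀ᶠ n : ℕ in atTop, g n ≤ (n : ℝ) ^ k / k.factorial *
        (binomial (n - K) q).real {j : ℕ | center p n k + scale p n k * x < j ∧
          (j : ℝ) + K ≤ center p n k + scale p n k * x'} := by
  have hN : ∀ᶠ n : ℕ in atTop, n - K ≤ n ∧ n ≤ n - K + K := .of_forall fun n => by omega
  refine ⟨_, (tendsto_binTail_center hp0 hp1 hk hN (tendsto_floor_sub_center hp0 hp1 hk x 0)).sub
    (tendsto_binTail_center hp0 hp1 hk hN (tendsto_floor_sub_center hp0 hp1 hk x' K)), ?_⟩
  filter_upwards [eventually_level_le hp0 hp1 hk x 0 zero_lt_one] with n hn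
  have h0 : 0 ≤ center p n k + scale p n k * x - 0 := by
    refine le_trans ?_ hn
    unfold level
    simp only [zero_mul, add_zero]
    positivity
  rw [sub_zero] at h0 ⊢
  rw [← mul_sub, ← hq]
  gcongr
  exact sub_le_binomial_real _ q h0 _ _

lemma exp_neg_div_le_pow {t : ℝ} (h0 : 0 ≤ t) (h1 : t < 1) {M : ℕ} {A : ℝ} (hM : (M : ℝ) ≤ A) :
    Real.exp (-(A * t / (1 - t))) ≤ (1 - t) ^ M := by
  have ht : 0 < 1 - t := by linarith
  rw [← Real.exp_log (pow_pos ht M), Real.log_pow, Real.exp_le_exp]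
  have h := Real.one_sub_inv_le_log_of_pos ht
  have e : 1 - (1 - t)⁻¹ = -(t / (1 - t)) := by field_simp; ring
  have h2 : 0 ≤ t / (1 - t) := by positivity
  calc -(A * t / (1 - t)) = -(A * (t / (1 - t))) := by ring
    _ ≤ M * (-(t / (1 - t))) := by nlinarith
    _ ≤ _ := by rw [← e]; gcongr

/-- A product of about `n ^ k / k!` factors `1 - t`, where `n ^ k / k! * t → e^{-x}`; this is where
the Gumbel factor arises. The number of trials is `n - K - k`, since a `k`-set inside `D` can have
common neighbours in `D` only outside itself. -/
lemma exists_tendsto_le_binomial_real_pow (hp0 : 0 < p) (hp1 : p < 1) (hk : 0 < k)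
    (q : unitInterval) (hq : (q : ℝ) = p ^ k) (x : ℝ) (K : ℕ) :
    ∃ g : ℕ → ℝ, Tendsto g atTop (𝓝 (Real.exp (-Real.exp (-x)))) ∧
      ∀ᶠ n : ℕ in atTop, 0 ≤ g n ∧ g n ≤ (binomial (n - K - k) q).real
        {j : ℕ | (j : ℝ) ≤ center p n k + scale p n k * x - K} ^ (n - K).choose k := by
  have hN : ∀ᶠ n : ℕ in atTop, n - K - k ≤ n ∧ n ≤ n - K - k + (K + k) :=
    .of_forall fun n => by omega
  have ht := tendsto_binTail_center hp0 hp1 hk hN (tendsto_floor_sub_center hp0 hp1 hk x K)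
  set t : ℕ → ℝ := fun n => binTail (n - K - k) (p ^ k)
    (⌊center p n k + scale p n k * x - K⌋₊ + 1) with htdef
  have hpow : Tendsto (fun n : ℕ => (n : ℝ) ^ k / k.factorial) atTop atTop :=
    ((tendsto_pow_atTop hk.ne').comp tendsto_natCast_atTop_atTop).atTop_div_const (by positivity)
  have ht0 : Tendsto t atTop (𝓝 0) := by
    refine (ht.div_atTop hpow).congr' ?_
    filter_upwards [hpow.eventually_gt_atTop 0] with n hn
    rw [mul_div_cancel_left₀ _ hn.ne']
  have hlim : Tendsto (fun n : ℕ => Real.exp (-((n : ℝ) ^ k / k.factorial * t n / (1 - t n)))) atTop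
      (𝓝 (Real.exp (-Real.exp (-x)))) := by
    have := (ht.div (ht0.const_sub 1) (by norm_num)).neg.rexp
    rwa [sub_zero, div_one] at this
  refine ⟨_, hlim, ?_⟩
  filter_upwards [eventually_level_le hp0 hp1 hk x K zero_lt_one,
    ht0.eventually (gt_mem_nhds zero_lt_one)] with n hn ht1
  have h0 : 0 ≤ center p n k + scale p n k * x - K := by
    refine le_trans ?_ hn
    unfold level
    simp only [zero_mul, add_zero]
    positivity
  refine ⟨(Real.exp_pos _).le, ?_⟩
  have ht2 : t n = (binomial (n - K - k) q).real
      (Set.Ici (⌊center p n k + scale p n k * x - K⌋₊ + 1)) := by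
    rw [binomial_real_Ici, hq]
  have e : (binomial (n - K - k) q).real
        {j : ℕ | (j : ℝ) ≤ center p n k + scale p n k * x - K} = 1 - t n := by
    rw [ht2, ← probReal_compl_eq_one_sub .of_discrete]
    congr 1
    ext j
    rw [Set.mem_compl_iff, Set.mem_Ici, not_le, Nat.lt_add_one_iff, Nat.le_floor_iff h0]; rfl
  rw [e]
  refine exp_neg_div_le_pow (ht2 ▸ measureReal_nonneg) ht1 ?_
  refine (Nat.choose_le_pow_div k (n - K)).trans ?_
  gcongr
  exact_mod_cast Nat.sub_le n K

lemma tendsto_choose_sub_div (K k : ℕ) :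
    Tendsto (fun n : ℕ => ((n - K).choose k : ℝ) * (k.factorial / (n : ℝ) ^ k)) atTop (𝓝 1) := by
  have h1 : ∀ c : ℕ, Tendsto (fun n : ℕ => ((n - c : ℕ) : ℝ) / n) atTop (𝓝 1) := by
    intro c
    have := (tendsto_const_div_atTop_nhds_zero_nat (c : ℝ)).const_sub 1
    rw [sub_zero] at this
    refine this.congr' ?_
    filter_upwards [eventually_ge_atTop (c + 1)] with n hn
    have : (0 : ℝ) < n := by exact_mod_cast (by omega : 0 < n)
    rw [Nat.cast_sub (by omega)]
    field_simp
  have h2 := tendsto_finsetProd (Finset.range k) fun i _ => h1 (K + i)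
  rw [Finset.prod_const_one] at h2
  refine h2.congr' ?_
  filter_upwards [eventually_ge_atTop 1] with n hn
  have hn0 : (0 : ℝ) < n := by exact_mod_cast hn
  rw [Finset.prod_div_distrib, Finset.prod_const, Finset.card_range, mul_div_assoc', ← Nat.cast_mul,
    mul_comm (Nat.choose _ _), ← Nat.descFactorial_eq_factorial_mul_choose,
    Nat.descFactorial_eq_prod_range, Nat.cast_prod]
  simp only [Nat.sub_sub]

end OneSet

/-! ### The number of disjoint families. -/

section Counting

variable {V ι : Type*} [Fintype V] [DecidableEq V] [Fintype ι] [DecidableEq ι]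

/-- The families of pairwise disjoint sets of vertices of the given sizes. -/
def disjointFamilies (V : Type*) [Fintype V] [DecidableEq V] (κ : ι → ℕ) :
    Finset (ι → Finset V) :=
  {U ∈ Fintype.piFinset fun a => Finset.univ.powersetCard (κ a) |
    ∀ a b, a ≠ b → Disjoint (U a) (U b)}

lemma mem_disjointFamilies {κ : ι → ℕ} {U : ι → Finset V} : U ∈ disjointFamilies V κ ↔
    (∀ a, (U a).card = κ a) ∧ Pairwise (Function.onFun Disjoint U) := by
  simp [disjointFamilies, Finset.mem_powersetCard, Pairwise, Function.onFun]

/-- The sets are chosen one at a time; at every stage at least `card V - ∑ a, κ a` vertices are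
unused. -/
lemma prod_choose_le_card_disjointFamilies (κ : ι → ℕ) :
    ∏ a, (Fintype.card V - ∑ a, κ a).choose (κ a) ≤ (disjointFamilies V κ).card := by
  set K := ∑ a, κ a with hK
  -- Positions not yet treated carry the size `0`, hence the empty set, so the index type stays
  -- fixed during the induction.
  suffices h : ∀ s : Finset ι, ∏ a ∈ s, (Fintype.card V - K).choose (κ a) ≤
      (disjointFamilies V fun a => if a ∈ s then κ a else 0).card by
    simpa using h Finset.univ
  intro s
  induction s using Finset.induction_on with
  | empty =>
    rw [Finset.prod_empty, Nat.one_le_iff_ne_zero, Finset.card_ne_zero]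
    exact ⟨fun _ => ∅, mem_disjointFamilies.2 ⟨fun a => by simp, fun _ _ _ => by simp⟩⟩
  | insert a s ha ih =>
    rw [Finset.prod_insert ha, mul_comm]
    have hUa : ∀ U ∈ disjointFamilies V fun a => if a ∈ s then κ a else 0, U a = ∅ := by
      intro U hU
      have := (mem_disjointFamilies.1 hU).1 a
      simpa [ha] using this
    calc (∏ x ∈ s, (Fintype.card V - K).choose (κ x)) * (Fintype.card V - K).choose (κ a)
        ≤ (disjointFamilies V fun a => if a ∈ s then κ a else 0).card *
          (Fintype.card V - K).choose (κ a) := Nat.mul_le_mul_right _ ih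
      _ ≤ ((disjointFamilies V fun a => if a ∈ s then κ a else 0).sigma fun U =>
          (Finset.univ.biUnion U)ᶜ.powersetCard (κ a)).card := by
        rw [Finset.card_sigma, ← smul_eq_mul]
        refine Finset.card_nsmul_le_sum _ _ _ fun U hU => ?_
        rw [Finset.card_powersetCard, Finset.card_compl]
        refine Nat.choose_le_choose _ (Nat.sub_le_sub_left ?_ _)
        refine Finset.card_biUnion_le.trans (Finset.sum_le_sum fun b _ => ?_)
        rw [(mem_disjointFamilies.1 hU).1 b]
        split_ifs <;> simp
      _ ≤ _ := by
        refine Finset.card_le_card_of_injOn (fun x => Function.update x.1 a x.2) ?_ ?_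
        · rintro ⟨U, T⟩ hx
          rw [Finset.mem_coe, Finset.mem_sigma, Finset.mem_powersetCard] at hx
          obtain ⟨hU, hT, hTc⟩ := hx
          dsimp only at hU hT hTc ⊢
          obtain ⟨hU1, hU2⟩ := mem_disjointFamilies.1 hU
          have hTU : ∀ b, Disjoint T (U b) := fun b => by
            rw [Finset.subset_compl_iff_disjoint_right] at hT
            exact hT.mono_right (Finset.subset_biUnion_of_mem U (Finset.mem_univ b))
          rw [Finset.mem_coe, mem_disjointFamilies]
          refine ⟨fun b => ?_, fun b b' hb => ?_⟩
          · by_cases hb : b = a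
            · subst hb; simp [hTc]
            · rw [Function.update_of_ne hb, hU1]; simp [hb]
          · rw [Function.onFun]
            by_cases h1 : b = a
            · subst h1
              rw [Function.update_self, Function.update_of_ne hb.symm]; exact hTU b'
            · rw [Function.update_of_ne h1]
              by_cases h2 : b' = a
              · subst h2; rw [Function.update_self]; exact (hTU b).symm
              · rw [Function.update_of_ne h2]; exact hU2 hb
        · rintro ⟨U, T⟩ hx ⟨U', T'⟩ hx' h
          rw [Finset.mem_coe, Finset.mem_sigma] at hx hx'
          dsimp only at h
          have hT : T = T' := by simpa using congrFun h a
          subst hT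
          have : U = U' := by
            funext b
            by_cases hb : b = a
            · subst hb; rw [hUa U hx.1, hUa U' hx'.1]
            · simpa [hb] using congrFun h b
          rw [this]

end Counting

/-! ### No extremal set outside the family. -/

section Harris

variable {V I : Type*} [Fintype V] [DecidableEq V] [Fintype I] {p : unitInterval}

/-- The counts of overlapping sets are dependent, but each event is decreasing in the graph, so
Harris bounds the joint probability below by the product, the only direction needed. -/
lemma prod_binomial_real_pow_le (D : Finset V) (k : I → ℕ) (c : I → ℝ) :
    ∏ i, (binomial (D.card - k i) (p ^ k i)).real {j : ℕ | (j : ℝ) ≤ c i} ^ D.card.choose (k i) ≤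
      (SimpleGraph.binomialRandom V p).real
        {G | ∀ i, ∀ X ∈ D.powersetCard (k i), ((nbrsIn G D X).card : ℝ) ≤ c i} := by
  have h := prod_measureReal_le_biInter_of_isLowerSet (p := p)
    (Finset.univ.sigma fun i => D.powersetCard (k i))
    (A := fun x : Σ _ : I, Finset V => {G : SimpleGraph V | ((nbrsIn G D x.2).card : ℝ) ≤ c x.1})
    fun x _ => isLowerSet_card_nbrsIn_le D x.2 (c x.1)
  rw [Finset.prod_sigma] at h
  refine (Eq.le ?_).trans (h.trans (Eq.le ?_))
  · refine Finset.prod_congr rfl fun i _ => ?_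
    rw [← Finset.card_powersetCard, ← Finset.prod_const]
    refine Finset.prod_congr rfl fun X hX => ?_
    rw [Finset.mem_powersetCard] at hX
    have := measureReal_card_nbrsIn_mem (p := p) (D := D \ X) (B := X) Finset.sdiff_disjoint
      {j : ℕ | (j : ℝ) ≤ c i}
    simp only [nbrsIn_sdiff_self] at this
    rw [Finset.card_sdiff_of_subset hX.1, hX.2] at this
    exact this.symm
  · congr 1
    ext G
    simp only [Set.mem_iInter, Finset.mem_sigma, Finset.mem_univ, true_and]
    exact ⟨fun h i X hX => h ⟨i, X⟩ hX, fun h x hx => h x.1 x.2 hx⟩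

end Harris

end CommonNbr

/-! ### Summation over all disjoint families. -/

namespace CommonNbr

variable {ι I : Type*} [Fintype ι] [DecidableEq ι] [Fintype I] {p : unitInterval}

/-- The probability for each family is bounded below by a quantity asymptotic to `∏ κ! / n ^ κ`
times the asserted limit, uniformly in the family, and there are at least `(1 + o(1)) ∏ n ^ κ / κ!`
families. The error terms `b = n^{-c}` and `ε = n^{-K-c}` are of lower order. -/
theorem exists_tendsto_le_sum_measureReal_familyEvent (hp0 : 0 < (p : ℝ)) (hp1 : (p : ℝ) < 1)
    {κ : ι → ℕ} (hκ : ∀ a, 0 < κ a) {k : I → ℕ} (hk : ∀ i, 0 < k i) {x x' : ι → ℝ}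
    (hx : ∀ a, x a < x' a) (z : I → ℝ) :
    ∃ f : ℕ → ℝ, Tendsto f atTop (𝓝 ((∏ a, (Real.exp (-x a) - Real.exp (-x' a))) *
        ∏ i, Real.exp (-Real.exp (-z i)))) ∧
      ∀ᶠ n : ℕ in atTop, f n ≤ ∑ U ∈ disjointFamilies (Fin n) κ,
        (SimpleGraph.binomialRandom (Fin n) p).real
          (familyEvent U k (fun a => center p n (κ a) + scale p n (κ a) * x a)
            (fun a => center p n (κ a) + scale p n (κ a) * x' a)
            (fun i => center p n (k i) + scale p n (k i) * z i)) := by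
  set K := ∑ a, κ a with hK
  have hc : ∀ᶠ c : ℝ in 𝓝[>] 0, c ∈ Set.Ioo (0 : ℝ) 1 := Ioo_mem_nhdsGT zero_lt_one
  have hext : ∀ᶠ c : ℝ in 𝓝[>] 0, ∀ i, ∀ s ∈ Finset.Ioo 0 (k i), ∀ᶠ n : ℕ in atTop,
      ∀ T D : Finset (Fin n), T.card = k i - s → Disjoint D T →
      (D.card : ℝ) ≤ level p s (1 + c) n → (SimpleGraph.binomialRandom (Fin n) p).real
        {G | level p (k i) (1 - c) n ≤ (nbrsIn G D T).card} ≤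
        Real.exp (-((((k i - s : ℕ) : ℝ) + c) * Real.log n)) := by
    rw [eventually_all]
    intro i
    rw [eventually_all_finset]
    intro s hs
    rw [Finset.mem_Ioo] at hs
    exact eventually_prob_extension_le hp0 hp1 hs.1 hs.2
  -- One `c` serves all extensions and overlaps at once, because only finitely many pairs `(i, s)`
  -- occur.
  obtain ⟨c, ⟨hc0, hc1⟩, hext, hover⟩ :=
    (hc.and (hext.and (eventually_prob_overlap_le hp0 hp1 hκ))).exists
  have hext' : ∀ᶠ n : ℕ in atTop, ∀ i, ∀ s ∈ Finset.Ioo 0 (k i),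
      ∀ T D : Finset (Fin n), T.card = k i - s → Disjoint D T →
      (D.card : ℝ) ≤ level p s (1 + c) n → (SimpleGraph.binomialRandom (Fin n) p).real
        {G | level p (k i) (1 - c) n ≤ (nbrsIn G D T).card} ≤
        Real.exp (-((((k i - s : ℕ) : ℝ) + c) * Real.log n)) := by
    rw [eventually_all]
    intro i
    rw [eventually_all_finset]
    exact hext i
  choose g hg hgle using fun a => exists_tendsto_le_binomial_real hp0 hp1 (hκ a) (p ^ κ a)
    (by push_cast; rfl) (x a) (x' a) K
  choose w hw hwle using fun i => exists_tendsto_le_binomial_real_pow hp0 hp1 (hk i) (p ^ k i)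
    (by push_cast; rfl) (z i) K
  set b : ℕ → ℝ := fun n => Real.exp (-(c * Real.log n)) with hb
  have hb0 : Tendsto b atTop (𝓝 0) :=
    Real.tendsto_exp_neg_atTop_nhds_zero.comp (tendsto_log_natCast_atTop.const_mul_atTop hc0)
  set A : ℝ := ∏ a, ((κ a).factorial : ℝ)
  have hA : 0 < A := Finset.prod_pos fun a _ => by positivity
  -- The overlap error `2 ^ K * ε`, rescaled by `n ^ K / A` like the main term, becomes `2 ^ K * b n
  -- / A`.
  have hg' : Tendsto (fun n => ∏ a, g a n - 2 ^ K * b n / A) atTop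
      (𝓝 (∏ a, (Real.exp (-x a) - Real.exp (-x' a)))) := by
    have := (tendsto_finsetProd Finset.univ fun a _ => hg a).sub ((hb0.const_mul (2 ^ K)).div_const A)
    rwa [mul_zero, zero_div, sub_zero] at this
  have hw' : Tendsto (fun n => ∏ i, w i n - Fintype.card I * 2 ^ K * b n) atTop
      (𝓝 (∏ i, Real.exp (-Real.exp (-z i)))) := by
    have := (tendsto_finsetProd Finset.univ fun i _ => hw i).sub
      (hb0.const_mul ((Fintype.card I : ℝ) * 2 ^ K))
    rwa [mul_zero, sub_zero] at this
  have hC := tendsto_finsetProd Finset.univ fun a _ => tendsto_choose_sub_div K (κ a)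
  rw [Finset.prod_const_one] at hC
  have hlim := hC.mul (hg'.mul hw')
  rw [one_mul] at hlim
  refine ⟨_, hlim, ?_⟩
  have hgpos : ∀ a, 0 < Real.exp (-x a) - Real.exp (-x' a) := fun a =>
    sub_pos.2 (Real.exp_lt_exp.2 (neg_lt_neg (hx a)))
  have e1 : ∀ᶠ n : ℕ in atTop, ∀ a, level p (κ a) (1 - c) n ≤
      center p n (κ a) + scale p n (κ a) * x a - 0 :=
    eventually_all.2 fun a => eventually_level_le hp0 hp1 (hκ a) _ _ (by linarith)
  have e2 : ∀ᶠ n : ℕ in atTop, ∀ a, center p n (κ a) + scale p n (κ a) * x' a - 0 ≤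
      level p (κ a) (1 + c) n :=
    eventually_all.2 fun a => eventually_le_level hp0 hp1 (hκ a) _ _ (by linarith)
  have e3 : ∀ᶠ n : ℕ in atTop, ∀ i, level p (k i) (1 - c) n ≤
      center p n (k i) + scale p n (k i) * z i - K :=
    eventually_all.2 fun i => eventually_level_le hp0 hp1 (hk i) _ _ (by linarith)
  have e4 : ∀ᶠ n : ℕ in atTop, ∀ a, 0 < g a n :=
    eventually_all.2 fun a => (hg a).eventually (lt_mem_nhds (hgpos a))
  have e5 := hg'.eventually (lt_mem_nhds (Finset.prod_pos fun a _ => hgpos a))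
  have e6 := hw'.eventually (lt_mem_nhds (Finset.prod_pos fun i _ => Real.exp_pos _))
  filter_upwards [hext', hover, eventually_all.2 hgle, eventually_all.2 hwle, e1, e2, e3, e4, e5, e6,
    eventually_ge_atTop 1] with n hext hover hgle hwle e1 e2 e3 e4 e5 e6 hn
  have hn0 : (0 : ℝ) < n := by exact_mod_cast hn
  have hexp : ∀ j : ℕ, Real.exp (-(((j : ℝ) + c) * Real.log n)) = b n / (n : ℝ) ^ j := by
    intro j
    rw [add_mul, neg_add, Real.exp_add, Real.exp_neg, Real.exp_nat_mul, Real.exp_log hn0, hb]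
    ring
  have hkey : ∀ U ∈ disjointFamilies (Fin n) κ, A / (n : ℝ) ^ K *
      ((∏ a, g a n - 2 ^ K * b n / A) * (∏ i, w i n - Fintype.card I * 2 ^ K * b n)) ≤
        (SimpleGraph.binomialRandom (Fin n) p).real
          (familyEvent U k (fun a => center p n (κ a) + scale p n (κ a) * x a)
            (fun a => center p n (κ a) + scale p n (κ a) * x' a)
            (fun i => center p n (k i) + scale p n (k i) * z i)) := by
    intro U hU
    obtain ⟨hUc, hUd⟩ := mem_disjointFamilies.1 hU
    set S := Finset.univ.biUnion U with hS
    have hSc : S.card = K := by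
      rw [hS, Finset.card_biUnion fun a _ b _ hab => hUd hab, hK]
      exact Finset.sum_congr rfl fun a _ => hUc a
    have hDc : Sᶜ.card = n - K := by rw [Finset.card_compl, Fintype.card_fin, hSc]
    have hDU : ∀ a, Disjoint Sᶜ (U a) := fun a =>
      (disjoint_compl_left (a := S)).mono_right (Finset.subset_biUnion_of_mem U (Finset.mem_univ a))
    have h := le_measureReal_familyEvent (p := p) (k := k) (κ := κ) (U := U) hUc hS
      (lo := fun a => center p n (κ a) + scale p n (κ a) * x a)
      (hi := fun a => center p n (κ a) + scale p n (κ a) * x' a)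
      (c := fun i => center p n (k i) + scale p n (k i) * z i)
      (M := fun s => level p s (1 - c) n) (M' := fun s => level p s (1 + c) n) (b := b n)
      (ε := b n / (n : ℝ) ^ K) (h := ∏ i, w i n) (Real.exp_pos _).le (by positivity)
      (fun a => by simpa using e2 a) (fun s => level_mono (by linarith))
      (fun i => by have := e3 i; rw [hSc]; linarith)
      (fun i s hs hsk T D hT hD hDle => by
        rw [Fintype.card_fin, ← hexp]
        exact hext i s (Finset.mem_Ioo.2 ⟨hs, hsk⟩) T D hT hD hDle)
      (fun W hW hWS hWU => by
        rw [← hexp]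
        refine (measureReal_mono ?_ (measure_ne_top _ _)).trans
          (hover U W Sᶜ hUd hUc hW hWS hWU hDU)
        refine Set.inter_subset_inter_left _ fun G hG a => ?_
        have h1 := e1 a
        rw [sub_zero] at h1
        exact h1.trans (hG a).le)
      (by rw [hSc]; linarith)
      (by
        refine le_trans ?_ (prod_binomial_real_pow_le Sᶜ k _)
        refine Finset.prod_le_prod (fun i _ => (hwle i).1) fun i _ => ?_
        rw [hDc, hSc]
        exact (hwle i).2)
    refine le_trans ?_ h
    rw [measureReal_forall_card_nbrsIn_mem hUd hDU, hSc, ← mul_assoc]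
    refine mul_le_mul_of_nonneg_right ?_ (sub_nonneg.2 (by linarith))
    rw [mul_sub]
    refine sub_le_sub ?_ (le_of_eq (by field_simp))
    rw [hK, ← Finset.prod_pow_eq_pow_sum, ← Finset.prod_div_distrib, ← Finset.prod_mul_distrib]
    refine Finset.prod_le_prod (fun a _ => by have := e4 a; positivity) fun a _ => ?_
    rw [hDc, hUc a]
    have := hgle a
    rw [div_mul_eq_mul_div, div_le_iff₀ (by positivity)]
    rw [div_mul_eq_mul_div, le_div_iff₀ (by positivity)] at this
    linarith
  refine le_trans ?_ (Finset.card_nsmul_le_sum _ _ _ hkey)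
  rw [nsmul_eq_mul, ← mul_assoc (Nat.cast _)]
  refine mul_le_mul_of_nonneg_right ?_ (mul_nonneg e5.le e6.le)
  rw [Finset.prod_mul_distrib, Finset.prod_div_distrib, Finset.prod_pow_eq_pow_sum]
  refine mul_le_mul_of_nonneg_right ?_ (by positivity)
  have := prod_choose_le_card_disjointFamilies (V := Fin n) κ
  rw [Fintype.card_fin] at this
  exact_mod_cast this

end CommonNbr

/-! ### From families of sets to ordered maxima. -/

namespace CommonNbr

/-- Above the degree of `U j` lie only the sets `U i` with `i < j`, exactly `j` of them, so the set
whose supremum is taken is `Set.Iic (deg G (U j))`. -/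
lemma jthMax_succ_eq {V : Type*} [Finite V] {G : SimpleGraph V} {k m : ℕ} {U : Fin m → Finset V}
    (hU : ∀ j, (U j).card = k) (hdeg : StrictAnti fun j => deg G (U j))
    (hX : ∀ X : Finset V, X.card = k → (∀ j, X ≠ U j) → ∀ j, deg G X < deg G (U j)) (j : Fin m) :
    jthMax G k (j + 1) = deg G (U j) := by
  have hinj : Function.Injective U := fun a b h => hdeg.injective (congrArg (deg G) h)
  unfold jthMax
  suffices h : {d : ℕ | (j : ℕ) + 1 ≤ Set.ncard {X : Finset V | X.card = k ∧ d ≤ deg G X}} =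
      Set.Iic (deg G (U j)) by rw [h, csSup_Iic]
  ext d
  rw [Set.mem_ofPred_eq, Set.mem_Iic]
  constructor
  · intro h
    by_contra! hd
    have hsub : {X : Finset V | X.card = k ∧ d ≤ deg G X} ⊆ U '' Set.Iio j := by
      rintro X ⟨hXk, hXd⟩
      by_cases hne : ∀ i, X ≠ U i
      · have := hX X hXk hne j
        omega
      · push Not at hne
        obtain ⟨i, rfl⟩ := hne
        refine ⟨i, ?_, rfl⟩
        rw [Set.mem_Iio, ← hdeg.lt_iff_gt]
        exact hd.trans_le hXd
    have h2 := Set.ncard_le_ncard hsub (Set.toFinite _)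
    rw [Set.ncard_image_of_injective _ hinj, ← Finset.coe_Iio, Set.ncard_coe_finset,
      Fin.card_Iio] at h2
    omega
  · intro h
    have hsub : U '' Set.Iic j ⊆ {X : Finset V | X.card = k ∧ d ≤ deg G X} := by
      rintro _ ⟨i, hi, rfl⟩
      exact ⟨hU i, h.trans (hdeg.antitone hi)⟩
    have h2 := Set.ncard_le_ncard hsub (Set.toFinite _)
    rwa [Set.ncard_image_of_injective _ hinj, ← Finset.coe_Iic, Set.ncard_coe_finset,
      Fin.card_Iic] at h2

section Boxes

variable {r : ℕ} {k m : Fin r → ℕ}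

/-- The last index of a block. -/
def lastIdx {m : ℕ} (hm : 0 < m) : Fin m := ⟨m - 1, Nat.sub_lt hm Nat.one_pos⟩

lemma le_lastIdx {m : ℕ} (hm : 0 < m) (j : Fin m) : j ≤ lastIdx hm := by
  rw [Fin.le_def, lastIdx]
  have := j.2
  simp only
  omega

/-- The intervals of every block are disjoint and decreasing. -/
structure IsDecreasingBox (c d : (Σ i, Fin (m i)) → ℝ) : Prop where
  lt : ∀ a, c a < d a
  le : ∀ i (j j' : Fin (m i)), j < j' → d ⟨i, j'⟩ ≤ c ⟨i, j⟩

lemma IsDecreasingBox.last_le {c d : (Σ i, Fin (m i)) → ℝ} (h : IsDecreasingBox c d)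
    (hm : ∀ i, 0 < m i) (i : Fin r) (j : Fin (m i)) : c ⟨i, lastIdx (hm i)⟩ ≤ c ⟨i, j⟩ := by
  rcases (le_lastIdx (hm i) j).eq_or_lt with h' | h'
  · rw [← h']
  · exact (h.lt _).le.trans (h.le i _ _ h')

section

variable {V : Type*} {G : SimpleGraph V} {lo hi : (Σ i, Fin (m i)) → ℝ}
  {U U' : (Σ i, Fin (m i)) → Finset V}

/-- Disjoint decreasing intervals order the degrees within a block, and every other `k i`-set lies
below the lowest interval. Injectivity of `k` ensures that a set of size `k i` cannot belong to
another block. -/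
lemma jthMax_eq_of_mem_familyEvent [Finite V] (hbox : IsDecreasingBox lo hi) (hk : Function.Injective k)
    (hm : ∀ i, 0 < m i) (hU : ∀ a, (U a).card = k a.1)
    (hG : G ∈ familyEvent U k lo hi fun i => lo ⟨i, lastIdx (hm i)⟩) (a : Σ i, Fin (m i)) :
    jthMax G (k a.1) (a.2 + 1) = deg G (U a) := by
  obtain ⟨i, j⟩ := a
  refine jthMax_succ_eq (U := fun j => U ⟨i, j⟩) (fun j => hU ⟨i, j⟩) (fun j j' h => ?_)
    (fun X hX hXU j => ?_) j
  · have h1 := (hG.1 ⟨i, j'⟩).2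
    have h2 := (hG.1 ⟨i, j⟩).1
    have h3 := hbox.le i j j' h
    exact_mod_cast h1.trans_lt (h3.trans_lt h2)
  · have h1 := hG.2 i X hX fun b hb => by
      obtain ⟨i', j'⟩ := b
      have : i' = i := hk (by rw [← hX, hb, hU])
      subst this
      exact hXU j' hb
    have h2 := (hG.1 ⟨i, j⟩).1
    exact_mod_cast h1.trans_lt ((hbox.last_le hm i j).trans_lt h2)

/-- The graph determines the family: the sets above the lowest interval are exactly those of the
family, and their degrees tell their positions. Hence the events of different families are disjoint
and their probabilities add up. -/
lemma eq_of_mem_familyEvent (hbox : IsDecreasingBox lo hi) (hk : Function.Injective k)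
    (hm : ∀ i, 0 < m i) (hU : ∀ a, (U a).card = k a.1) (hU' : ∀ a, (U' a).card = k a.1)
    (hG : G ∈ familyEvent U k lo hi fun i => lo ⟨i, lastIdx (hm i)⟩)
    (hG' : G ∈ familyEvent U' k lo hi fun i => lo ⟨i, lastIdx (hm i)⟩) : U = U' := by
  funext ⟨i, j⟩
  have h1 := hG'.1 ⟨i, j⟩
  by_contra hne
  by_cases h : ∀ b, U' ⟨i, j⟩ ≠ U b
  · have := hG.2 i _ (hU' ⟨i, j⟩) h
    linarith [hbox.last_le hm i j]
  · push Not at h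
    obtain ⟨⟨i', j'⟩, hb⟩ := h
    have : i' = i := hk (by rw [← hU ⟨i', j'⟩, ← hb, hU'])
    subst this
    have h2 := hG.1 ⟨i', j'⟩
    rw [← hb] at h2
    rcases lt_trichotomy j j' with h | h | h
    · linarith [hbox.le _ _ _ h]
    · subst h; exact hne hb.symm
    · linarith [hbox.le _ _ _ h]

end

/-- The limit of the probability that the rescaled maxima lie in a decreasing box is at least the
expression below. -/
theorem exists_tendsto_le_measureReal_rescaledMaxima {p : unitInterval} (hp0 : 0 < (p : ℝ))
    (hp1 : (p : ℝ) < 1) (hk : ∀ i, 0 < k i) (hk_inj : Function.Injective k) (hm : ∀ i, 0 < m i)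
    {c d : (Σ i, Fin (m i)) → ℝ} (hbox : IsDecreasingBox c d) :
    ∃ f : ℕ → ℝ, Tendsto f atTop (𝓝 ((∏ a, (Real.exp (-c a) - Real.exp (-d a))) *
        ∏ i, Real.exp (-Real.exp (-c ⟨i, lastIdx (hm i)⟩)))) ∧
      ∀ᶠ n : ℕ in atTop, f n ≤ (SimpleGraph.binomialRandom (Fin n) p).real
        {G | ∀ a, rescaledMaxima p k m n G a ∈ Set.Ioc (c a) (d a)} := by
  classical
  obtain ⟨f, hf, hle⟩ := exists_tendsto_le_sum_measureReal_familyEvent hp0 hp1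
    (κ := fun a : Σ i, Fin (m i) => k a.1) (fun a => hk a.1) hk hbox.lt
    (fun i => c ⟨i, lastIdx (hm i)⟩)
  refine ⟨f, hf, ?_⟩
  filter_upwards [hle, eventually_ge_atTop 2] with n hle hn
  refine hle.trans ?_
  have hs : ∀ i, 0 < scale p n (k i) := fun i => scale_pos hp0 hp1 (hk i) hn
  have hbox' : IsDecreasingBox (fun a : Σ i, Fin (m i) => center p n (k a.1) + scale p n (k a.1) * c a)
      (fun a => center p n (k a.1) + scale p n (k a.1) * d a) :=
    ⟨fun a => by have := hbox.lt a; have := hs a.1; gcongr,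
      fun i j j' h => by have := hbox.le i j j' h; have := hs i; gcongr⟩
  rw [← measureReal_biUnion_finset _ fun _ _ => .of_discrete]
  · refine measureReal_mono (Set.iUnion₂_subset fun U hU G hG a => ?_) (measure_ne_top _ _)
    have hUc := (mem_disjointFamilies.1 hU).1
    have hj := jthMax_eq_of_mem_familyEvent hbox' hk_inj hm hUc hG a
    have h := hG.1 a
    have hsa := hs a.1
    unfold rescaledMaxima
    rw [hj, Set.mem_Ioc, lt_div_iff₀ hsa, div_le_iff₀ hsa]
    constructor <;> linarith [h.1, h.2]
  · intro U hU U' hU' hne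
    rw [Function.onFun, Set.disjoint_left]
    intro G hG hG'
    exact hne (eq_of_mem_familyEvent hbox' hk_inj hm (mem_disjointFamilies.1 hU).1
      (mem_disjointFamilies.1 hU').1 hG hG')

end Boxes

end CommonNbr

namespace CommonNbr

/-! ### The Gumbel density and its integrals. -/

section Gumbel

lemma hasDerivAt_gumbel (t : ℝ) : HasDerivAt (fun t => Real.exp (-Real.exp (-t)))
    (Real.exp (-t) * Real.exp (-Real.exp (-t))) t := by
  have h1 : HasDerivAt (fun t : ℝ => -t) (-1) t := hasDerivAt_neg' t
  have h2 : HasDerivAt (fun t => -Real.exp (-t)) (Real.exp (-t)) t :=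
    h1.exp.fun_neg.congr_deriv (by ring)
  exact h2.exp.congr_deriv (mul_comm _ _)

lemma lintegral_Iic_gumbel (a : ℝ) :
    ∫⁻ t in Set.Iic a, ENNReal.ofReal (Real.exp (-t) * Real.exp (-Real.exp (-t))) =
      ENNReal.ofReal (Real.exp (-Real.exp (-a))) := by
  set ν := (volume : Measure ℝ).withDensity fun t =>
    ENNReal.ofReal (Real.exp (-t) * Real.exp (-Real.exp (-t))) with hν
  have hcont : Continuous fun t : ℝ => Real.exp (-t) * Real.exp (-Real.exp (-t)) := by fun_prop
  have h1 : ∀ b ≤ a, ν (Set.Ioc b a) =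
      ENNReal.ofReal (Real.exp (-Real.exp (-a)) - Real.exp (-Real.exp (-b))) := by
    intro b hb
    rw [hν, withDensity_apply _ measurableSet_Ioc, ← ofReal_integral_eq_lintegral_ofReal
      (hcont.integrableOn_Ioc) (.of_forall fun t => by positivity),
      ← intervalIntegral.integral_of_le hb,
      intervalIntegral.integral_eq_sub_of_hasDerivAt (fun t _ => hasDerivAt_gumbel t)
        (hcont.intervalIntegrable _ _)]
  have h2 : Tendsto (fun b => ν (Set.Ioc b a)) atBot (𝓝 (ν (Set.Iic a))) :=
    tendsto_measure_Ioc_atBot ν a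
  have h3 : Tendsto (fun b => ν (Set.Ioc b a)) atBot
      (𝓝 (ENNReal.ofReal (Real.exp (-Real.exp (-a)) - 0))) := by
    have h : Tendsto (fun b : ℝ => Real.exp (-Real.exp (-b))) atBot (𝓝 0) :=
      Real.tendsto_exp_neg_atTop_nhds_zero.comp (Real.tendsto_exp_atTop.comp tendsto_neg_atBot_atTop)
    refine ((ENNReal.continuous_ofReal.tendsto _).comp (h.const_sub _)).congr' ?_
    filter_upwards [eventually_le_atBot a] with b hb
    exact (h1 b hb).symm
  rw [← withDensity_apply _ measurableSet_Iic, ← hν, tendsto_nhds_unique h2 h3, sub_zero]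

lemma lintegral_gumbel :
    ∫⁻ t, ENNReal.ofReal (Real.exp (-t) * Real.exp (-Real.exp (-t))) = 1 := by
  set ν := (volume : Measure ℝ).withDensity fun t =>
    ENNReal.ofReal (Real.exp (-t) * Real.exp (-Real.exp (-t))) with hν
  have h2 : Tendsto (fun a => ν (Set.Iic a)) atTop (𝓝 (ν Set.univ)) := tendsto_measure_Iic_atTop ν
  have h3 : Tendsto (fun a => ν (Set.Iic a)) atTop (𝓝 (ENNReal.ofReal (Real.exp (-0)))) := by
    have h : Tendsto (fun a : ℝ => Real.exp (-Real.exp (-a))) atTop (𝓝 (Real.exp (-0))) :=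
      Real.tendsto_exp_neg_atTop_nhds_zero.neg.rexp
    refine ((ENNReal.continuous_ofReal.tendsto _).comp h).congr fun a => ?_
    rw [Function.comp, hν, withDensity_apply _ measurableSet_Iic, lintegral_Iic_gumbel]
  have := tendsto_nhds_unique h2 h3
  rwa [hν, withDensity_apply _ MeasurableSet.univ, setLIntegral_univ, neg_zero, Real.exp_zero,
    ENNReal.ofReal_one] at this

end Gumbel

/-! ### The limit law is a probability measure. -/

section Density

lemma blockDensity_nonneg {m : ℕ} (hm : 0 < m) (y : Fin m → ℝ) : 0 ≤ blockDensity hm y :=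
  Set.indicator_nonneg (fun z _ => by positivity) y

lemma measurable_blockDensity {m : ℕ} (hm : 0 < m) : Measurable (blockDensity hm) := by
  refine Measurable.indicator (by fun_prop) ?_
  have : {z : Fin m → ℝ | Antitone z} = ⋂ i, ⋂ j, ⋂ _ : i ≤ j, {z | z j ≤ z i} := by
    ext z; simp [Antitone]
  rw [this]
  exact .iInter fun i => .iInter fun j => .iInter fun _ =>
    measurableSet_le (measurable_pi_apply _) (measurable_pi_apply _)

lemma antitone_snoc_iff {m : ℕ} (y : Fin (m + 1) → ℝ) (t : ℝ) :
    Antitone (Fin.snoc y t : Fin (m + 2) → ℝ) ↔ Antitone y ∧ t ≤ y (Fin.last m) := by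
  rw [Fin.antitone_iff_succ_le, Fin.antitone_iff_succ_le]
  constructor
  · intro h
    refine ⟨fun j => ?_, ?_⟩
    · have := h j.castSucc
      rwa [Fin.succ_castSucc, Fin.snoc_castSucc, Fin.snoc_castSucc] at this
    · have := h (Fin.last m)
      rwa [Fin.succ_last, Fin.snoc_last, Fin.snoc_castSucc] at this
  · rintro ⟨h1, h2⟩ i
    induction i using Fin.lastCases with
    | last => rwa [Fin.succ_last, Fin.snoc_last, Fin.snoc_castSucc]
    | cast j => rw [Fin.succ_castSucc, Fin.snoc_castSucc, Fin.snoc_castSucc]; exact h1 j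

lemma blockDensity_snoc {m : ℕ} (hm : 0 < m + 2) (y : Fin (m + 1) → ℝ) (t : ℝ) :
    ENNReal.ofReal (blockDensity hm (Fin.snoc y t : Fin (m + 2) → ℝ)) =
      {z : Fin (m + 1) → ℝ | Antitone z}.indicator
        (fun z => ENNReal.ofReal (∏ j, Real.exp (-z j))) y *
      (Set.Iic (y (Fin.last m))).indicator
        (fun t => ENNReal.ofReal (Real.exp (-t) * Real.exp (-Real.exp (-t)))) t := by
  unfold blockDensity
  have hl : (⟨m + 2 - 1, Nat.sub_lt hm Nat.one_pos⟩ : Fin (m + 2)) =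
    Fin.last (m + 1) := rfl
  by_cases h1 : Antitone y
  · by_cases h2 : t ≤ y (Fin.last m)
    · rw [Set.indicator_of_mem (show _ ∈ {z | Antitone z} from (antitone_snoc_iff y t).2 ⟨h1, h2⟩),
        Set.indicator_of_mem (show y ∈ {z | Antitone z} from h1),
        Set.indicator_of_mem (show t ∈ Set.Iic _ from h2),
        ← ENNReal.ofReal_mul (by positivity), Fin.prod_univ_castSucc, hl]
      simp only [Fin.snoc_castSucc, Fin.snoc_last]
      rw [mul_assoc]
    · rw [Set.indicator_of_notMem (show _ ∉ {z | Antitone z} from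
        fun h => h2 ((antitone_snoc_iff y t).1 h).2), Set.indicator_of_notMem (show t ∉ Set.Iic _ from h2)]
      simp
  · rw [Set.indicator_of_notMem (show _ ∉ {z | Antitone z} from
        fun h => h1 ((antitone_snoc_iff y t).1 h).1),
        Set.indicator_of_notMem (show y ∉ {z | Antitone z} from h1)]
    simp

/-- Integrating out the last coordinate over `(-∞, y_last]` gives `exp (-exp (-y_last))`, the final
factor of the block density with one coordinate less. The base case is the Gumbel density. -/
lemma lintegral_blockDensity_succ {m : ℕ} (hm : 0 < m + 1) :
    ∫⁻ y, ENNReal.ofReal (blockDensity hm y) = 1 := by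
  induction m with
  | zero =>
    change ∫⁻ y : Fin 1 → ℝ, ENNReal.ofReal (blockDensity hm y) = 1
    refine ((volume_preserving_funUnique (Fin 1) ℝ).symm.lintegral_comp_emb
      (MeasurableEquiv.measurableEmbedding _)
      fun y => ENNReal.ofReal (blockDensity hm y)).symm.trans ?_
    rw [← lintegral_gumbel]
    refine lintegral_congr fun t => ?_
    congr 1
    unfold blockDensity
    rw [Set.indicator_of_mem (show _ ∈ {z : Fin 1 → ℝ | Antitone z} from
      Subsingleton.antitone (α := Fin 1) _)]
    simp [MeasurableEquiv.funUnique]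
  | succ m ih =>
    have hmeas : Measurable fun x : ℝ × (Fin (m + 1) → ℝ) => ENNReal.ofReal (blockDensity hm
        ((MeasurableEquiv.piFinSuccAbove (fun _ : Fin (m + 2) => ℝ) (Fin.last (m + 1))).symm x)) :=
      ((measurable_blockDensity hm).comp (MeasurableEquiv.measurable _)).ennreal_ofReal
    rw [← (volume_preserving_piFinSuccAbove (fun _ : Fin (m + 2) => ℝ)
      (Fin.last (m + 1))).symm.lintegral_comp_emb (MeasurableEquiv.measurableEmbedding _),
      Measure.volume_eq_prod, lintegral_prod_symm _ hmeas.aemeasurable,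
      ← ih m.succ_pos]
    refine lintegral_congr fun y => ?_
    have e : ∀ t : ℝ, (MeasurableEquiv.piFinSuccAbove (fun _ : Fin (m + 2) => ℝ)
        (Fin.last (m + 1))).symm (t, y) = (Fin.snoc y t : Fin (m + 2) → ℝ) := fun t =>
      Fin.insertNth_last' t y
    simp only [e]
    simp_rw [blockDensity_snoc]
    rw [lintegral_const_mul _ (Measurable.indicator (by fun_prop) measurableSet_Iic),
      lintegral_indicator measurableSet_Iic, lintegral_Iic_gumbel]
    unfold blockDensity
    by_cases h1 : Antitone y
    · rw [Set.indicator_of_mem (show y ∈ {z | Antitone z} from h1),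
        Set.indicator_of_mem (show y ∈ {z | Antitone z} from h1), ← ENNReal.ofReal_mul (by positivity)]
      rfl
    · rw [Set.indicator_of_notMem (show y ∉ {z | Antitone z} from h1),
        Set.indicator_of_notMem (show y ∉ {z | Antitone z} from h1)]
      simp

lemma integral_blockDensity {m : ℕ} (hm : 0 < m) : ∫ y, blockDensity hm y = 1 := by
  obtain ⟨m, rfl⟩ := Nat.exists_eq_succ_of_ne_zero hm.ne'
  rw [integral_eq_lintegral_of_nonneg_ae (.of_forall (blockDensity_nonneg _))
    (measurable_blockDensity _).aestronglyMeasurable, lintegral_blockDensity_succ]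
  rfl

lemma measurePreserving_sigmaCurry {r : ℕ} (m : Fin r → ℕ) :
    MeasurePreserving (MeasurableEquiv.piCurry fun (i : Fin r) (_ : Fin (m i)) => ℝ) := by
  have h : MeasurePreserving (MeasurableEquiv.piCurry fun (i : Fin r) (_ : Fin (m i)) => ℝ).symm := by
    refine ⟨MeasurableEquiv.measurable _, ?_⟩
    symm
    rw [volume_pi]
    refine Measure.pi_eq fun s hs => ?_
    rw [MeasurableEquiv.map_apply]
    have : (MeasurableEquiv.piCurry fun (i : Fin r) (_ : Fin (m i)) => ℝ).symm ⁻¹'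
        Set.univ.pi s = Set.univ.pi fun i => Set.univ.pi fun j => s ⟨i, j⟩ := by
      ext x
      simp only [Set.mem_preimage, Set.mem_univ_pi, Sigma.forall]
      rfl
    rw [this, volume_pi_pi, Fintype.prod_sigma]
    exact Finset.prod_congr rfl fun i _ => volume_pi_pi _
  exact h.symm

lemma integral_prod_blockDensity {r : ℕ} (m : Fin r → ℕ) (hm : ∀ i, 0 < m i) :
    ∫ x : (Σ i, Fin (m i)) → ℝ, ∏ i, blockDensity (hm i) (fun j => x ⟨i, j⟩) = 1 := by
  have h := (measurePreserving_sigmaCurry m).integral_comp (MeasurableEquiv.measurableEmbedding _)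
    fun y : (i : Fin r) → Fin (m i) → ℝ => ∏ i, blockDensity (hm i) (y i)
  refine h.trans ?_
  rw [integral_fintype_prod_volume_eq_prod fun i => blockDensity (hm i)]
  exact Finset.prod_eq_one fun i _ => integral_blockDensity (hm i)

/-- Total mass one is what allows lower bounds alone to identify the limit: no probability is left
over for anything else. -/
lemma isProbabilityMeasure_limitLaw {r : ℕ} (m : Fin r → ℕ) (hm : ∀ i, 0 < m i) :
    IsProbabilityMeasure (limitLaw m hm) := by
  refine ⟨?_⟩
  have h := integral_prod_blockDensity m hm
  rw [limitLaw, withDensity_apply _ MeasurableSet.univ, setLIntegral_univ,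
    ← ofReal_integral_eq_lintegral_ofReal (integrable_of_integral_eq_one h)
      (.of_forall fun x => Finset.prod_nonneg fun i _ => blockDensity_nonneg _ _), h,
    ENNReal.ofReal_one]

end Density

end CommonNbr

/-! ### Approximation of open sets by grid boxes and weak convergence. -/

namespace CommonNbr

variable {r : ℕ} {k m : Fin r → ℕ}

lemma volume_setOf_eq_zero {ι : Type*} [Fintype ι] {a b : ι} (hab : a ≠ b) :
    volume {x : ι → ℝ | x a = x b} = 0 := by
  classical
  have h : {x : ι → ℝ | x a = x b} =
      (LinearMap.ker (LinearMap.proj (R := ℝ) (φ := fun _ : ι => ℝ) a - LinearMap.proj b) :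
        Submodule ℝ (ι → ℝ)) := by
    ext x
    simp [sub_eq_zero]
  rw [h]
  refine Measure.addHaar_submodule _ _ fun htop => ?_
  have : Pi.single a (1 : ℝ) ∈ LinearMap.ker
      (LinearMap.proj (R := ℝ) (φ := fun _ : ι => ℝ) a - LinearMap.proj b) := htop ▸ trivial
  simp [Pi.single_eq_of_ne hab.symm] at this

/-- Ties lie in proper subspaces, which are null. Away from them a decreasing block is strictly
decreasing, so that all sufficiently fine grid cells around the point are decreasing boxes. -/
lemma ae_injective_blocks (m : Fin r → ℕ) :
    ∀ᵐ x : (Σ i, Fin (m i)) → ℝ, ∀ i, Function.Injective fun j => x ⟨i, j⟩ := by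
  have h : ∀ i, ∀ j j' : Fin (m i), ∀ᵐ x : (Σ i, Fin (m i)) → ℝ,
      x ⟨i, j⟩ = x ⟨i, j'⟩ → j = j' := by
    intro i j j'
    by_cases hj : j = j'
    · exact .of_forall fun _ _ => hj
    · have := volume_setOf_eq_zero (a := (⟨i, j⟩ : Σ i, Fin (m i))) (b := ⟨i, j'⟩)
        (fun h => hj (by simpa using h))
      rw [← compl_mem_ae_iff] at this
      filter_upwards [this] with x hx h
      exact absurd h hx
  filter_upwards [eventually_countable_forall.2 fun i => eventually_countable_forall.2 fun j =>
    eventually_countable_forall.2 fun j' => h i j j'] with x hx i j j' hjj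
  exact hx i j j' hjj

lemma prod_blockDensity_of_strictAnti (hm : ∀ i, 0 < m i) {x : (Σ i, Fin (m i)) → ℝ}
    (hx : ∀ i, StrictAnti fun j => x ⟨i, j⟩) :
    ∏ i, blockDensity (hm i) (fun j => x ⟨i, j⟩) =
      (∏ a, Real.exp (-x a)) * ∏ i, Real.exp (-Real.exp (-x ⟨i, lastIdx (hm i)⟩)) := by
  rw [Fintype.prod_sigma, ← Finset.prod_mul_distrib]
  refine Finset.prod_congr rfl fun i _ => ?_
  unfold blockDensity
  rw [Set.indicator_of_mem (show _ ∈ {z : Fin (m i) → ℝ | Antitone z} from (hx i).antitone)]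
  rfl

/-- The cell of the grid of mesh `1 / (l + 1)` with index `z`. -/
def gridCell {ι : Type*} (l : ℕ) (z : ι → ℤ) : Set (ι → ℝ) :=
  {x | ∀ a, x a ∈ Set.Ioc (z a / ((l : ℝ) + 1)) ((z a + 1) / ((l : ℝ) + 1))}

/-- The index of the cell that contains `x`. -/
noncomputable def gridIndex {ι : Type*} (l : ℕ) (x : ι → ℝ) (a : ι) : ℤ := ⌈x a * (l + 1)⌉ - 1

section Grid

variable {ι : Type*} {l : ℕ}

lemma mem_gridCell_iff {x : ι → ℝ} {z : ι → ℤ} : x ∈ gridCell l z ↔ gridIndex l x = z := by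
  have hl : (0 : ℝ) < l + 1 := by positivity
  rw [funext_iff]
  refine forall_congr' fun a => ?_
  rw [Set.mem_Ioc, div_lt_iff₀ hl, le_div_iff₀ hl, gridIndex, sub_eq_iff_eq_add, Int.ceil_eq_iff]
  push_cast
  rw [add_sub_cancel_right]

lemma measurableSet_gridCell [Finite ι] (z : ι → ℤ) : MeasurableSet (gridCell l z) := by
  have : gridCell l z =
      Set.univ.pi fun a => Set.Ioc (z a / ((l : ℝ) + 1)) ((z a + 1) / ((l : ℝ) + 1)) := by
    ext x; simp [gridCell]
  rw [this]
  exact MeasurableSet.univ_pi fun a => measurableSet_Ioc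

lemma volume_gridCell [Fintype ι] (z : ι → ℤ) :
    volume (gridCell l z) = ENNReal.ofReal (∏ _a : ι, 1 / ((l : ℝ) + 1)) := by
  have : gridCell l z =
      Set.univ.pi fun a => Set.Ioc (z a / ((l : ℝ) + 1)) ((z a + 1) / ((l : ℝ) + 1)) := by
    ext x; simp [gridCell]
  rw [this, Real.volume_pi_Ioc, ENNReal.ofReal_prod_of_nonneg fun _ _ => by positivity]
  refine Finset.prod_congr rfl fun a _ => ?_
  rw [← sub_div, add_sub_cancel_left]

lemma tendsto_gridIndex_div (x : ι → ℝ) (a : ι) :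
    Tendsto (fun l : ℕ => (gridIndex l x a : ℝ) / (l + 1)) atTop (𝓝 (x a)) := by
  have h1 : Tendsto (fun l : ℕ => x a - 1 / ((l : ℝ) + 1)) atTop (𝓝 (x a)) := by
    simpa using tendsto_one_div_add_atTop_nhds_zero_nat.const_sub (x a)
  refine tendsto_of_tendsto_of_tendsto_of_le_of_le h1 tendsto_const_nhds (fun l => ?_) fun l => ?_
  · have hx : x ∈ gridCell l (gridIndex l x) := mem_gridCell_iff.2 rfl
    have := (hx a).2
    rw [add_div] at this
    simp only
    linarith
  · have hx : x ∈ gridCell l (gridIndex l x) := mem_gridCell_iff.2 rfl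
    exact (hx a).1.le

lemma tendsto_gridIndex_add_one_div (x : ι → ℝ) (a : ι) :
    Tendsto (fun l : ℕ => ((gridIndex l x a : ℝ) + 1) / (l + 1)) atTop (𝓝 (x a)) := by
  have := (tendsto_gridIndex_div x a).add tendsto_one_div_add_atTop_nhds_zero_nat
  rw [add_zero] at this
  exact this.congr fun l => (add_div _ _ _).symm

lemma eventually_gridCell_subset [Fintype ι] {O : Set (ι → ℝ)} (hO : IsOpen O) {x : ι → ℝ}
    (hx : x ∈ O) : ∀ᶠ l : ℕ in atTop, gridCell l (gridIndex l x) ⊆ O := by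
  obtain ⟨ε, hε, hball⟩ := Metric.isOpen_iff.1 hO x hx
  filter_upwards [tendsto_one_div_add_atTop_nhds_zero_nat.eventually (gt_mem_nhds hε)] with l hl y hy
  refine hball (Metric.mem_ball.2 (lt_of_le_of_lt ?_ hl))
  rw [dist_pi_le_iff (by positivity)]
  intro a
  have hx' : x ∈ gridCell l (gridIndex l x) := mem_gridCell_iff.2 rfl
  have h1 := hx' a
  have h2 := hy a
  rw [Set.mem_Ioc, add_div] at h1 h2
  rw [Real.dist_eq, abs_le]
  constructor <;> linarith [h1.1, h1.2, h2.1, h2.2]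

lemma eventually_gridIndex_mem [Fintype ι] [DecidableEq ι] (x : ι → ℝ) : ∀ᶠ l : ℕ in atTop,
    gridIndex l x ∈ Fintype.piFinset fun _ : ι => Finset.Icc (-((l : ℤ) + 1) ^ 2) (((l : ℤ) + 1) ^ 2) := by
  have h : ∀ a, ∀ᶠ l : ℕ in atTop, |(gridIndex l x a : ℝ) / (l + 1)| < l + 1 := fun a => by
    have h1 := (tendsto_gridIndex_div x a).abs.eventually (gt_mem_nhds (lt_add_one |x a|))
    filter_upwards [h1, tendsto_natCast_atTop_atTop.eventually_ge_atTop |x a|] with l h1 h2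
    linarith
  filter_upwards [eventually_all.2 h] with l hl
  rw [Fintype.mem_piFinset]
  intro a
  have hl0 : (0 : ℝ) < l + 1 := by positivity
  have := hl a
  rw [abs_div, abs_of_pos hl0, div_lt_iff₀ hl0, ← sq, abs_lt] at this
  rw [Finset.mem_Icc]
  constructor
  · have := this.1.le; exact_mod_cast this
  · have := this.2.le; exact_mod_cast this

end Grid

/-- A lower bound of the limiting probability of a decreasing box. -/
noncomputable def boxBound (hm : ∀ i, 0 < m i) (c d : (Σ i, Fin (m i)) → ℝ) : ℝ :=
  (∏ a, (Real.exp (-c a) - Real.exp (-d a))) *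
    ∏ i, Real.exp (-Real.exp (-c ⟨i, lastIdx (hm i)⟩))

lemma sub_mul_exp_neg_le {c d : ℝ} : (d - c) * Real.exp (-d) ≤ Real.exp (-c) - Real.exp (-d) := by
  have h := Real.add_one_le_exp (d - c)
  have e : Real.exp (-c) = Real.exp (d - c) * Real.exp (-d) := by rw [← Real.exp_add]; ring_nf
  rw [e]
  nlinarith [Real.exp_pos (-d)]

open Classical in
/-- The indices of the decreasing cells inside `O` in a large cube. -/
noncomputable def gridFinset (m : Fin r → ℕ) (O : Set ((Σ i, Fin (m i)) → ℝ)) (l : ℕ) :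
    Finset ((Σ i, Fin (m i)) → ℤ) :=
  {z ∈ Fintype.piFinset fun _ => Finset.Icc (-((l : ℤ) + 1) ^ 2) (((l : ℤ) + 1) ^ 2) |
    gridCell l z ⊆ O ∧ IsDecreasingBox (fun a => z a / ((l : ℝ) + 1))
      (fun a => (z a + 1) / ((l : ℝ) + 1))}

lemma eventually_gridIndex_mem_gridFinset {O : Set ((Σ i, Fin (m i)) → ℝ)} (hO : IsOpen O)
    {x : (Σ i, Fin (m i)) → ℝ} (hx : x ∈ O) (hxs : ∀ i, StrictAnti fun j => x ⟨i, j⟩) :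
    ∀ᶠ l in atTop, gridIndex l x ∈ gridFinset m O l := by
  classical
  have h : ∀ i, ∀ j j' : Fin (m i), ∀ᶠ l : ℕ in atTop, j < j' →
      ((gridIndex l x ⟨i, j'⟩ : ℝ) + 1) / (l + 1) ≤ (gridIndex l x ⟨i, j⟩ : ℝ) / (l + 1) := by
    intro i j j'
    by_cases hj : j < j'
    · filter_upwards [(tendsto_gridIndex_add_one_div x ⟨i, j'⟩).eventually_lt
        (tendsto_gridIndex_div x ⟨i, j⟩) (hxs i hj)] with l hl _
      exact hl.le
    · exact .of_forall fun _ h => absurd h hj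
  filter_upwards [eventually_gridCell_subset hO hx, eventually_gridIndex_mem x,
    eventually_all.2 fun i => eventually_all.2 fun j => eventually_all.2 fun j' => h i j j']
    with l h1 h2 h3
  rw [gridFinset, Finset.mem_filter]
  refine ⟨by convert h2, h1, fun a => ?_, fun i j j' hj => h3 i j j' hj⟩
  gcongr
  exact lt_add_one _

/-- The step functions `φ l` have integral at most the sum of the box bounds, and almost everywhere
in `O` their lower limit is at least the density; Fatou's lemma concludes. -/
theorem limitLaw_le_liminf_sum_boxBound (hm : ∀ i, 0 < m i) {O : Set ((Σ i, Fin (m i)) → ℝ)}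
    (hO : IsOpen O) : limitLaw m hm O ≤ liminf (fun l : ℕ => ENNReal.ofReal
      (∑ z ∈ gridFinset m O l, boxBound hm (fun a => z a / ((l : ℝ) + 1))
        (fun a => (z a + 1) / ((l : ℝ) + 1)))) atTop := by
  -- The factors `e^{-x}` are taken at upper endpoints, because `sub_mul_exp_neg_le` bounds the box
  -- increments that way; the Gumbel factors stay at lower endpoints, as in `boxBound`. Both
  -- endpoints converge to the point.
  set v : ℕ → ((Σ i, Fin (m i)) → ℤ) → ℝ := fun l z =>
    (∏ a, Real.exp (-((z a + 1) / ((l : ℝ) + 1)))) *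
      ∏ i, Real.exp (-Real.exp (-(z ⟨i, lastIdx (hm i)⟩ / ((l : ℝ) + 1)))) with hv
  set φ : ℕ → ((Σ i, Fin (m i)) → ℝ) → ENNReal := fun l x =>
    ∑ z ∈ gridFinset m O l, (gridCell l z).indicator (fun _ => ENNReal.ofReal (v l z)) x with hφ
  have hφm : ∀ l, Measurable (φ l) := fun l => Finset.measurable_fun_sum _ fun z _ =>
    measurable_const.indicator (measurableSet_gridCell z)
  have hφint : ∀ l, ∫⁻ x, φ l x ≤ ENNReal.ofReal (∑ z ∈ gridFinset m O l,
      boxBound hm (fun a => z a / ((l : ℝ) + 1)) (fun a => (z a + 1) / ((l : ℝ) + 1))) := by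
    intro l
    rw [hφ, lintegral_finsetSum _ fun z _ => measurable_const.indicator (measurableSet_gridCell z)]
    have hle : ∀ z : (Σ i, Fin (m i)) → ℤ, v l z * ∏ _a : (Σ i, Fin (m i)), 1 / ((l : ℝ) + 1) ≤
        boxBound hm (fun a => z a / ((l : ℝ) + 1)) (fun a => (z a + 1) / ((l : ℝ) + 1)) := by
      intro z
      rw [hv, boxBound, mul_right_comm, ← Finset.prod_mul_distrib]
      refine mul_le_mul_of_nonneg_right ?_ (by positivity)
      refine Finset.prod_le_prod (fun a _ => by positivity) fun a _ => ?_
      refine le_trans (le_of_eq ?_) sub_mul_exp_neg_le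
      rw [← sub_div, add_sub_cancel_left, mul_comm]
    have hv0 : ∀ z, 0 ≤ v l z := fun z => by rw [hv]; positivity
    rw [ENNReal.ofReal_sum_of_nonneg fun z _ =>
      le_trans (mul_nonneg (hv0 z) (by positivity)) (hle z)]
    refine Finset.sum_le_sum fun z _ => ?_
    rw [lintegral_indicator_const (measurableSet_gridCell z), volume_gridCell,
      ← ENNReal.ofReal_mul (hv0 z)]
    exact ENNReal.ofReal_le_ofReal (hle z)
  have hpt : ∀ᵐ x : (Σ i, Fin (m i)) → ℝ, O.indicator (fun x => ENNReal.ofReal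
      (∏ i, blockDensity (hm i) fun j => x ⟨i, j⟩)) x ≤ liminf (fun l => φ l x) atTop := by
    filter_upwards [ae_injective_blocks m] with x hx
    by_cases hxO : x ∈ O
    swap
    · rw [Set.indicator_of_notMem hxO]; exact zero_le
    rw [Set.indicator_of_mem hxO]
    by_cases hxa : ∀ i, Antitone fun j => x ⟨i, j⟩
    swap
    · push Not at hxa
      obtain ⟨i, hi⟩ := hxa
      rw [Finset.prod_eq_zero (Finset.mem_univ i), ENNReal.ofReal_zero]
      · exact zero_le
      · exact Set.indicator_of_notMem (show _ ∉ {z : Fin (m i) → ℝ | Antitone z} from hi) _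
    have hxs : ∀ i, StrictAnti fun j => x ⟨i, j⟩ := fun i => (hxa i).strictAnti_of_injective (hx i)
    rw [prod_blockDensity_of_strictAnti hm hxs]
    have hlim : Tendsto (fun l => ENNReal.ofReal (v l (gridIndex l x))) atTop (𝓝 (ENNReal.ofReal
        ((∏ a, Real.exp (-x a)) * ∏ i, Real.exp (-Real.exp (-x ⟨i, lastIdx (hm i)⟩))))) := by
      refine ENNReal.tendsto_ofReal (Tendsto.mul ?_ ?_)
      · exact tendsto_finsetProd _ fun a _ => (tendsto_gridIndex_add_one_div x a).neg.rexp
      · exact tendsto_finsetProd _ fun i _ => (tendsto_gridIndex_div x _).neg.rexp.neg.rexp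
    rw [← hlim.liminf_eq]
    refine liminf_le_liminf ?_
    filter_upwards [eventually_gridIndex_mem_gridFinset hO hxO hxs] with l hl
    refine le_trans (le_of_eq ?_) (Finset.single_le_sum (fun _ _ => zero_le) hl)
    rw [Set.indicator_of_mem (mem_gridCell_iff.2 rfl)]
  calc limitLaw m hm O = ∫⁻ x, O.indicator (fun x => ENNReal.ofReal
        (∏ i, blockDensity (hm i) fun j => x ⟨i, j⟩)) x := by
        rw [limitLaw, withDensity_apply _ hO.measurableSet, lintegral_indicator hO.measurableSet]
    _ ≤ ∫⁻ x, liminf (fun l => φ l x) atTop := lintegral_mono_ae hpt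
    _ ≤ liminf (fun l => ∫⁻ x, φ l x) atTop := lintegral_liminf_le hφm
    _ ≤ _ := liminf_le_liminf (.of_forall hφint)

/-- For fixed mesh there are finitely many cells, disjoint and contained in `O`, so their asymptotic
lower bounds add up. -/
theorem sum_boxBound_le_liminf {p : unitInterval} (hp0 : 0 < (p : ℝ)) (hp1 : (p : ℝ) < 1)
    (hk : ∀ i, 0 < k i) (hk_inj : Function.Injective k) (hm : ∀ i, 0 < m i)
    (O : Set ((Σ i, Fin (m i)) → ℝ)) (l : ℕ) :
    ENNReal.ofReal (∑ z ∈ gridFinset m O l, boxBound hm (fun a => z a / ((l : ℝ) + 1))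
      (fun a => (z a + 1) / ((l : ℝ) + 1))) ≤
    liminf (fun n : ℕ => SimpleGraph.binomialRandom (Fin n) p (rescaledMaxima p k m n ⁻¹' O))
      atTop := by
  classical
  have h : ∀ z : (Σ i, Fin (m i)) → ℤ, ∃ f : ℕ → ℝ, z ∈ gridFinset m O l →
      Tendsto f atTop (𝓝 (boxBound hm (fun a => z a / ((l : ℝ) + 1))
        (fun a => (z a + 1) / ((l : ℝ) + 1)))) ∧
      ∀ᶠ n : ℕ in atTop, f n ≤ (SimpleGraph.binomialRandom (Fin n) p).real
        (rescaledMaxima p k m n ⁻¹' gridCell l z) := by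
    intro z
    by_cases hz : z ∈ gridFinset m O l
    · rw [gridFinset, Finset.mem_filter] at hz
      obtain ⟨f, hf⟩ := exists_tendsto_le_measureReal_rescaledMaxima hp0 hp1 hk hk_inj hm hz.2.2
      exact ⟨f, fun _ => hf⟩
    · exact ⟨0, fun h => absurd h hz⟩
  choose f hf using h
  have hlim := ENNReal.tendsto_ofReal (tendsto_finsetSum _ fun z hz => (hf z hz).1)
  rw [← hlim.liminf_eq]
  refine liminf_le_liminf ?_
  filter_upwards [(eventually_all_finset (gridFinset m O l)).2 fun z hz => (hf z hz).2] with n hn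
  rw [← ofReal_measureReal]
  refine ENNReal.ofReal_le_ofReal ((Finset.sum_le_sum hn).trans ?_)
  rw [← measureReal_biUnion_finset _ fun _ _ => .of_discrete]
  · refine measureReal_mono (Set.iUnion₂_subset fun z hz => Set.preimage_mono ?_)
      (measure_ne_top _ _)
    rw [gridFinset, Finset.mem_filter] at hz
    exact hz.2.1
  · intro z _ z' _ hne
    refine Disjoint.preimage _ (Set.disjoint_left.2 fun x hx hx' => hne ?_)
    rw [← mem_gridCell_iff.1 hx, mem_gridCell_iff.1 hx']

end CommonNbr

theorem mainTheorem2 (p : unitInterval) (hp0 : 0 < p) (hp1 : p < 1)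
    (r : ℕ) (k m : Fin r → ℕ) (hk : ∀ i, 0 < k i) (hk_inj : Function.Injective k)
    (hm : ∀ i, 0 < m i) :
    ∃ _ : MeasureTheory.IsProbabilityMeasure (CommonNbr.limitLaw m hm),
      MeasureTheory.TendstoInDistribution
        (fun n : ℕ => CommonNbr.rescaledMaxima (p : ℝ) k m n)
        Filter.atTop
        (id : ((Σ i : Fin r, Fin (m i)) → ℝ) → ((Σ i : Fin r, Fin (m i)) → ℝ))
        (fun n : ℕ => SimpleGraph.binomialRandom (Fin n) p)
        (CommonNbr.limitLaw m hm) := by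
  have hprob := CommonNbr.isProbabilityMeasure_limitLaw m hm
  refine ⟨hprob, fun _ => Measurable.of_discrete.aemeasurable, aemeasurable_id, ?_⟩
  -- By the portmanteau theorem, lower bounds on open sets give convergence in distribution, the
  -- limit being a probability measure.
  refine tendsto_of_forall_isOpen_le_liminf' fun O hO => ?_
  simp only [ProbabilityMeasure.coe_mk, Measure.map_id]
  refine (CommonNbr.limitLaw_le_liminf_sum_boxBound hm hO).trans ?_
  refine (liminf_le_liminf (.of_forall fun l =>
    CommonNbr.sum_boxBound_le_liminf hp0 hp1 hk hk_inj hm O l)).trans ?_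
  -- The bound from `n → ∞` holds for every mesh and does not depend on `l`, so the lower limit over
  -- `l` disappears.
  rw [liminf_const]
  refine liminf_le_liminf (.of_forall fun n => ?_)
  rw [Measure.map_apply .of_discrete hO.measurableSet]
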